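/- Let $(M,J)$ be a $C^\infty$-smooth almost complex manifold (finite-dimensional, Hausdorff, $\sigma$-compact) and let $\mathbb D\subset\mathbb C$ be the open unit disc. Fix a smoothness class $X$, either $C^{k,\alpha}(\mathbb D)$ with $k\ge 1$, $0<\alpha<1$, or $W^{k,p}(\mathbb D)$ with $k\ge 1$, $2<p<\infty$. Let $\mathcal M$ be the set of all $J$-holomorphic discs of class $X$ in $M$, that is, of all $C^1$ maps $f:\mathbb D\to M$ with $df\circ J_{\rm st}=J\circ df$ such that $h\circ f$ is of class $X$ for every $h\in C^\infty(M,\mathbb R)$. For $f\in\mathcal M$ let the tangent space $T_f\mathcal M$ be the real vector space spanned by the vector fields $u$ along $f$ that are velocities at $f$ of curves in $\mathcal M$: there is a curve $\mathbb R\ni t\mapsto f_t\in\mathcal M$ with $f_0=f$ such that, for every $h\in C^\infty(M,\mathbb R)$, $\frac{d}{dt}\big|_{t=0}h(f_t(\zeta))=dh(u(\zeta))$ for all $\zeta\in\mathbb D$, and $\frac{h\circ f_t-h\circ f}{t}\to dh(u)$ in the norm of $X$ as $t\to0$. For $\zeta\in\mathbb D$ let $\Phi^\zeta:\mathcal M\to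 M$, $\Phi^\zeta(f)=f(\zeta)$, be the evaluation map, with differential $d\Phi^\zeta:T_f\mathcal M\to T_{f(\zeta)}M$, $u\mapsto u(\zeta)$. Suppose there is an almost complex structure $\mathcal J$ on $\mathcal M$, that is, a family of real-linear maps $\mathcal J_f:T_f\mathcal M\to T_f\mathcal M$, $f\in\mathcal M$, with $\mathcal J_f^2=-\mathrm{id}$ (neither continuity of $\mathcal J_f$ nor smooth dependence on $f$ is needed), such that every evaluation map $\Phi^\zeta$, $\zeta\in\mathbb D$, is $(\mathcal J,J)$-holomorphic, that is, $d\Phi^\zeta\circ\mathcal J_f=J\circ d\Phi^\zeta$ on $T_f\mathcal M$ for all $f\in\mathcal M$. Then $J$ is integrable, that is, its Nijenhuis tensor $$N_J(V,W)=[JV,JW]-J[JV,W]-J[V,JW]-[V,W]$$ vanishes identically on $M$ (for all $C^\infty$ vector fields $V,W$). -/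

import Mathlib

open scoped Manifold ContDiff Topology

noncomputable section

namespace PseudoHolomorphic

/-! ## Almost complex manifolds

`M` is a smooth manifold modelled on a finite-dimensional real vector space `E`. -/

section AlmostComplex

variable (E : Type*) [NormedAddCommGroup E] [NormedSpace ℝ E]
  (M : Type*) [TopologicalSpace M] [ChartedSpace E M] [IsManifold 𝓘(ℝ, E) ∞ M]

/-- A `C^∞` almost complex structure on `M`: a smooth section `J` of `End(TM)` with
`J² = -id`. -/
structure AlmostComplexStructure where
  toFun : ∀ x : M, TangentSpace 𝓘(ℝ, E) x →L[ℝ] TangentSpace 𝓘(ℝ, E) x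
  sq_eq_neg : ∀ (x : M) (v : TangentSpace 𝓘(ℝ, E) x), toFun x (toFun x v) = -v
  smooth : ContMDiff 𝓘(ℝ, E) (𝓘(ℝ, E).prod 𝓘(ℝ, E →L[ℝ] E)) ∞
    (fun x => Bundle.TotalSpace.mk' (E →L[ℝ] E)
      (E := fun x : M => TangentSpace 𝓘(ℝ, E) x →L[ℝ] TangentSpace 𝓘(ℝ, E) x) x (toFun x))

variable {E M}

/-- `V` is a `C^∞` vector field on `M`. -/
def IsSmoothVectorField (V : ∀ x : M, TangentSpace 𝓘(ℝ, E) x) : Prop :=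
  ContMDiff 𝓘(ℝ, E) 𝓘(ℝ, E).tangent ∞
    (fun x => (⟨x, V x⟩ : TangentBundle 𝓘(ℝ, E) M))

namespace AlmostComplexStructure

/-- The vector field `J V`. -/
def apply (J : AlmostComplexStructure E M) (V : ∀ x : M, TangentSpace 𝓘(ℝ, E) x) :
    ∀ x : M, TangentSpace 𝓘(ℝ, E) x :=
  fun x => J.toFun x (V x)

/-- The Nijenhuis tensor `N_J(V, W) = [JV, JW] - J[JV, W] - J[V, JW] - [V, W]`. -/
def nijenhuis (J : AlmostComplexStructure E M) (V W : ∀ x : M, TangentSpace 𝓘(ℝ, E) x) (x : M) :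
    TangentSpace 𝓘(ℝ, E) x :=
  VectorField.mlieBracket 𝓘(ℝ, E) (J.apply V) (J.apply W) x
    - J.toFun x (VectorField.mlieBracket 𝓘(ℝ, E) (J.apply V) W x)
    - J.toFun x (VectorField.mlieBracket 𝓘(ℝ, E) V (J.apply W) x)
    - VectorField.mlieBracket 𝓘(ℝ, E) V W x

/-- `J` is integrable: its Nijenhuis tensor vanishes identically. -/
def IsIntegrable (J : AlmostComplexStructure E M) : Prop :=
  ∀ V W : (∀ x : M, TangentSpace 𝓘(ℝ, E) x),
    IsSmoothVectorField V → IsSmoothVectorField W → ∀ x : M, J.nijenhuis V W x = 0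

end AlmostComplexStructure

end AlmostComplex

/-! ## Function spaces on the unit disc -/

/-- The open unit disc, as an open submanifold of `ℂ`. -/
def disc : TopologicalSpace.Opens ℂ := ⟨Metric.ball 0 1, Metric.isOpen_ball⟩

/-- Extension of a function on the disc by zero. Only its values on the disc matter below. -/
def extendByZero (g : disc → ℝ) : ℂ → ℝ := Function.extend Subtype.val g 0

/-- The `C^{k,α}` norm of `g` on the unit disc is at most `C`: `g` is `C^k` and its derivatives
of order `≤ k` are bounded by `C` and `α`-Hölder with constant `C`. (The maximum of sup norms and
Hölder seminorms; it is equivalent to any other usual choice of the norm.) -/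
def HolderNormLE (k : ℕ) (α : ℝ) (g : ℂ → ℝ) (C : ℝ) : Prop :=
  ContDiffOn ℝ k g disc ∧
  ∀ j ≤ k,
    (∀ z ∈ disc, ‖iteratedFDeriv ℝ j g z‖ ≤ C) ∧
    (∀ z ∈ disc, ∀ w ∈ disc,
      ‖iteratedFDeriv ℝ j g z - iteratedFDeriv ℝ j g w‖ ≤ C * ‖z - w‖ ^ α)

/-- `d` is the weak derivative of `g` on the unit disc in the direction `v`:
`∫ g ∂_v φ = - ∫ d φ` for all test functions `φ ∈ C_c^∞(disc)`. -/
def IsWeakPartial (v : ℂ) (g d : ℂ → ℝ) : Prop :=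
  ∀ φ : ℂ → ℝ, ContDiff ℝ ∞ φ → HasCompactSupport φ → tsupport φ ⊆ disc →
    ∫ z in (disc : Set ℂ), g z * fderiv ℝ φ z v = - ∫ z in (disc : Set ℂ), d z * φ z

/-- `g ∈ L^p(disc)` with norm at most `C`. -/
def LpNormLE (p : ℝ) (g : ℂ → ℝ) (C : ℝ) : Prop :=
  MeasureTheory.MemLp g (ENNReal.ofReal p) (MeasureTheory.volume.restrict (disc : Set ℂ)) ∧
  MeasureTheory.eLpNorm g (ENNReal.ofReal p) (MeasureTheory.volume.restrict (disc : Set ℂ))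
    ≤ ENNReal.ofReal C

/-- The `W^{k,p}` norm of `g` on the unit disc is at most `C`: all weak partial derivatives of `g`
of order `≤ k` exist and have `L^p` norm at most `C`. (The maximum of the `L^p` norms; it is
equivalent to any other usual choice of the norm.) The partial derivatives with respect to the
real coordinates `ξ`, `η` of `ζ = ξ + iη` are those in the directions `1` and `i`. -/
def SobolevNormLE (p : ℝ) : ℕ → (ℂ → ℝ) → ℝ → Prop
  | 0, g, C => LpNormLE p g C
  | k + 1, g, C => LpNormLE p g C ∧ ∃ g₁ g₂ : ℂ → ℝ,
      IsWeakPartial 1 g g₁ ∧ IsWeakPartial Complex.I g g₂ ∧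
      SobolevNormLE p k g₁ C ∧ SobolevNormLE p k g₂ C

/-- The smoothness classes under consideration: `C^{k,α}` with `k ≥ 1`, `0 < α < 1`, and
`W^{k,p}` with `k ≥ 1`, `2 < p < ∞`. -/
inductive SmoothnessClass : Type
  | holder (k : ℕ) (α : ℝ) (hk : 1 ≤ k) (hα₀ : 0 < α) (hα₁ : α < 1) : SmoothnessClass
  | sobolev (k : ℕ) (p : ℝ) (hk : 1 ≤ k) (hp : 2 < p) : SmoothnessClass

/-- The norm of `g : disc → ℝ` in the Banach space of real functions of class `X` is at
most `C`. -/
def SmoothnessClass.NormLE (X : SmoothnessClass) (g : disc → ℝ) (C : ℝ) : Prop :=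
  match X with
  | .holder k α _ _ _ => HolderNormLE k α (extendByZero g) C
  | .sobolev k p _ _ => SobolevNormLE p k (extendByZero g) C

/-! ## The manifold of `J`-holomorphic discs -/

section Discs

variable {E : Type*} [NormedAddCommGroup E] [NormedSpace ℝ E]
  {M : Type*} [TopologicalSpace M] [ChartedSpace E M] [IsManifold 𝓘(ℝ, E) ∞ M]

/-- The set `𝓜` of `J`-holomorphic discs of class `X` in `M`: continuously differentiable maps
`f` from the open unit disc to `M` with `df ∘ J_st = J ∘ df`, which are of class `X` on the disc.
A map into `M` is of class `X` if its composition with every `C^∞` function `h : M → ℝ` is; this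
amounts to being of class `X` up to the boundary in charts, and it forces the image to be
relatively compact in `M`. -/
structure JDisc (X : SmoothnessClass) (J : AlmostComplexStructure E M) where
  toFun : disc → M
  contMDiff : ContMDiff 𝓘(ℝ, ℂ) 𝓘(ℝ, E) 1 toFun
  cauchyRiemann : ∀ (ζ : disc) (v : ℂ),
    mfderiv 𝓘(ℝ, ℂ) 𝓘(ℝ, E) toFun ζ (Complex.I * v : ℂ)
      = J.toFun (toFun ζ) (mfderiv 𝓘(ℝ, ℂ) 𝓘(ℝ, E) toFun ζ v)
  memClass : ∀ h : M → ℝ, ContMDiff 𝓘(ℝ, E) 𝓘(ℝ, ℝ) ∞ h →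
    ∃ C : ℝ, X.NormLE (fun ζ => h (toFun ζ)) C

/-- The differential `dh(v)` of a real function `h` on `M` at `x`, applied to a tangent vector. -/
def differential (h : M → ℝ) (x : M) (v : TangentSpace 𝓘(ℝ, E) x) : ℝ :=
  mfderiv 𝓘(ℝ, E) 𝓘(ℝ, ℝ) h x v

namespace JDisc

variable {X : SmoothnessClass} {J : AlmostComplexStructure E M}

/-- The evaluation map `Φ^ζ : 𝓜 → M`, `f ↦ f(ζ)`. -/
def eval (ζ : disc) (f : JDisc X J) : M := f.toFun ζ

/-- Vector fields along the disc `f`, i.e. sections of `f^*TM`. -/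
abbrev FieldAlong (f : JDisc X J) : Type _ :=
  ∀ ζ : disc, TangentSpace 𝓘(ℝ, E) (eval ζ f)

/-- The curve `t ↦ c t` in `𝓜` passes through `f` at `t = 0` and is differentiable there as a
curve in the Banach manifold of all discs of class `X` in `M`, with velocity the vector field
`u = d/dt|₀ c t` along `f`. In terms of `C^∞` functions `h` on `M`: at each point `ζ` one has
`d/dt|₀ h(c t (ζ)) = dh(u(ζ))`, and the difference quotients of `t ↦ h ∘ c t` at `0` converge to
`dh(u)` in the norm of the class `X`. -/
def HasVelocity (c : ℝ → JDisc X J) (f : JDisc X J) (u : FieldAlong f) : Prop :=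
  c 0 = f ∧
  ∀ h : M → ℝ, ContMDiff 𝓘(ℝ, E) 𝓘(ℝ, ℝ) ∞ h →
    (∀ ζ : disc, HasDerivAt (fun t : ℝ => h (eval ζ (c t)))
      (differential h (eval ζ f) (u ζ)) 0) ∧
    ∀ ε : ℝ, 0 < ε → ∀ᶠ t : ℝ in 𝓝[≠] 0,
      X.NormLE (fun ζ => t⁻¹ * (h (eval ζ (c t)) - h (eval ζ f))
        - differential h (eval ζ f) (u ζ)) ε

/-- The tangent space `T_f 𝓜`: the vector fields along `f` that are velocities at `f` of curves
of `J`-holomorphic discs of class `X`. (These already form a linear subspace; the span makes this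
visible in the type.) -/
def tangent (f : JDisc X J) : Submodule ℝ (FieldAlong f) :=
  Submodule.span ℝ {u | ∃ c : ℝ → JDisc X J, HasVelocity c f u}

/-- The differential `dΦ^ζ : T_f 𝓜 → T_{f(ζ)} M` of the evaluation map at `ζ`. It sends the
velocity `u` of a curve `t ↦ c t` of discs to the velocity `u ζ` of the curve `t ↦ c t (ζ)`. -/
def evalDifferential (ζ : disc) (f : JDisc X J) :
    tangent f →ₗ[ℝ] TangentSpace 𝓘(ℝ, E) (eval ζ f) :=
  (LinearMap.proj ζ).comp (tangent f).subtype

variable (X J) in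
/-- An almost complex structure on `𝓜`: linear endomorphisms `𝒥_f` of the tangent spaces
`T_f 𝓜` with `𝒥_f² = -id`. Neither boundedness of `𝒥_f` nor smooth dependence on `f` is
required. -/
structure AlmostComplexStructureOnDiscs where
  toFun : ∀ f : JDisc X J, tangent f →ₗ[ℝ] tangent f
  sq_eq_neg : ∀ (f : JDisc X J) (u : tangent f), toFun f (toFun f u) = -u

/-- The evaluation map `Φ^ζ` is `(𝒥, J)`-holomorphic: `dΦ^ζ ∘ 𝒥 = J ∘ dΦ^ζ`. -/
def AlmostComplexStructureOnDiscs.EvalIsHolomorphic (𝒥 : AlmostComplexStructureOnDiscs X J)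
    (ζ : disc) : Prop :=
  ∀ (f : JDisc X J) (u : tangent f),
    evalDifferential ζ f (𝒥.toFun f u) = J.toFun (eval ζ f) (evalDifferential ζ f u)

end JDisc

end Discs

end PseudoHolomorphic

end

/-! Holomorphy of all evaluation maps says that the structure on the space of discs acts pointwise:
at each `ζ`, the field `𝒥 u` takes the value `J (u ζ)`. Tangent vectors at a disc satisfy the
linearised Cauchy-Riemann equation. In a chart, for a disc `y` and a field `η` along it, this reads
`∂_I η = J ∂_1 η + (dJ η) ∂_1 y`. Hence both `η` and `Jη` solve it. If the equation for `η` is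
inserted into the equation for `Jη`, the derivatives of `η` cancel because `J² = -1`, and what
remains is exactly `N_J(∂_1 y, η) = 0` (`nijenhuisForm_eq_zero_of_disc_family`).

It remains to realise enough pairs `(∂_1 y, η)` at a given point `p`. Exact prescription is
unnecessary. For small `ε > 0` there is a one-parameter family of discs `p + ε F`, with `F` bounded
and with derivatives at the centre within `O(ε)` of two prescribed vectors
(`WienerTorus.exists_disc_family`). The Nijenhuis form is bilinear, so the factor `ε²` can be
divided out. It is also continuous, so `ε → 0` gives its vanishing on arbitrary vectors at `p`
(`nijenhuisForm_inChart_eq_zero`).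

The family solves `∂_0 u + (J_0 + A(ε u)) ∂_1 u = 0` with `A(0) = 0`. The family parameter is
treated as a third torus variable, so regularity in it comes at no extra cost. One writes `u = P + S
φ`, with `P` a linear solution near the origin and `S` a right inverse of the constant coefficient
operator there, and solves `φ = -A(ε u) ∂_1 u` by contraction (`exists_quasilinear_fixedPoint`). The
norms are weighted `ℓ¹` norms of Fourier coefficients. They are submultiplicative, bounded Fourier
multipliers act on them trivially, and smooth functions act in a locally Lipschitz way
(`exists_wnorm_comp_sub_le`), so no singular integral estimates are needed.

The linearised equation needs care, since `𝒥 u` is only known to lie in the span of velocities and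
velocities have only the regularity of the class. Both kinds of class embed in `W^{1,2}`. There the
equation can be differentiated in weak form along a curve of discs
(`SobolevDifferentiable.tendsto_integral_mul_fderiv`). The weak form is linear, hence passes to the
span. For the discs constructed above, `u` and `J u` are `C^1`, so it then holds pointwise
(`JDisc.linearised_cauchyRiemann`). Bump functions turn the Cauchy-Riemann system of a chart into
equations between global smooth functions, valid along every disc, including discs that leave the
chart. -/

noncomputable section

namespace WienerTorus

open scoped ENNReal NNReal ContDiff
open UnitAddTorus MeasureTheory

/-! ### Fourier coefficients and weighted Wiener algebras on the three-torus. -/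

section

attribute [local instance] instMeasureSpaceUnitAddCircle

instance : IsProbabilityMeasure (volume : Measure UnitAddCircle) :=
  inferInstanceAs (IsProbabilityMeasure AddCircle.haarAddCircle)

instance : Measure.IsAddHaarMeasure (volume : Measure UnitAddCircle) :=
  inferInstanceAs (Measure.IsAddHaarMeasure AddCircle.haarAddCircle)

/-- The three-dimensional torus. -/
abbrev T3 : Type := UnitAddTorus (Fin 3)

/-- The Fourier coefficient functional. -/
def fc (n : Fin 3 → ℤ) : C(T3, ℂ) →L[ℂ] ℂ :=
  LinearMap.mkContinuous
    { toFun := fun u => mFourierCoeff u n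
      map_add' := fun u v => by
        simp only [mFourierCoeff, ContinuousMap.add_apply, smul_add]
        exact integral_add (Continuous.integrable_of_hasCompactSupport (by fun_prop)
            (HasCompactSupport.of_compactSpace _))
          (Continuous.integrable_of_hasCompactSupport (by fun_prop)
            (HasCompactSupport.of_compactSpace _))
      map_smul' := fun c u => by
        simp only [mFourierCoeff, ContinuousMap.smul_apply, smul_eq_mul, RingHom.id_apply]
        rw [← integral_const_mul]
        congr 1; ext t; ring } 1 (fun u => by
    simp only [LinearMap.coe_mk, AddHom.coe_mk, mFourierCoeff, one_mul]
    refine (norm_integral_le_of_norm_le_const (C := ‖u‖) (Filter.Eventually.of_forall fun t => ?_)).trans ?_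
    · rw [norm_smul]
      calc _ ≤ ‖(mFourier (-n) : C(T3,ℂ))‖ * ‖u‖ := by
              gcongr <;> exact ContinuousMap.norm_coe_le_norm _ _
        _ = _ := by rw [mFourier_norm, one_mul]
    · simp)

lemma fc_apply (n : Fin 3 → ℤ) (u : C(T3, ℂ)) : fc n u = mFourierCoeff u n := rfl

lemma norm_fc_le (n : Fin 3 → ℤ) (u : C(T3, ℂ)) : ‖fc n u‖ ≤ ‖u‖ := by
  have := (fc n).le_of_opNorm_le (LinearMap.mkContinuous_norm_le _ zero_le_one _) u
  simpa using this

lemma fc_mFourier (n m : Fin 3 → ℤ) : fc n (mFourier m) = if n = m then 1 else 0 := by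
  have := orthonormal_iff_ite.1 (orthonormal_mFourier (d := Fin 3)) n m
  rw [← this, fc_apply, ContinuousMap.inner_toLp, mFourierCoeff]
  simp [mFourier_neg, mul_comm]

/-- The quotient map from `ℝ³` to the torus. -/
def toTorus (x : Fin 3 → ℝ) : T3 := fun i => (x i : UnitAddCircle)

lemma continuous_toTorus : Continuous toTorus := by
  unfold toTorus; fun_prop

lemma toTorus_surjective : Function.Surjective toTorus := fun t =>
  ⟨fun i => (QuotientAddGroup.mk_surjective (t i)).choose,
    funext fun i => (QuotientAddGroup.mk_surjective (t i)).choose_spec⟩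

lemma isOpenQuotientMap_toTorus : IsOpenQuotientMap toTorus :=
  IsOpenQuotientMap.piMap (fun _ : Fin 3 => QuotientAddGroup.isOpenQuotientMap_mk)

lemma toTorus_add (x y : Fin 3 → ℝ) : toTorus (x + y) = toTorus x + toTorus y := rfl

/-- The phase `2πi ⟨n, x⟩`. -/
def phase (n : Fin 3 → ℤ) : (Fin 3 → ℝ) →L[ℝ] ℂ :=
  ∑ j, (2 * Real.pi * Complex.I * n j : ℂ) • (Complex.ofRealCLM.comp (ContinuousLinearMap.proj j))

lemma phase_apply (n : Fin 3 → ℤ) (x : Fin 3 → ℝ) :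
    phase n x = ∑ j, (2 * Real.pi * Complex.I * n j : ℂ) * x j := by
  simp [phase]

lemma phase_single (n : Fin 3 → ℤ) (j : Fin 3) (h : ℝ) :
    phase n (Pi.single j h) = 2 * Real.pi * Complex.I * n j * h := by
  rw [phase_apply, Finset.sum_eq_single j] <;> simp +contextual

lemma mFourier_toTorus (n : Fin 3 → ℤ) (x : Fin 3 → ℝ) :
    mFourier n (toTorus x) = Complex.exp (phase n x) := by
  simp only [mFourier, ContinuousMap.coe_mk, toTorus, phase_apply, Complex.exp_sum]
  refine Finset.prod_congr rfl fun j _ => ?_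
  rw [fourier_coe_apply]; simp

/-- Translation of a function on the torus. -/
def translate (a : T3) (u : C(T3, ℂ)) : C(T3, ℂ) := u.comp ⟨fun t => t + a, by fun_prop⟩

/-- Invariance of Haar measure moves the translation onto the character. This is what allows a
derivative to be computed on Fourier coefficients in `fc_of_fderiv`. -/
lemma fc_translate (n : Fin 3 → ℤ) (a : T3) (u : C(T3, ℂ)) :
    fc n (translate a u) = mFourier n a * fc n u := by
  have h := integral_add_right_eq_self (μ := (volume : Measure T3))
    (fun t => mFourier (-n) (t - a) • u t) a
  simp only [add_sub_cancel_right] at h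
  simp only [fc_apply, mFourierCoeff]
  change ∫ t, mFourier (-n) t • u (t + a) = _
  rw [h, ← integral_const_mul]
  congr 1; ext t
  have : mFourier (-n) (t - a) = mFourier n a * mFourier (-n) t := by
    simp only [mFourier, ContinuousMap.coe_mk, ← Finset.prod_mul_distrib]
    refine Finset.prod_congr rfl fun j _ => ?_
    rw [Pi.sub_apply, Pi.neg_apply, sub_eq_add_neg, fourier_apply, fourier_apply, fourier_apply, smul_add,
      AddCircle.toCircle_add]
    simp [mul_comm]
  rw [this, smul_eq_mul, smul_eq_mul, mul_assoc]

/-! ### Weighted Wiener norms -/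

/-- The weight `1 + |n|₁`. -/
def wt (n : Fin 3 → ℤ) : ℕ := 1 + ∑ j, (n j).natAbs

lemma one_le_wt (n : Fin 3 → ℤ) : 1 ≤ wt n := Nat.le_add_right _ _

/-- Submultiplicativity of the weight is what makes every `wnorm s` an algebra norm. -/
lemma wt_add_le (m n : Fin 3 → ℤ) : wt (m + n) ≤ wt m * wt n := by
  have h : ∑ j, ((m + n) j).natAbs ≤ ∑ j, (m j).natAbs + ∑ j, (n j).natAbs := by
    rw [← Finset.sum_add_distrib]
    exact Finset.sum_le_sum fun j _ => Int.natAbs_add_le _ _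
  unfold wt
  nlinarith [Nat.zero_le ((∑ j, (m j).natAbs) * ∑ j, (n j).natAbs)]

lemma wt_neg (n : Fin 3 → ℤ) : wt (-n) = wt n := by simp [wt]

/-- The weighted `ℓ¹` norm of the Fourier coefficients. -/
def wnorm (s : ℕ) (u : C(T3, ℂ)) : ℝ≥0∞ := ∑' n, (wt n : ℝ≥0∞) ^ s * ‖fc n u‖ₑ

lemma wnorm_add_le (s : ℕ) (u v : C(T3, ℂ)) : wnorm s (u + v) ≤ wnorm s u + wnorm s v := by
  unfold wnorm
  rw [← ENNReal.tsum_add]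
  refine ENNReal.tsum_le_tsum fun n => ?_
  rw [← mul_add, map_add]
  gcongr
  exact enorm_add_le _ _

lemma wnorm_smul (s : ℕ) (c : ℂ) (u : C(T3, ℂ)) : wnorm s (c • u) = ‖c‖ₑ * wnorm s u := by
  unfold wnorm
  rw [← ENNReal.tsum_mul_left]
  refine tsum_congr fun n => ?_
  rw [map_smul, smul_eq_mul, enorm_mul]; ring

@[simp] lemma wnorm_zero (s : ℕ) : wnorm s 0 = 0 := by simp [wnorm]

lemma wnorm_neg (s : ℕ) (u : C(T3, ℂ)) : wnorm s (-u) = wnorm s u := by simp [wnorm]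

lemma wnorm_sub_comm (s : ℕ) (u v : C(T3, ℂ)) : wnorm s (u - v) = wnorm s (v - u) := by
  rw [← wnorm_neg, neg_sub]

lemma wnorm_sum_le {ι : Type*} (s : ℕ) (t : Finset ι) (u : ι → C(T3, ℂ)) :
    wnorm s (∑ i ∈ t, u i) ≤ ∑ i ∈ t, wnorm s (u i) := by
  classical
  induction t using Finset.induction_on with
  | empty => simp
  | insert a t ha ih =>
    rw [Finset.sum_insert ha, Finset.sum_insert ha]
    exact (wnorm_add_le _ _ _).trans (by gcongr)

lemma wnorm_mono {s r : ℕ} (h : r ≤ s) (u : C(T3, ℂ)) : wnorm r u ≤ wnorm s u := by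
  refine ENNReal.tsum_le_tsum fun n => ?_
  gcongr
  exact_mod_cast one_le_wt n

lemma summable_fc {s : ℕ} {u : C(T3, ℂ)} (hu : wnorm s u ≠ ⊤) :
    Summable fun n => (wt n : ℝ) ^ s * ‖fc n u‖ := by
  have h : ∀ n, (wt n : ℝ≥0∞) ^ s * ‖fc n u‖ₑ = ENNReal.ofReal ((wt n : ℝ) ^ s * ‖fc n u‖) := by
    intro n
    rw [ENNReal.ofReal_mul (by positivity), ENNReal.ofReal_pow (by positivity), ofReal_norm,
      ENNReal.ofReal_natCast]
  simp only [wnorm, h] at hu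
  have := ENNReal.summable_toReal hu
  refine this.congr fun n => ?_
  rw [ENNReal.toReal_ofReal (by positivity)]

lemma summable_fc_zero {s : ℕ} {u : C(T3, ℂ)} (hu : wnorm s u ≠ ⊤) :
    Summable fun n => ‖fc n u‖ := by
  simpa using summable_fc (s := 0) (ne_top_of_le_ne_top hu (wnorm_mono (Nat.zero_le s) u))

lemma hasSum_fc {s : ℕ} {u : C(T3, ℂ)} (hu : wnorm s u ≠ ⊤) :
    HasSum (fun n => fc n u • mFourier n) u :=
  hasSum_mFourier_series_of_summable (summable_fc_zero hu).of_norm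

lemma enorm_le_wnorm (s : ℕ) (u : C(T3, ℂ)) : ‖u‖ₑ ≤ wnorm s u := by
  by_cases hu : wnorm s u = ⊤
  · simp [hu]
  refine le_trans ?_ (wnorm_mono (Nat.zero_le s) u)
  conv_lhs => rw [← (hasSum_fc hu).tsum_eq]
  refine (enorm_tsum_le_tsum_enorm
    (f := fun n => fc n u • (mFourier n : C(T3, ℂ)))).trans ?_
  rw [wnorm]
  refine ENNReal.tsum_le_tsum fun n => ?_
  rw [enorm_smul, ← ofReal_norm (mFourier n), mFourier_norm]
  simp

lemma eq_of_fc_eq {s : ℕ} {u v : C(T3, ℂ)} (hu : wnorm s u ≠ ⊤) (hv : wnorm s v ≠ ⊤)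
    (h : ∀ n, fc n u = fc n v) : u = v := by
  rw [← (hasSum_fc hu).tsum_eq, ← (hasSum_fc hv).tsum_eq]
  simp [h]

/-- The function with prescribed Fourier coefficients. -/
def synth (c : (Fin 3 → ℤ) → ℂ) : C(T3, ℂ) := ∑' n, c n • mFourier n

lemma hasSum_synth {c : (Fin 3 → ℤ) → ℂ} (hc : Summable fun n => ‖c n‖) :
    HasSum (fun n => c n • (mFourier n : C(T3, ℂ))) (synth c) := by
  refine Summable.hasSum (Summable.of_norm ?_)
  simpa only [norm_smul, mFourier_norm, mul_one] using hc

lemma fc_synth {c : (Fin 3 → ℤ) → ℂ} (hc : Summable fun n => ‖c n‖) (n : Fin 3 → ℤ) :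
    fc n (synth c) = c n := by
  have := (fc n).hasSum (hasSum_synth hc)
  simp only [map_smul, fc_mFourier, smul_eq_mul, mul_ite, mul_one, mul_zero] at this
  rw [← this.tsum_eq]
  simp

/-- The coefficients of a product are a convolution, and the weight is distributed by `wt_add_le`.
Only `u` needs a finite norm: its Fourier series then converges uniformly and may be multiplied by
`v` term by term. -/
lemma wnorm_mul_le (s : ℕ) {u : C(T3, ℂ)} (v : C(T3, ℂ)) (hu : wnorm s u ≠ ⊤) :
    wnorm s (u * v) ≤ wnorm s u * wnorm s v := by
  have key : ∀ k, ‖fc k (u * v)‖ₑ ≤ ∑' m, ‖fc m u‖ₑ * ‖fc (k - m) v‖ₑ := by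
    intro k
    have h1 : HasSum (fun m => fc m u * fc (k - m) v) (fc k (u * v)) := by
      have := (fc k).hasSum ((hasSum_fc hu).mul_right v)
      convert this using 2 with m
      rw [smul_mul_assoc, map_smul, smul_eq_mul]
      congr 1
      simp only [fc_apply, mFourierCoeff]
      congr 1; ext t
      have : -k + m = -(k - m) := by abel
      simp only [ContinuousMap.mul_apply, smul_eq_mul, ← mul_assoc, ← mFourier_add, this]
    rw [← h1.tsum_eq]
    refine enorm_tsum_le_tsum_enorm.trans ?_
    simp [enorm_mul]
  calc wnorm s (u * v) ≤ ∑' k, (wt k : ℝ≥0∞) ^ s * ∑' m, ‖fc m u‖ₑ * ‖fc (k - m) v‖ₑ :=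
        ENNReal.tsum_le_tsum fun k => by gcongr; exact key k
    _ ≤ ∑' k, ∑' m, ((wt m : ℝ≥0∞) ^ s * ‖fc m u‖ₑ) * ((wt (k - m) : ℝ≥0∞) ^ s * ‖fc (k - m) v‖ₑ) := by
        refine ENNReal.tsum_le_tsum fun k => ?_
        rw [← ENNReal.tsum_mul_left]
        refine ENNReal.tsum_le_tsum fun m => ?_
        have : (wt k : ℝ≥0∞) ≤ wt m * wt (k - m) := by
          have := wt_add_le m (k - m)
          rw [add_sub_cancel] at this
          exact_mod_cast this
        calc _ ≤ ((wt m : ℝ≥0∞) * wt (k - m)) ^ s * (‖fc m u‖ₑ * ‖fc (k - m) v‖ₑ) := by gcongr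
          _ = _ := by rw [mul_pow]; ring
    _ = wnorm s u * wnorm s v := by
        rw [ENNReal.tsum_comm, wnorm, ← ENNReal.tsum_mul_right]
        refine tsum_congr fun m => ?_
        rw [ENNReal.tsum_mul_left]
        congr 1
        exact (Equiv.subRight m).tsum_eq (fun k => (wt k : ℝ≥0∞) ^ s * ‖fc k v‖ₑ)

lemma wnorm_mul_ne_top {s : ℕ} {u v : C(T3, ℂ)} (hu : wnorm s u ≠ ⊤) (hv : wnorm s v ≠ ⊤) :
    wnorm s (u * v) ≠ ⊤ :=
  ne_top_of_le_ne_top (ENNReal.mul_ne_top hu hv) (wnorm_mul_le s v hu)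

/-- The Fourier multiplier with symbol `m`. -/
def mult (m : (Fin 3 → ℤ) → ℂ) (u : C(T3, ℂ)) : C(T3, ℂ) := synth fun n => m n * fc n u

/-- A symbol of growth `r` costs `r` powers of the weight. The finiteness hypothesis makes the
defining series of `mult` summable; otherwise the `tsum` could take its default value `0`. -/
lemma fc_mult {m : (Fin 3 → ℤ) → ℂ} {u : C(T3, ℂ)} {r : ℕ} {K : ℝ≥0}
    (hm : ∀ n, ‖m n‖₊ ≤ K * wt n ^ r) (hu : wnorm r u ≠ ⊤) (n : Fin 3 → ℤ) :
    fc n (mult m u) = m n * fc n u := by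
  refine fc_synth ?_ n
  refine Summable.of_nonneg_of_le (fun _ => norm_nonneg _) (fun n => ?_)
    ((summable_fc hu).mul_left (K : ℝ))
  rw [norm_mul, ← mul_assoc]
  gcongr
  exact_mod_cast hm n

lemma wnorm_mult_le {m : (Fin 3 → ℤ) → ℂ} {r : ℕ} {K : ℝ≥0}
    (hm : ∀ n, ‖m n‖₊ ≤ K * wt n ^ r) (s : ℕ) (u : C(T3, ℂ)) :
    wnorm s (mult m u) ≤ K * wnorm (s + r) u := by
  -- In `ℝ≥0∞` zero times infinity is zero, so for `K = 0` an infinite norm of `u` does not make the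
  -- bound trivial, and the multiplier has to be seen to vanish.
  by_cases hK : K = 0
  · have : mult m u = 0 := by
      have : ∀ n, m n = 0 := fun n => by simpa [hK] using hm n
      exact (tsum_congr fun n => by beta_reduce; rw [this, zero_mul]; exact zero_smul ℂ (mFourier n : C(T3, ℂ))).trans tsum_zero
    simp [this]
  by_cases hu : wnorm (s + r) u = ⊤
  · rw [hu, ENNReal.mul_top (by simpa using hK)]; exact le_top
  have hr := ne_top_of_le_ne_top hu (wnorm_mono (Nat.le_add_left r s) u)
  rw [wnorm, wnorm, ← ENNReal.tsum_mul_left]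
  refine ENNReal.tsum_le_tsum fun n => ?_
  rw [fc_mult hm hr, enorm_mul]
  have : ‖m n‖ₑ ≤ K * (wt n : ℝ≥0∞) ^ r := by
    rw [enorm_eq_nnnorm]; exact_mod_cast hm n
  calc _ ≤ (wt n : ℝ≥0∞) ^ s * ((K * (wt n : ℝ≥0∞) ^ r) * ‖fc n u‖ₑ) := by gcongr
    _ = _ := by rw [pow_add]; ring

lemma mult_sub {m : (Fin 3 → ℤ) → ℂ} {u v : C(T3, ℂ)} {r : ℕ} {K : ℝ≥0}
    (hm : ∀ n, ‖m n‖₊ ≤ K * wt n ^ r) (hu : wnorm r u ≠ ⊤) (hv : wnorm r v ≠ ⊤) :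
    mult m (u - v) = mult m u - mult m v := by
  have hs : ∀ {u}, wnorm r u ≠ ⊤ → wnorm 0 (mult m u) ≠ ⊤ := fun {u} h =>
    ne_top_of_le_ne_top (ENNReal.mul_ne_top ENNReal.coe_ne_top (by simpa using h))
      (wnorm_mult_le hm 0 u)
  have huv : wnorm r (u - v) ≠ ⊤ := by
    rw [sub_eq_add_neg]
    exact ne_top_of_le_ne_top (ENNReal.add_ne_top.2 ⟨hu, by rwa [wnorm_neg]⟩) (wnorm_add_le _ _ _)
  have h2 : wnorm 0 (mult m u - mult m v) ≠ ⊤ := by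
    rw [sub_eq_add_neg]
    exact ne_top_of_le_ne_top (ENNReal.add_ne_top.2 ⟨hs hu, by rw [wnorm_neg]; exact hs hv⟩)
      (wnorm_add_le _ _ _)
  refine eq_of_fc_eq (hs huv) h2 fun n => ?_
  rw [fc_mult hm huv, map_sub, map_sub, fc_mult hm hu, fc_mult hm hv, mul_sub]

/-- The real part, as a complex-valued function. -/
def rePart (u : C(T3, ℂ)) : C(T3, ℂ) := ⟨fun t => ((u t).re : ℂ), by fun_prop⟩

lemma rePart_eq (u : C(T3, ℂ)) : rePart u = (2⁻¹ : ℂ) • (u + star u) := by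
  ext t
  simp [rePart, Complex.add_conj]

lemma fc_star (n : Fin 3 → ℤ) (u : C(T3, ℂ)) : fc n (star u) = star (fc (-n) u) := by
  simp only [fc_apply, mFourierCoeff, ContinuousMap.star_apply, smul_eq_mul, neg_neg]
  rw [← starRingEnd_apply, ← integral_conj]
  congr 1; ext t
  simp [mFourier_neg]

lemma wnorm_star (s : ℕ) (u : C(T3, ℂ)) : wnorm s (star u) = wnorm s u := by
  unfold wnorm
  rw [← (Equiv.neg (Fin 3 → ℤ)).tsum_eq (fun n => (wt n : ℝ≥0∞) ^ s * ‖fc n u‖ₑ)]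
  refine tsum_congr fun n => ?_
  rw [fc_star, Equiv.neg_apply, wt_neg, ← ofReal_norm, norm_star, ofReal_norm]

lemma wnorm_rePart_le (s : ℕ) (u : C(T3, ℂ)) : wnorm s (rePart u) ≤ wnorm s u := by
  rw [rePart_eq, wnorm_smul]
  calc _ ≤ ‖(2⁻¹ : ℂ)‖ₑ * (wnorm s u + wnorm s u) := by
        gcongr
        exact (wnorm_add_le _ _ _).trans (by rw [wnorm_star])
    _ = _ := by
        have : ‖(2⁻¹ : ℂ)‖ₑ = 2⁻¹ := by
          rw [enorm_inv two_ne_zero, ← ofReal_norm]; simp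
        rw [this, ← two_mul, ← mul_assoc, ENNReal.inv_mul_cancel (by simp) (by simp), one_mul]

lemma rePart_sub (u v : C(T3, ℂ)) : rePart (u - v) = rePart u - rePart v := by
  ext t; simp [rePart]

lemma wnorm_tsum_le (s : ℕ) {u : ℕ → C(T3, ℂ)} (hu : Summable u) :
    wnorm s (∑' k, u k) ≤ ∑' k, wnorm s (u k) := by
  unfold wnorm
  rw [ENNReal.tsum_comm]
  refine ENNReal.tsum_le_tsum fun n => ?_
  rw [ENNReal.tsum_mul_left, (fc n).map_tsum hu]
  gcongr
  exact enorm_tsum_le_tsum_enorm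

lemma summable_of_wnorm {s : ℕ} {u : ℕ → C(T3, ℂ)} (hu : ∑' k, wnorm s (u k) ≠ ⊤) :
    Summable u := by
  refine Summable.of_norm_bounded (ENNReal.summable_toReal hu) fun k => ?_
  have := enorm_le_wnorm s (u k)
  rw [← ofReal_norm] at this
  exact (ENNReal.ofReal_le_iff_le_toReal (ENNReal.ne_top_of_tsum_ne_top hu k)).1 this

end

/-! ### Periodic functions on `ℝ³`: derivatives and decay of Fourier coefficients. -/

section

attribute [local instance] instMeasureSpaceUnitAddCircle

/-- The periodic function on `ℝ³` defined by a function on the torus. -/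
def lift (u : C(T3, ℂ)) (x : Fin 3 → ℝ) : ℂ := u (toTorus x)

/-- The phase `2π ⟨n, x⟩`. -/
def rphase (n : Fin 3 → ℤ) : (Fin 3 → ℝ) →L[ℝ] ℝ :=
  ∑ j, (2 * Real.pi * n j : ℝ) • (ContinuousLinearMap.proj j)

lemma phase_eq (n : Fin 3 → ℤ) (x : Fin 3 → ℝ) : phase n x = rphase n x * Complex.I := by
  simp only [phase_apply, rphase, _root_.sum_apply, Complex.ofReal_sum, Finset.sum_mul]
  refine Finset.sum_congr rfl fun j _ => ?_
  simp; ring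

/-- The constant `7` is an upper bound for `2π`; the `ℓ¹` size of the frequency appears because `Fin
3 → ℝ` carries the sup norm. -/
lemma norm_rphase_le (n : Fin 3 → ℤ) : ‖rphase n‖ ≤ 7 * wt n := by
  refine ContinuousLinearMap.opNorm_le_bound _ (by positivity) fun x => ?_
  simp only [rphase, _root_.sum_apply]
  refine (norm_sum_le _ _).trans ?_
  calc _ ≤ ∑ j, (7 * ((n j).natAbs : ℝ)) * ‖x‖ := by
        refine Finset.sum_le_sum fun j _ => ?_
        simp only [_root_.smul_apply, ContinuousLinearMap.proj_apply, norm_smul,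
          norm_mul, Real.norm_ofNat, Real.norm_eq_abs, abs_of_pos Real.pi_pos, Nat.cast_natAbs,
          Int.cast_abs]
        gcongr
        · linarith [Real.pi_lt_d2]
        · exact norm_le_pi_norm x j
    _ = 7 * (∑ j, ((n j).natAbs : ℝ)) * ‖x‖ := by rw [← Finset.sum_mul, ← Finset.mul_sum]
    _ ≤ _ := by
        gcongr
        simp [wt]

/-- The exponential with frequency `n`. -/
def expo (n : Fin 3 → ℤ) (x : Fin 3 → ℝ) : ℂ := Complex.exp (rphase n x * Complex.I)

lemma mFourier_eq_expo (n : Fin 3 → ℤ) (x : Fin 3 → ℝ) : mFourier n (toTorus x) = expo n x := by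
  rw [mFourier_toTorus, phase_eq, expo]

lemma contDiff_expI {N : WithTop ℕ∞} : ContDiff ℝ N fun θ : ℝ => Complex.exp (θ * Complex.I) :=
  (Complex.ofRealCLM.contDiff.mul contDiff_const).cexp

lemma iteratedDeriv_expI (k : ℕ) :
    iteratedDeriv k (fun θ : ℝ => Complex.exp (θ * Complex.I)) =
      fun θ : ℝ => Complex.I ^ k * Complex.exp (θ * Complex.I) := by
  induction k with
  | zero => simp
  | succ k ih =>
    rw [iteratedDeriv_succ, ih]
    ext θ
    have h : HasDerivAt (fun θ : ℝ => Complex.exp (θ * Complex.I))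
        (Complex.exp (θ * Complex.I) * (1 * Complex.I)) θ :=
      ((Complex.ofRealCLM.hasDerivAt).mul_const Complex.I).cexp
    rw [(h.const_mul _).deriv]; ring

lemma norm_iteratedFDeriv_expo_le (n : Fin 3 → ℤ) (k : ℕ) (x : Fin 3 → ℝ) :
    ‖iteratedFDeriv ℝ k (expo n) x‖ ≤ (7 * wt n) ^ k := by
  have h : expo n = (fun θ : ℝ => Complex.exp (θ * Complex.I)) ∘ rphase n := rfl
  rw [h, (rphase n).iteratedFDeriv_comp_right (contDiff_expI (N := k)) x le_rfl]
  refine (ContinuousMultilinearMap.norm_compContinuousLinearMap_le _ _).trans ?_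
  rw [norm_iteratedFDeriv_eq_norm_iteratedDeriv, iteratedDeriv_expI]
  simp only [norm_mul, norm_pow, Complex.norm_I, one_pow, Complex.norm_exp_ofReal_mul_I, one_mul,
    Finset.prod_const, Finset.card_univ, Fintype.card_fin]
  gcongr
  exact norm_rphase_le n

lemma contDiff_expo (n : Fin 3 → ℤ) {N : WithTop ℕ∞} : ContDiff ℝ N (expo n) :=
  contDiff_expI.comp (rphase n).contDiff

lemma lift_eq_tsum {s : ℕ} {u : C(T3, ℂ)} (hu : wnorm s u ≠ ⊤) :
    lift u = fun x => ∑' n, fc n u • expo n x := by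
  ext x
  have := (hasSum_mFourier_series_apply_of_summable (summable_fc_zero hu).of_norm (toTorus x)).tsum_eq
  rw [lift, ← this]
  simp only [mFourier_eq_expo]; rfl

lemma norm_iteratedFDeriv_term_le (c : ℂ) (n : Fin 3 → ℤ) (k : ℕ) (x : Fin 3 → ℝ) :
    ‖iteratedFDeriv ℝ k (fun x => c • expo n x) x‖ ≤ 7 ^ k * ((wt n : ℝ) ^ k * ‖c‖) := by
  rw [iteratedFDeriv_const_smul_apply' (contDiff_expo n (N := k)).contDiffAt, norm_smul]
  calc _ ≤ ‖c‖ * (7 * wt n) ^ k := by gcongr; exact norm_iteratedFDeriv_expo_le n k x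
    _ = _ := by rw [mul_pow]; ring

/-- The Fourier series may be differentiated termwise, since each derivative costs at most one
factor `7 * wt n`. -/
lemma contDiff_lift {s : ℕ} {u : C(T3, ℂ)} (hu : wnorm s u ≠ ⊤) : ContDiff ℝ s (lift u) := by
  rw [lift_eq_tsum hu]
  refine contDiff_tsum (v := fun k n => 7 ^ k * ((wt n : ℝ) ^ k * ‖fc n u‖))
    (fun n => (contDiff_expo n).const_smul _) (fun k hk => ?_) (fun k n x hk =>
      norm_iteratedFDeriv_term_le _ _ _ _)
  have hk : k ≤ s := by exact_mod_cast hk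
  exact (summable_fc (ne_top_of_le_ne_top hu (wnorm_mono hk u))).mul_left _

lemma norm_iteratedFDeriv_lift_le {s k : ℕ} {u : C(T3, ℂ)} {R : ℝ≥0} (hu : wnorm s u ≤ R)
    (hk : k ≤ s) (x : Fin 3 → ℝ) : ‖iteratedFDeriv ℝ k (lift u) x‖ ≤ 7 ^ k * R := by
  have hu' : wnorm s u ≠ ⊤ := ne_top_of_le_ne_top ENNReal.coe_ne_top hu
  have hs : ∀ k : ℕ, (k : ℕ∞) ≤ s → Summable fun n => 7 ^ k * ((wt n : ℝ) ^ k * ‖fc n u‖) :=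
    fun k hk => (summable_fc (ne_top_of_le_ne_top hu' (wnorm_mono
      (by exact_mod_cast hk) u))).mul_left _
  rw [lift_eq_tsum hu', iteratedFDeriv_tsum (fun n => (contDiff_expo n).const_smul _) hs
    (fun k n x hk => norm_iteratedFDeriv_term_le _ _ _ _) (by exact_mod_cast hk)]
  refine (tsum_of_norm_bounded (hs k (by exact_mod_cast hk)).hasSum
    (fun n => norm_iteratedFDeriv_term_le _ _ _ _)).trans ?_
  rw [tsum_mul_left]
  gcongr
  have h1 : wnorm k u ≤ R := (wnorm_mono hk u).trans hu
  have h2 := ne_top_of_le_ne_top ENNReal.coe_ne_top h1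
  have : ∑' n, (wt n : ℝ) ^ k * ‖fc n u‖ = (wnorm k u).toReal := by
    rw [wnorm, ENNReal.tsum_toReal_eq (fun n => by finiteness)]
    simp
  rw [this]
  exact ENNReal.toReal_le_coe_of_le_coe h1

/-- The partial derivative in the `j`-th direction. -/
def pd (j : Fin 3) (u : C(T3, ℂ)) : C(T3, ℂ) := mult (fun n => 2 * Real.pi * Complex.I * n j) u

lemma pd_symbol_le (j : Fin 3) (n : Fin 3 → ℤ) :
    ‖(2 * Real.pi * Complex.I * n j : ℂ)‖₊ ≤ 7 * (wt n : ℝ≥0) ^ 1 := by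
  rw [← NNReal.coe_le_coe]
  have h1 : ((n j).natAbs : ℝ) ≤ wt n := by
    have : (n j).natAbs ≤ ∑ j, (n j).natAbs :=
      Finset.single_le_sum (f := fun j => (n j).natAbs) (fun _ _ => Nat.zero_le _) (Finset.mem_univ j)
    exact_mod_cast this.trans (Nat.le_add_left _ _)
  have h2 : ‖(n j : ℂ)‖ = (n j).natAbs := by
    rw [Complex.norm_intCast, Nat.cast_natAbs, Int.cast_abs]
  simp only [coe_nnnorm, norm_mul, Complex.norm_ofNat, Complex.norm_real, Complex.norm_I, mul_one,
    Real.norm_eq_abs, abs_of_pos Real.pi_pos, h2, NNReal.coe_mul, NNReal.coe_ofNat, pow_one,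
    NNReal.coe_natCast]
  gcongr
  linarith [Real.pi_lt_d2]

lemma wnorm_pd_le (j : Fin 3) (s : ℕ) (u : C(T3, ℂ)) : wnorm s (pd j u) ≤ 7 * wnorm (s + 1) u := by
  exact (wnorm_mult_le (pd_symbol_le j) s u).trans (by simp)

lemma fc_pd (j : Fin 3) {u : C(T3, ℂ)} (hu : wnorm 1 u ≠ ⊤) (n : Fin 3 → ℤ) :
    fc n (pd j u) = 2 * Real.pi * Complex.I * n j * fc n u :=
  fc_mult (pd_symbol_le j) hu n

lemma fderiv_expo (n : Fin 3 → ℤ) (x v : Fin 3 → ℝ) :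
    fderiv ℝ (expo n) x v = phase n v * expo n x := by
  have h : HasFDerivAt (expo n) (expo n x • ((rphase n).smulRight Complex.I)) x := by
    have := ((rphase n).smulRight Complex.I).hasFDerivAt (x := x) |>.cexp
    exact this
  rw [h.fderiv, phase_eq]; simp; ring

/-- This identifies the Fourier multiplier `pd j` with the genuine partial derivative, so that
identities for `pd` can be checked by calculus on `ℝ³`. -/
lemma fderiv_lift_single (j : Fin 3) {u : C(T3, ℂ)} (hu : wnorm 1 u ≠ ⊤) (x : Fin 3 → ℝ) :
    fderiv ℝ (lift u) x (Pi.single j 1) = lift (pd j u) x := by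
  have hpd : wnorm 0 (pd j u) ≠ ⊤ :=
    ne_top_of_le_ne_top (ENNReal.mul_ne_top (by simp) hu) (wnorm_pd_le j 0 u)
  rw [lift_eq_tsum hu, lift_eq_tsum hpd]
  have hd : ∀ n, Differentiable ℝ fun x => fc n u • expo n x := fun n =>
    ((contDiff_expo n (N := 1)).const_smul _).differentiable one_ne_zero
  have hb : ∀ n x, ‖fderiv ℝ (fun x => fc n u • expo n x) x‖ ≤ 7 ^ 1 * ((wt n : ℝ) ^ 1 * ‖fc n u‖) := by
    intro n x
    rw [← norm_iteratedFDeriv_one]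
    exact norm_iteratedFDeriv_term_le _ _ _ _
  have hs := (summable_fc hu).mul_left (7 ^ 1 : ℝ)
  have h0 : Summable fun n => fc n u • expo n x := by
    refine Summable.of_norm_bounded (summable_fc_zero hu) fun n => ?_
    simp [expo, Complex.norm_exp_ofReal_mul_I]
  rw [fderiv_tsum_apply hs hd hb h0]
  have hS : Summable fun n => fderiv ℝ (fun x => fc n u • expo n x) x :=
    Summable.of_norm_bounded hs (fun n => hb n x)
  rw [← ContinuousLinearMap.apply_apply (𝕜 := ℝ) (Pi.single j 1 : Fin 3 → ℝ) (∑' n, _), ContinuousLinearMap.map_tsum _ hS]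
  refine tsum_congr fun n => ?_
  rw [ContinuousLinearMap.apply_apply, fc_pd j hu,
    fderiv_fun_const_smul ((contDiff_expo n (N := 1)).contDiffAt.differentiableAt one_ne_zero)]
  rw [_root_.smul_apply, fderiv_expo, phase_single]
  simp; ring

lemma lift_add_of_toTorus_eq_zero (u : C(T3, ℂ)) {k : Fin 3 → ℝ} (hk : toTorus k = 0)
    (x : Fin 3 → ℝ) : lift u (x + k) = lift u x := by
  simp [lift, toTorus_add, hk]

/-- A periodic function is constant on the fibres of `toTorus`, and a continuous one descends
because `toTorus` is a quotient map. -/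
lemma exists_lift_eq {v : (Fin 3 → ℝ) → ℂ} (hv : Continuous v)
    (hper : ∀ k, toTorus k = 0 → ∀ x, v (x + k) = v x) : ∃ u : C(T3, ℂ), lift u = v := by
  let q : C(Fin 3 → ℝ, T3) := ⟨toTorus, continuous_toTorus⟩
  have hq : Topology.IsQuotientMap q := isOpenQuotientMap_toTorus.isQuotientMap
  have hf : Function.FactorsThrough (⟨v, hv⟩ : C(Fin 3 → ℝ, ℂ)) q := by
    intro x y hxy
    have : toTorus (y - x) = 0 := by
      have h : toTorus x = toTorus y := hxy
      have h2 := toTorus_add x (y - x)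
      rw [add_sub_cancel, h] at h2
      simpa using h2
    have := hper _ this x
    rw [add_sub_cancel] at this
    exact this.symm
  exact ⟨hq.lift _ hf, funext fun x => congrArg (fun f => f x) (hq.lift_comp _ hf)⟩

lemma exists_lift_eq_fderiv (j : Fin 3) {u : C(T3, ℂ)} {k : ℕ} (hu : ContDiff ℝ (k + 1) (lift u)) :
    ∃ u' : C(T3, ℂ), lift u' = fun x => fderiv ℝ (lift u) x (Pi.single j 1) := by
  refine exists_lift_eq ((hu.continuous_fderiv (by simp)).clm_apply continuous_const) ?_
  intro k hk x
  have : (fun y => lift u (y + k)) = lift u := funext (lift_add_of_toTorus_eq_zero u hk)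
  rw [← fderiv_comp_add_right, this]

/-- Unlike `fc_pd`, this assumes nothing about summability of the Fourier series. The coefficient of
the translate of `u` by `r` in the `j`-th direction is differentiated at `r = 0` in two ways: under
the integral sign, and through the exponential factor of `fc_translate`. -/
lemma fc_of_fderiv (j : Fin 3) {u u' : C(T3, ℂ)} (hu : Differentiable ℝ (lift u))
    (h : ∀ x, lift u' x = fderiv ℝ (lift u) x (Pi.single j 1)) (n : Fin 3 → ℤ) :
    fc n u' = 2 * Real.pi * Complex.I * n j * fc n u := by
  have hd : ∀ (t : T3) (r : ℝ), HasDerivAt (fun r : ℝ => u (t + toTorus (Pi.single j r)))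
      (u' (t + toTorus (Pi.single j r))) r := by
    intro t r
    obtain ⟨x, rfl⟩ := toTorus_surjective t
    have h1 : HasDerivAt (fun r : ℝ => x + Pi.single j r) (Pi.single j 1 : Fin 3 → ℝ) r := by
      have h2 : HasDerivAt (fun r : ℝ => x + r • (Pi.single j 1 : Fin 3 → ℝ))
          ((1 : ℝ) • (Pi.single j 1 : Fin 3 → ℝ)) r :=
        ((hasDerivAt_id r).smul_const _).const_add x
      simpa [← Pi.single_smul] using h2
    have h3 := (hu (x + Pi.single j r)).hasFDerivAt.comp_hasDerivAt r h1
    rw [← h] at h3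
    exact h3
  have hI := hasDerivAt_integral_of_dominated_loc_of_deriv_le (μ := (volume : Measure T3))
    (F := fun (r : ℝ) t => mFourier (-n) t • u (t + toTorus (Pi.single j r)))
    (F' := fun (r : ℝ) t => mFourier (-n) t • u' (t + toTorus (Pi.single j r)))
    (x₀ := 0) (s := Set.univ) (bound := fun _ => ‖u'‖) Filter.univ_mem
    (Filter.Eventually.of_forall fun r => Continuous.aestronglyMeasurable (by fun_prop))
    (Continuous.integrable_of_hasCompactSupport (by fun_prop) (HasCompactSupport.of_compactSpace _))
    (Continuous.aestronglyMeasurable (by fun_prop))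
    (Filter.Eventually.of_forall fun t r _ => by
      rw [norm_smul]
      calc _ ≤ ‖(mFourier (-n) : C(T3,ℂ))‖ * ‖u'‖ := by
              gcongr <;> exact ContinuousMap.norm_coe_le_norm _ _
        _ = _ := by rw [mFourier_norm, one_mul])
    (integrable_const _)
    (Filter.Eventually.of_forall fun t r _ => (hd t r).fun_const_smul _)
  have h1 := hI.2
  have h2 : (fun r : ℝ => ∫ t : T3, mFourier (-n) t • u (t + toTorus (Pi.single j r))) =
      fun r : ℝ => Complex.exp (2 * Real.pi * Complex.I * n j * r) * fc n u := by
    ext r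
    rw [← phase_single, ← mFourier_toTorus, ← fc_translate]; rfl
  have h0 : toTorus (Pi.single j 0) = 0 := by
    rw [Pi.single_zero]; rfl
  rw [h2] at h1
  simp only [h0, add_zero] at h1
  have h3 : HasDerivAt (fun r : ℝ => Complex.exp (2 * Real.pi * Complex.I * n j * r) * fc n u)
      (Complex.exp (2 * Real.pi * Complex.I * n j * (0 : ℝ)) *
        (2 * Real.pi * Complex.I * n j * 1) * fc n u) 0 :=
    ((Complex.ofRealCLM.hasDerivAt.const_mul _).cexp).mul_const _
  have := h1.unique h3
  simpa [fc_apply, mFourierCoeff] using this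

/-- Each derivative in direction `j` multiplies the coefficient by `2πi n_j`, whose modulus is at
least `|n_j|`. -/
lemma pow_mul_norm_fc_le (j : Fin 3) (n : Fin 3 → ℤ) (k : ℕ) {u : C(T3, ℂ)} {B : ℝ}
    (hu : ContDiff ℝ k (lift u)) (hB : ∀ x, ‖iteratedFDeriv ℝ k (lift u) x‖ ≤ B) :
    ((n j).natAbs : ℝ) ^ k * ‖fc n u‖ ≤ B := by
  induction k generalizing u with
  | zero =>
    have hB0 : 0 ≤ B := (norm_nonneg _).trans (hB 0)
    simp only [norm_iteratedFDeriv_zero] at hB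
    simp only [pow_zero, one_mul]
    refine (norm_fc_le n u).trans ((ContinuousMap.norm_le _ hB0).2 fun t => ?_)
    obtain ⟨x, rfl⟩ := toTorus_surjective t
    exact hB x
  | succ k ih =>
    obtain ⟨u', hu'⟩ := exists_lift_eq_fderiv j (k := k) (by exact_mod_cast hu)
    have hfd : ContDiff ℝ k (fderiv ℝ (lift u)) := hu.fderiv_right (by norm_cast)
    have h1 : ContDiff ℝ k (lift u') := by
      rw [hu']; exact hfd.clm_apply contDiff_const
    have h2 := ih h1 (fun x => by
      rw [hu']
      refine (norm_iteratedFDeriv_clm_apply_const hfd.contDiffAt le_rfl).trans ?_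
      rw [norm_iteratedFDeriv_fderiv, Pi.norm_single, norm_one, one_mul]
      exact hB x)
    rw [fc_of_fderiv j (hu.differentiable (by simp)) (fun x => congrFun hu' x)] at h2
    refine le_trans ?_ h2
    have h3 : ‖(n j : ℂ)‖ = (n j).natAbs := by
      rw [Complex.norm_intCast, Nat.cast_natAbs, Int.cast_abs]
    simp only [norm_mul, Complex.norm_ofNat, Complex.norm_real, Complex.norm_I, mul_one,
      Real.norm_eq_abs, abs_of_pos Real.pi_pos, h3]
    rw [pow_succ, mul_assoc]
    gcongr
    nlinarith [Real.pi_gt_three, Nat.cast_nonneg (α := ℝ) (n j).natAbs]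

/-- The sixth power dominates the product of `(1 + |n_j|)²` over the three coordinates. This is the
source of the exponent `6` in all later regularity assumptions. -/
lemma summable_wt : Summable fun n : Fin 3 → ℤ => ((wt n : ℝ) ^ 6)⁻¹ := by
  let f : ℤ → ℝ := fun k => ((1 + (k.natAbs : ℝ)) ^ 2)⁻¹
  have hf : Summable f := by
    have h : Summable fun k : ℕ => ((1 + (k : ℝ)) ^ 2)⁻¹ := by
      have := (summable_nat_add_iff 1).2 (Real.summable_nat_pow_inv.2 one_lt_two)
      refine this.congr fun k => ?_
      push_cast; ring
    exact Summable.of_nat_of_neg (by simpa [f] using h) (by simpa [f] using h)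
  have hf0 : 0 ≤ f := fun k => by positivity
  have h3 : Summable fun p : ℤ × ℤ × ℤ => f p.1 * (f p.2.1 * f p.2.2) :=
    hf.mul_of_nonneg (hf.mul_of_nonneg hf hf0 hf0) hf0 (fun p => mul_nonneg (hf0 _) (hf0 _))
  have hi : Function.Injective fun n : Fin 3 → ℤ => (n 0, n 1, n 2) := by
    intro m n h
    simp only [Prod.mk.injEq] at h
    ext j; fin_cases j <;> simp [h]
  refine Summable.of_nonneg_of_le (fun _ => by positivity) (fun n => ?_) (h3.comp_injective hi)
  have hw : ∀ j, 1 + ((n j).natAbs : ℝ) ≤ wt n := fun j => by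
    have : (n j).natAbs ≤ ∑ j, (n j).natAbs :=
      Finset.single_le_sum (f := fun j => (n j).natAbs) (fun _ _ => Nat.zero_le _) (Finset.mem_univ j)
    exact_mod_cast Nat.add_le_add_left this 1
  simp only [Function.comp, f, ← mul_inv]
  gcongr
  calc _ ≤ (wt n : ℝ) ^ 2 * ((wt n : ℝ) ^ 2 * (wt n : ℝ) ^ 2) := by
        gcongr <;> exact hw _
    _ = _ := by ring

/-- The weight is a sum of four terms, each at most the maximum of `1` and the `|n_j|`. -/
lemma wt_pow_le (n : Fin 3 → ℤ) (k : ℕ) :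
    (wt n : ℝ) ^ k ≤ 4 ^ k * (1 + ∑ j, ((n j).natAbs : ℝ) ^ k) := by
  have hw : (wt n : ℝ) = 1 + ∑ j, ((n j).natAbs : ℝ) := by simp [wt]
  have key : ∃ m : ℝ, 0 ≤ m ∧ (wt n : ℝ) ≤ 4 * m ∧ m ^ k ≤ 1 + ∑ j, ((n j).natAbs : ℝ) ^ k := by
    obtain ⟨i, hi⟩ := Finite.exists_max fun j => ((n j).natAbs : ℝ)
    have hs : ((n i).natAbs : ℝ) ^ k ≤ ∑ j, ((n j).natAbs : ℝ) ^ k :=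
      Finset.single_le_sum (f := fun j => ((n j).natAbs : ℝ) ^ k) (fun _ _ => by positivity)
        (Finset.mem_univ i)
    have hm : (wt n : ℝ) ≤ 1 + 3 * (n i).natAbs := by
      rw [hw, Fin.sum_univ_three]
      linarith [hi 0, hi 1, hi 2]
    rcases le_total 1 ((n i).natAbs : ℝ) with h | h
    · exact ⟨(n i).natAbs, by positivity, by linarith, by linarith⟩
    · refine ⟨1, zero_le_one, by linarith, ?_⟩
      rw [one_pow]
      have : 0 ≤ ∑ j, ((n j).natAbs : ℝ) ^ k := by positivity
      linarith
  obtain ⟨m, hm0, hm1, hm2⟩ := key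
  calc _ ≤ (4 * m) ^ k := by gcongr
    _ = 4 ^ k * m ^ k := mul_pow _ _ _
    _ ≤ _ := by gcongr

/-- A function of class `C⁶` has absolutely summable Fourier series. -/
lemma exists_wnorm_zero_le : ∃ K : ℝ≥0, ∀ (u : C(T3, ℂ)) (B : ℝ≥0), ContDiff ℝ 6 (lift u) →
    (∀ k ≤ 6, ∀ x, ‖iteratedFDeriv ℝ k (lift u) x‖ ≤ B) → wnorm 0 u ≤ K * B := by
  -- Six factors `4` come from `wt_pow_le` with exponent `6`; the seventh counts the term without
  -- derivatives and the three pure sixth derivatives, each bounded by `B`.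
  refine ⟨4 ^ 7 * (∑' n : Fin 3 → ℤ, ((wt n : ℝ) ^ 6)⁻¹).toNNReal, fun u B hu hB => ?_⟩
  have h : ∀ n, ‖fc n u‖ ≤ 4 ^ 7 * B * ((wt n : ℝ) ^ 6)⁻¹ := by
    intro n
    have hpos : (0 : ℝ) < (wt n : ℝ) ^ 6 := by
      have : 0 < wt n := one_le_wt n
      positivity
    rw [← div_eq_mul_inv, le_div_iff₀ hpos]
    have h0 := pow_mul_norm_fc_le 0 n 0 (hu.of_le (by norm_num)) (hB 0 (by norm_num))
    have h6 := fun j => pow_mul_norm_fc_le j n 6 hu (hB 6 le_rfl)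
    calc ‖fc n u‖ * (wt n : ℝ) ^ 6 ≤ ‖fc n u‖ * (4 ^ 6 * (1 + ∑ j, ((n j).natAbs : ℝ) ^ 6)) := by
          gcongr; exact wt_pow_le n 6
      _ = 4 ^ 6 * (((n 0).natAbs : ℝ) ^ 0 * ‖fc n u‖ + ∑ j, ((n j).natAbs : ℝ) ^ 6 * ‖fc n u‖) := by
          rw [← Finset.sum_mul]; ring
      _ ≤ 4 ^ 6 * (B + ∑ j : Fin 3, (B : ℝ)) := by
          gcongr with j
          exact h6 j
      _ = _ := by simp; ring
  have hS := summable_wt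
  calc wnorm 0 u ≤ ∑' n, ENNReal.ofReal (4 ^ 7 * B * ((wt n : ℝ) ^ 6)⁻¹) := by
        refine ENNReal.tsum_le_tsum fun n => ?_
        rw [pow_zero, one_mul, ← ofReal_norm]
        exact ENNReal.ofReal_le_ofReal (h n)
    _ = ENNReal.ofReal (∑' n, 4 ^ 7 * B * ((wt n : ℝ) ^ 6)⁻¹) :=
        (ENNReal.ofReal_tsum_of_nonneg (fun n => by positivity) (hS.mul_left _)).symm
    _ = _ := by
        rw [tsum_mul_left, ENNReal.ofReal_mul (by positivity), ENNReal.ofReal_mul (by positivity),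
          ENNReal.ofReal_coe_nnreal, ENNReal.coe_mul, ENNReal.ofReal_pow (by norm_num),
          ENNReal.ofReal_ofNat, ENNReal.coe_pow, ENNReal.coe_ofNat]
        change _ * (ENNReal.ofReal _) = _ * (ENNReal.ofReal _) * _
        ring

/-- One factor of the weight is written as `1 + ∑ |n_j|` and each `|n_j|` is absorbed into a
derivative. Finiteness of the left side is not assumed, so the inequality can raise the order of
regularity. -/
lemma wnorm_succ_le (r : ℕ) {u : C(T3, ℂ)} {u' : Fin 3 → C(T3, ℂ)} (hu : Differentiable ℝ (lift u))
    (h : ∀ j x, lift (u' j) x = fderiv ℝ (lift u) x (Pi.single j 1)) :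
    wnorm (r + 1) u ≤ wnorm r u + ∑ j, wnorm r (u' j) := by
  simp only [wnorm, ← Summable.tsum_finsetSum (fun _ _ => ENNReal.summable), ← ENNReal.tsum_add]
  refine ENNReal.tsum_le_tsum fun n => ?_
  have h1 : ∀ j, ((n j).natAbs : ℝ≥0∞) * ‖fc n u‖ₑ ≤ ‖fc n (u' j)‖ₑ := by
    intro j
    rw [fc_of_fderiv j hu (h j)]
    have h3 : ‖(n j : ℂ)‖ = (n j).natAbs := by
      rw [Complex.norm_intCast, Nat.cast_natAbs, Int.cast_abs]
    rw [enorm_mul]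
    gcongr
    rw [← ofReal_norm, ← ENNReal.ofReal_natCast]
    refine ENNReal.ofReal_le_ofReal ?_
    simp only [norm_mul, Complex.norm_ofNat, Complex.norm_real, Complex.norm_I, mul_one,
      Real.norm_eq_abs, abs_of_pos Real.pi_pos, h3]
    nlinarith [Real.pi_gt_three, Nat.cast_nonneg (α := ℝ) (n j).natAbs]
  calc _ = (wt n : ℝ≥0∞) ^ r * (‖fc n u‖ₑ + ∑ j, ((n j).natAbs : ℝ≥0∞) * ‖fc n u‖ₑ) := by
        rw [pow_succ, ← Finset.sum_mul]
        simp only [wt, Nat.cast_add, Nat.cast_one, Nat.cast_sum]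
        ring
    _ ≤ (wt n : ℝ≥0∞) ^ r * (‖fc n u‖ₑ + ∑ j, ‖fc n (u' j)‖ₑ) := by
        gcongr with j
        exact h1 j
    _ = _ := by rw [mul_add, Finset.mul_sum]

end

section

/-! ### Parametric integrals and Hadamard's lemma -/

lemma hasFDerivAt_parametric_integral {V W : Type*} [NormedAddCommGroup V] [NormedSpace ℝ V]
    [FiniteDimensional ℝ V] [NormedAddCommGroup W] [NormedSpace ℝ W] [CompleteSpace W]
    {F : V × ℝ → W} (hF : ContDiff ℝ 1 F) (x : V) :
    HasFDerivAt (fun x => ∫ s in (0 : ℝ)..1, F (x, s))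
      (∫ s in (0 : ℝ)..1, (fderiv ℝ F (x, s)).comp (ContinuousLinearMap.inl ℝ V ℝ)) x := by
  have hc : Continuous fun p : V × ℝ => (fderiv ℝ F p).comp (ContinuousLinearMap.inl ℝ V ℝ) :=
    (hF.continuous_fderiv one_ne_zero).clm_comp continuous_const
  have hK : IsCompact (Metric.closedBall x 1 ×ˢ Set.Icc (0 : ℝ) 1) :=
    (isCompact_closedBall x 1).prod isCompact_Icc
  obtain ⟨B, hB⟩ := hK.exists_bound_of_continuousOn hc.continuousOn
  refine intervalIntegral.hasFDerivAt_integral_of_dominated_of_fderiv_le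
    (F' := fun x s => (fderiv ℝ F (x, s)).comp (ContinuousLinearMap.inl ℝ V ℝ))
    (bound := fun _ => B)
    (Metric.closedBall_mem_nhds x one_pos)
    (Filter.Eventually.of_forall fun y => ?_) ?_ ?_ ?_ intervalIntegrable_const ?_
  · exact (hF.continuous.comp (by fun_prop)).aestronglyMeasurable
  · exact (hF.continuous.comp (by fun_prop)).intervalIntegrable _ _
  · exact (hc.comp (by fun_prop : Continuous fun s : ℝ => (x, s))).aestronglyMeasurable
  · refine Filter.Eventually.of_forall fun s hs y hy => hB (y, s) ⟨hy, ?_⟩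
    rw [Set.uIoc_of_le zero_le_one] at hs
    exact Set.Ioc_subset_Icc_self hs
  · refine Filter.Eventually.of_forall fun s hs y hy => ?_
    have h1 := (hF.differentiable one_ne_zero (y, s)).hasFDerivAt
    exact h1.comp y (hasFDerivAt_prodMk_left y s)

/-- The target space is quantified inside the induction because the derivative of the integral is a
parametric integral with values in `V →L[ℝ] W`. -/
lemma contDiff_parametric_integral_nat {V : Type} [NormedAddCommGroup V] [NormedSpace ℝ V]
    [FiniteDimensional ℝ V] (n : ℕ) : ∀ {W : Type} [NormedAddCommGroup W] [NormedSpace ℝ W]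
    [CompleteSpace W] {F : V × ℝ → W}, ContDiff ℝ ∞ F →
    ContDiff ℝ n (fun x => ∫ s in (0 : ℝ)..1, F (x, s)) := by
  induction n with
  | zero =>
    intro W _ _ _ F hF
    have hd := fun x => (hasFDerivAt_parametric_integral (hF.of_le (by exact_mod_cast le_top)) x)
    exact contDiff_zero.2 (continuous_iff_continuousAt.2 fun x => (hd x).continuousAt)
  | succ n ih =>
    intro W _ _ _ F hF
    have hd := fun x => (hasFDerivAt_parametric_integral (hF.of_le (by exact_mod_cast le_top)) x)
    push_cast
    rw [contDiff_succ_iff_fderiv]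
    refine ⟨fun x => (hd x).differentiableAt, by simp, ?_⟩
    rw [funext fun x => (hd x).fderiv]
    exact ih (F := fun p => (fderiv ℝ F p).comp (ContinuousLinearMap.inl ℝ V ℝ))
      ((hF.fderiv_right (by simp)).clm_comp contDiff_const)

lemma contDiff_parametric_integral {V : Type} [NormedAddCommGroup V] [NormedSpace ℝ V]
    [FiniteDimensional ℝ V] {W : Type} [NormedAddCommGroup W] [NormedSpace ℝ W]
    [CompleteSpace W] {F : V × ℝ → W} (hF : ContDiff ℝ ∞ F) :
    ContDiff ℝ ∞ (fun x => ∫ s in (0 : ℝ)..1, F (x, s)) :=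
  contDiff_infty.2 fun n => contDiff_parametric_integral_nat n hF

set_option linter.unusedSectionVars false

variable {ι : Type} [Fintype ι] [DecidableEq ι]

/-- The partial derivative of a function on `ι → ℝ`. -/
def partialD (i : ι) (a : (ι → ℝ) → ℝ) (y : ι → ℝ) : ℝ := fderiv ℝ a y (Pi.single i 1)

lemma contDiff_partialD (i : ι) {a : (ι → ℝ) → ℝ} (ha : ContDiff ℝ ∞ a) :
    ContDiff ℝ ∞ (partialD i a) :=
  (ha.fderiv_right (by simp)).clm_apply contDiff_const

lemma fderiv_eq_sum_partialD (a : (ι → ℝ) → ℝ) (y v : ι → ℝ) :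
    fderiv ℝ a y v = ∑ i, partialD i a y * v i := by
  conv_lhs => rw [← Finset.univ_sum_single v, map_sum]
  refine Finset.sum_congr rfl fun i _ => ?_
  have : Pi.single i (v i) = v i • (Pi.single i 1 : ι → ℝ) := by simp [← Pi.single_smul]
  rw [this, map_smul, smul_eq_mul, mul_comm]; rfl

/-- The coefficients are averages of the partial derivatives of `a` over the segment from `q` to
`p`. The pair is encoded as one tuple on `ι ⊕ ι`, so that composition estimates for a single tuple
apply to the coefficients as well. -/
lemma exists_hadamard {a : (ι → ℝ) → ℝ} (ha : ContDiff ℝ ∞ a) :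
    ∃ b : ι → (ι ⊕ ι → ℝ) → ℝ, (∀ i, ContDiff ℝ ∞ (b i)) ∧ ∀ p q : ι → ℝ,
      a p - a q = ∑ i, b i (Sum.elim p q) * (p i - q i) := by
  let P : ((ι ⊕ ι → ℝ) × ℝ) → (ι → ℝ) := fun z i =>
    z.1 (Sum.inr i) + z.2 * (z.1 (Sum.inl i) - z.1 (Sum.inr i))
  have hP : ContDiff ℝ ∞ P := by
    refine contDiff_pi.2 fun i => ?_
    have h1 : ∀ k : ι ⊕ ι, ContDiff ℝ ∞ fun z : (ι ⊕ ι → ℝ) × ℝ => z.1 k := fun k =>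
      (contDiff_apply ℝ ℝ k).comp contDiff_fst
    exact (h1 _).add (contDiff_snd.mul ((h1 _).sub (h1 _)))
  have hc := fun i => (contDiff_partialD i ha).comp hP
  refine ⟨fun i z => ∫ s in (0 : ℝ)..1, (partialD i a ∘ P) (z, s),
    fun i => contDiff_parametric_integral (hc i), fun p q => ?_⟩
  have hd : ∀ s : ℝ, HasDerivAt (fun s : ℝ => a (P (Sum.elim p q, s)))
      (∑ i, (partialD i a ∘ P) (Sum.elim p q, s) * (p i - q i)) s := by
    intro s
    have h1 : HasDerivAt (fun s : ℝ => P (Sum.elim p q, s)) (p - q) s := by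
      rw [hasDerivAt_pi]
      intro i
      simpa [P] using ((hasDerivAt_id s).mul_const (p i - q i)).const_add (q i)
    have h2 := (ha.differentiable (by simp) (P (Sum.elim p q, s))).hasFDerivAt.comp_hasDerivAt s h1
    rw [fderiv_eq_sum_partialD] at h2
    exact h2
  have hci : ∀ i, Continuous fun s : ℝ => (partialD i a ∘ P) (Sum.elim p q, s) := fun i =>
    (hc i).continuous.comp (by fun_prop)
  have hint := intervalIntegral.integral_eq_sub_of_hasDerivAt (a := 0) (b := 1)
    (fun s _ => hd s) (Continuous.intervalIntegrable
      (continuous_finsetSum _ fun i _ => (hci i).mul continuous_const) _ _)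
  have e1 : P (Sum.elim p q, 1) = p := by ext i; simp [P]
  have e0 : P (Sum.elim p q, 0) = q := by ext i; simp [P]
  rw [e1, e0] at hint
  rw [← hint, intervalIntegral.integral_finsetSum
    (f := fun i s => (partialD i a ∘ P) (Sum.elim p q, s) * (p i - q i))
    (fun i _ => ((hci i).mul continuous_const).intervalIntegrable _ _)]
  simp only [intervalIntegral.integral_mul_const]

/-! ### Composition with smooth functions -/

/-- Composition of a continuous function with the real parts of functions on the torus. -/
def comp (a : (ι → ℝ) → ℝ) (ha : Continuous a) (g : ι → C(T3, ℂ)) : C(T3, ℂ) :=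
  ⟨fun t => (a fun i => (g i t).re : ℂ), by fun_prop⟩

lemma comp_apply (a : (ι → ℝ) → ℝ) (ha : Continuous a) (g : ι → C(T3, ℂ)) (t : T3) :
    comp a ha g t = (a fun i => (g i t).re : ℂ) := rfl

/-- The real parts of the lifts of a tuple of functions. -/
def reLift (g : ι → C(T3, ℂ)) (x : Fin 3 → ℝ) : ι → ℝ := fun i => (lift (g i) x).re

lemma lift_comp (a : (ι → ℝ) → ℝ) (ha : Continuous a) (g : ι → C(T3, ℂ)) :
    lift (comp a ha g) = Complex.ofRealCLM ∘ (a ∘ reLift g) := rfl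

lemma reLift_eq_sum (g : ι → C(T3, ℂ)) : reLift g = fun x => ∑ i,
    (((ContinuousLinearMap.single ℝ (fun _ : ι => ℝ) i).comp Complex.reCLM) ∘ lift (g i)) x := by
  ext x i
  simp [reLift, Pi.single_apply]

lemma contDiff_reLift {s : ℕ} {g : ι → C(T3, ℂ)} (hg : ∀ i, wnorm s (g i) ≠ ⊤) :
    ContDiff ℝ s (reLift g) :=
  contDiff_pi.2 fun i => Complex.reCLM.contDiff.comp (contDiff_lift (hg i))

lemma norm_iteratedFDeriv_reLift_le {s k : ℕ} {g : ι → C(T3, ℂ)} {R : ℝ≥0}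
    (hg : ∀ i, wnorm s (g i) ≤ R) (hk : k ≤ s) (x : Fin 3 → ℝ) :
    ‖iteratedFDeriv ℝ k (reLift g) x‖ ≤ Fintype.card ι * (7 ^ k * R) := by
  have hcd : ∀ i, ContDiff ℝ s (lift (g i)) := fun i =>
    contDiff_lift (ne_top_of_le_ne_top ENNReal.coe_ne_top (hg i))
  rw [reLift_eq_sum, iteratedFDeriv_fun_sum_apply (fun i _ =>
    ((ContinuousLinearMap.contDiff _).comp ((hcd i).of_le (by exact_mod_cast hk))).contDiffAt)]
  refine (norm_sum_le _ _).trans ?_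
  rw [← nsmul_eq_mul, ← Finset.card_univ]
  refine Finset.sum_le_card_nsmul _ _ _ fun i _ => ?_
  refine (ContinuousLinearMap.norm_iteratedFDeriv_comp_left _ (hcd i).contDiffAt
    (by exact_mod_cast hk)).trans ?_
  have hL : ‖(ContinuousLinearMap.single ℝ (fun _ : ι => ℝ) i).comp Complex.reCLM‖ ≤ 1 := by
    refine ContinuousLinearMap.opNorm_le_bound _ zero_le_one fun z => ?_
    rw [one_mul, ContinuousLinearMap.comp_apply, ContinuousLinearMap.single_apply, Pi.norm_single]
    exact Complex.abs_re_le_norm z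
  calc _ ≤ 1 * (7 ^ k * (R : ℝ)) := by
        gcongr
        exact norm_iteratedFDeriv_lift_le (hg i) hk x
    _ = _ := one_mul _

lemma norm_reLift_le {s : ℕ} {g : ι → C(T3, ℂ)} {R : ℝ≥0} (hg : ∀ i, wnorm s (g i) ≤ R)
    (x : Fin 3 → ℝ) : ‖reLift g x‖ ≤ R := by
  refine (pi_norm_le_iff_of_nonneg R.2).2 fun i => ?_
  have h1 : ‖g i‖ₑ ≤ R := (enorm_le_wnorm s _).trans (hg i)
  have h2 : ‖g i‖ ≤ R := by rw [enorm_eq_nnnorm] at h1; exact_mod_cast h1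
  exact (Complex.abs_re_le_norm _).trans (((g i).norm_coe_le_norm _).trans h2)

lemma contDiff_lift_comp {s : ℕ} {a : (ι → ℝ) → ℝ} (ha : ContDiff ℝ ∞ a) {g : ι → C(T3, ℂ)}
    (hg : ∀ i, wnorm s (g i) ≠ ⊤) : ContDiff ℝ s (lift (comp a ha.continuous g)) := by
  rw [lift_comp]
  exact Complex.ofRealCLM.contDiff.comp ((ha.of_le (by exact_mod_cast le_top)).comp
    (contDiff_reLift hg))

/-- Six derivatives of the composite suffice for `exists_wnorm_zero_le`. They are controlled by
derivatives of `a` on a compact ball containing all values of the inner map, and by derivatives of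
the inner map, which the bound on `wnorm s` provides. -/
lemma exists_wnorm_zero_comp_le (s : ℕ) (hs : 6 ≤ s) {a : (ι → ℝ) → ℝ} (ha : ContDiff ℝ ∞ a)
    (R : ℝ≥0) : ∃ C : ℝ≥0, ∀ g : ι → C(T3, ℂ), (∀ i, wnorm s (g i) ≤ R) →
      wnorm 0 (comp a ha.continuous g) ≤ C := by
  obtain ⟨K, hK⟩ := exists_wnorm_zero_le
  have hA : ∀ k : ℕ, ∃ A : ℝ, ∀ y ∈ Metric.closedBall (0 : ι → ℝ) R,
      ‖iteratedFDeriv ℝ k a y‖ ≤ A := fun k =>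
    (isCompact_closedBall _ _).exists_bound_of_continuousOn
      (ha.continuous_iteratedFDeriv (m := k) (by exact_mod_cast le_top)).continuousOn
  choose A hA using hA
  let A' : ℝ := ∑ k ∈ Finset.range 7, |A k|
  -- The summand `1` ensures `D ≤ D ^ i` for `i ≥ 1`, the form in which
  -- `norm_iteratedFDeriv_comp_le` wants the bounds on the inner derivatives.
  let D : ℝ := 1 + Fintype.card ι * (7 ^ 6 * R)
  have hA'0 : 0 ≤ A' := Finset.sum_nonneg fun _ _ => abs_nonneg _
  have hD : 1 ≤ D := le_add_of_nonneg_right (by positivity)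
  have hD0 : 0 ≤ D := zero_le_one.trans hD
  let B : ℝ≥0 := ⟨Nat.factorial 6 * A' * D ^ 6, by positivity⟩
  refine ⟨K * B, fun g hg => ?_⟩
  have hgt : ∀ i, wnorm 6 (g i) ≠ ⊤ := fun i =>
    ne_top_of_le_ne_top ENNReal.coe_ne_top ((wnorm_mono hs _).trans (hg i))
  rw [ENNReal.coe_mul]
  refine hK _ _ (contDiff_lift_comp ha hgt) fun k hk x => ?_
  rw [lift_comp]
  have hcomp : ContDiff ℝ 6 (a ∘ reLift g) :=
    (show ContDiff ℝ 6 a from mod_cast contDiff_infty.1 ha 6).comp (contDiff_reLift hgt)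
  refine (ContinuousLinearMap.norm_iteratedFDeriv_comp_left _ hcomp.contDiffAt
    (by exact_mod_cast hk)).trans ?_
  rw [Complex.ofRealCLM_norm, one_mul]
  have h1 := norm_iteratedFDeriv_comp_le (n := k) (N := 6) (C := A') (D := D)
    (show ContDiff ℝ 6 a from mod_cast contDiff_infty.1 ha 6) (contDiff_reLift hgt) (by exact_mod_cast hk) x
    (fun i hi => by
      refine (hA i _ (by simpa using norm_reLift_le hg x)).trans ((le_abs_self _).trans ?_)
      exact Finset.single_le_sum (f := fun k => |A k|) (fun _ _ => abs_nonneg _)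
        (Finset.mem_range.2 (by omega)))
    (fun i hi1 hi => by
      refine (norm_iteratedFDeriv_reLift_le hg (by omega) x).trans ?_
      calc _ ≤ (Fintype.card ι : ℝ) * (7 ^ 6 * R) := by gcongr; norm_num; omega
        _ ≤ D := le_add_of_nonneg_left zero_le_one
        _ ≤ D ^ i := le_self_pow₀ hD (by omega))
  refine h1.trans ?_
  change _ ≤ (Nat.factorial 6 : ℝ) * A' * D ^ 6
  gcongr

lemma fderiv_lift_comp {a : (ι → ℝ) → ℝ} (ha : ContDiff ℝ ∞ a) {g : ι → C(T3, ℂ)}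
    (hg : ∀ i, wnorm 1 (g i) ≠ ⊤) (j : Fin 3) (x : Fin 3 → ℝ) :
    fderiv ℝ (lift (comp a ha.continuous g)) x (Pi.single j 1) =
      lift (∑ i, comp (partialD i a) (contDiff_partialD i ha).continuous g * rePart (pd j (g i)))
        x := by
  have h1 : ∀ i, HasFDerivAt (fun x => (lift (g i) x).re)
      (Complex.reCLM.comp (fderiv ℝ (lift (g i)) x)) x := fun i =>
    Complex.reCLM.hasFDerivAt.comp x
      ((contDiff_lift (hg i)).differentiable (by simp) x).hasFDerivAt
  have h2 : HasFDerivAt (reLift g)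
      (ContinuousLinearMap.pi fun i => Complex.reCLM.comp (fderiv ℝ (lift (g i)) x)) x :=
    hasFDerivAt_pi.2 h1
  have h3 := (ha.differentiable (by simp) (reLift g x)).hasFDerivAt.comp x h2
  have h4 := Complex.ofRealCLM.hasFDerivAt.comp x h3
  rw [lift_comp, h4.fderiv]
  simp only [ContinuousLinearMap.comp_apply, ContinuousLinearMap.coe_pi', fderiv_eq_sum_partialD,
    fderiv_lift_single j (hg _)]
  simp [lift, ContinuousMap.sum_apply, comp_apply, rePart]
  rfl

/-- Smooth functions act on the weighted Wiener algebras. -/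
theorem exists_wnorm_comp_le (s : ℕ) (hs : 6 ≤ s) (R : ℝ≥0) : ∀ {r : ℕ}, r ≤ s →
    ∀ {a : (ι → ℝ) → ℝ} (ha : ContDiff ℝ ∞ a), ∃ C : ℝ≥0, ∀ g : ι → C(T3, ℂ),
      (∀ i, wnorm s (g i) ≤ R) → wnorm r (comp a ha.continuous g) ≤ C := by
  intro r
  -- Induction on the order `r` at fixed `s`, for all `a` at once. By the chain rule the first
  -- derivatives of the composite are sums of composites with `partialD i a` times first derivatives
  -- of the components of `g`, so the `r + 1` norm reduces to `r` norms; `r + 1 ≤ s` leaves room for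
  -- the latter derivatives.
  induction r with
  | zero => intro _ a ha; exact exists_wnorm_zero_comp_le s hs ha R
  | succ r ih =>
    intro hr a ha
    obtain ⟨C, hC⟩ := ih (by omega) ha
    choose C' hC' using fun i => ih (by omega) (contDiff_partialD i ha)
    refine ⟨C + ∑ j : Fin 3, ∑ i, C' i * (7 * R), fun g hg => ?_⟩
    have hg1 : ∀ i, wnorm 1 (g i) ≠ ⊤ := fun i =>
      ne_top_of_le_ne_top ENNReal.coe_ne_top ((wnorm_mono (by omega) _).trans (hg i))
    refine (wnorm_succ_le r ((contDiff_lift_comp ha hg1).differentiable (by simp))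
      (fun j x => (fderiv_lift_comp ha hg1 j x).symm)).trans ?_
    push_cast
    gcongr with j
    · exact hC g hg
    · refine (wnorm_sum_le _ _ _).trans ?_
      gcongr with i
      refine (wnorm_mul_le _ _ (ne_top_of_le_ne_top ENNReal.coe_ne_top (hC' i g hg))).trans ?_
      gcongr
      · exact hC' i g hg
      · refine (wnorm_rePart_le _ _).trans ((wnorm_pd_le _ _ _).trans ?_)
        gcongr
        exact (wnorm_mono hr _).trans (hg i)

/-- Smooth functions act in a locally Lipschitz way on the weighted Wiener algebras. -/
theorem exists_wnorm_comp_sub_le (s : ℕ) (hs : 6 ≤ s) (R : ℝ≥0) {a : (ι → ℝ) → ℝ}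
    (ha : ContDiff ℝ ∞ a) : ∃ C : ℝ≥0, ∀ g g' : ι → C(T3, ℂ), (∀ i, wnorm s (g i) ≤ R) →
      (∀ i, wnorm s (g' i) ≤ R) →
      wnorm s (comp a ha.continuous g - comp a ha.continuous g') ≤
        C * ∑ i, wnorm s (g i - g' i) := by
  obtain ⟨b, hb, hab⟩ := exists_hadamard ha
  choose C hC using fun i => exists_wnorm_comp_le s hs R le_rfl (hb i)
  refine ⟨∑ i, C i, fun g g' hg hg' => ?_⟩
  have hG : ∀ i, wnorm s (Sum.elim g g' i) ≤ R := by rintro (i | i) <;> simp [hg, hg']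
  -- Hadamard's factorisation turns the difference into products, to which the algebra property
  -- applies.
  have h : comp a ha.continuous g - comp a ha.continuous g' =
      ∑ i, comp (b i) (hb i).continuous (Sum.elim g g') * rePart (g i - g' i) := by
    ext t
    simp only [ContinuousMap.sub_apply, comp_apply, ContinuousMap.sum_apply,
      ContinuousMap.mul_apply, rePart, ContinuousMap.coe_mk]
    rw [← Complex.ofReal_sub, hab]
    push_cast
    refine Finset.sum_congr rfl fun i _ => ?_
    congr 3
    · ext k; rcases k with k | k <;> rfl
    · simp
  rw [h, ENNReal.ofNNReal_finsetSum, Finset.sum_mul]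
  refine (wnorm_sum_le _ _ _).trans ?_
  gcongr with i
  refine (wnorm_mul_le _ _ (ne_top_of_le_ne_top ENNReal.coe_ne_top (hC i _ hG))).trans ?_
  gcongr
  · exact hC i _ hG
  · exact (wnorm_rePart_le _ _).trans
      (Finset.single_le_sum (f := fun i => wnorm s (g i - g' i)) (fun _ _ => zero_le)
        (Finset.mem_univ i))

end

/-! ### The contraction argument for quasilinear equations. -/

section

set_option linter.unusedSectionVars false

variable {ι : Type} [Fintype ι] [DecidableEq ι]

/-- The sum of the Wiener norms of the components. -/
def vnorm (s : ℕ) (φ : ι → C(T3, ℂ)) : ℝ≥0∞ := ∑ i, wnorm s (φ i)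

lemma wnorm_le_vnorm (s : ℕ) (φ : ι → C(T3, ℂ)) (i : ι) : wnorm s (φ i) ≤ vnorm s φ :=
  Finset.single_le_sum (f := fun i => wnorm s (φ i)) (fun _ _ => zero_le) (Finset.mem_univ i)

lemma vnorm_add_le (s : ℕ) (φ ψ : ι → C(T3, ℂ)) : vnorm s (φ + ψ) ≤ vnorm s φ + vnorm s ψ := by
  unfold vnorm
  rw [← Finset.sum_add_distrib]
  exact Finset.sum_le_sum fun i _ => wnorm_add_le _ _ _

lemma vnorm_sub_comm (s : ℕ) (φ ψ : ι → C(T3, ℂ)) : vnorm s (φ - ψ) = vnorm s (ψ - φ) :=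
  Finset.sum_congr rfl fun _ _ => wnorm_sub_comm _ _ _

lemma eq_of_vnorm_sub_eq_zero {s : ℕ} {φ ψ : ι → C(T3, ℂ)} (h : vnorm s (φ - ψ) = 0) : φ = ψ := by
  ext1 i
  have h1 : ‖(φ - ψ) i‖ₑ ≤ 0 := (enorm_le_wnorm s _).trans ((wnorm_le_vnorm s _ i).trans h.le)
  rw [← ofReal_norm, nonpos_iff_eq_zero, ENNReal.ofReal_eq_zero] at h1
  exact sub_eq_zero.1 (norm_le_zero_iff.1 h1)

/-- The contraction principle for the weighted Wiener norms. -/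
theorem exists_fixedPoint (s : ℕ) (Ψ : (ι → C(T3, ℂ)) → ι → C(T3, ℂ))
    (h1 : ∀ φ, vnorm s φ ≤ 1 → vnorm s (Ψ φ) ≤ 1)
    (h2 : ∀ φ ψ, vnorm s φ ≤ 1 → vnorm s ψ ≤ 1 →
      vnorm s (Ψ φ - Ψ ψ) ≤ 2⁻¹ * vnorm s (φ - ψ)) :
    ∃ φ, vnorm s φ ≤ 1 ∧ Ψ φ = φ := by
  let f : ℕ → ι → C(T3, ℂ) := fun k => Ψ^[k] 0
  have hf : ∀ k, f (k + 1) = Ψ (f k) := fun k => Function.iterate_succ_apply' Ψ k 0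
  have hb : ∀ k, vnorm s (f k) ≤ 1 := by
    intro k
    induction k with
    | zero => simp [f, vnorm]
    | succ k ih => rw [hf]; exact h1 _ ih
  have hd : ∀ k, vnorm s (f (k + 1) - f k) ≤ 2⁻¹ ^ k := by
    intro k
    induction k with
    | zero => simpa [f] using hb 1
    | succ k ih =>
      rw [hf (k + 1), hf k, pow_succ']
      refine (h2 _ _ (h1 _ (hb k)) (hb k)).trans ?_
      rw [← hf k]
      gcongr
  have hgeo : ∀ K : ℕ, ∑' k, (2⁻¹ : ℝ≥0∞) ^ (k + K) = 2 * 2⁻¹ ^ K := by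
    intro K
    simp_rw [pow_add]
    rw [ENNReal.tsum_mul_right, ENNReal.tsum_geometric, ENNReal.one_sub_inv_two, inv_inv]
  have hdi : ∀ K i, ∑' k, wnorm s ((f (k + K + 1) - f (k + K)) i) ≠ ⊤ := by
    intro K i
    refine ne_top_of_le_ne_top (b := 2 * 2⁻¹ ^ K) (by finiteness) ?_
    rw [← hgeo K]
    exact ENNReal.tsum_le_tsum fun k => (wnorm_le_vnorm s _ i).trans (hd _)
  -- The limit is the telescoping series of the increments, which converges in `C(T3, ℂ)`; its
  -- `wnorm` tails are then estimated directly, so completeness for the extended norm need not be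
  -- set up.
  let φ : ι → C(T3, ℂ) := fun i => ∑' k, (f (k + 1) - f k) i
  have htail : ∀ K, vnorm s (φ - f K) ≤ 2 * 2⁻¹ ^ K := by
    intro K
    have e : ∀ i, (φ - f K) i = ∑' k, (f (k + K + 1) - f (k + K)) i := by
      intro i
      have hs : Summable fun k => (f (k + 1) - f k) i := summable_of_wnorm (hdi 0 i)
      have e1 := hs.sum_add_tsum_nat_add K
      have e2 : ∑ k ∈ Finset.range K, (f (k + 1) - f k) i = f K i := by
        have := Finset.sum_range_sub (fun k => f k i) K
        simpa [f] using this
      rw [e2] at e1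
      rw [Pi.sub_apply]
      change (∑' k, (f (k + 1) - f k) i) - f K i = _
      rw [← e1, add_sub_cancel_left]
    calc vnorm s (φ - f K) ≤ ∑ i, ∑' k, wnorm s ((f (k + K + 1) - f (k + K)) i) := by
          refine Finset.sum_le_sum fun i _ => ?_
          rw [e]
          exact wnorm_tsum_le s (summable_of_wnorm (hdi K i))
      _ = ∑' k, vnorm s (f (k + K + 1) - f (k + K)) :=
          (Summable.tsum_finsetSum fun _ _ => ENNReal.summable).symm
      _ ≤ ∑' k, 2⁻¹ ^ (k + K) := ENNReal.tsum_le_tsum fun k => hd _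
      _ = _ := hgeo K
  have hlim : Filter.Tendsto (fun K : ℕ => (2 : ℝ≥0∞) * 2⁻¹ ^ K) Filter.atTop (nhds 0) := by
    have := ENNReal.Tendsto.const_mul (a := 2) (ENNReal.tendsto_pow_atTop_nhds_zero_of_lt_one
      (ENNReal.inv_lt_one.2 ENNReal.one_lt_two)) (Or.inr (by simp))
    simpa using this
  have hφ : vnorm s φ ≤ 1 := by
    have h3 : ∀ K : ℕ, vnorm s φ ≤ 1 + 2 * 2⁻¹ ^ K := fun K => by
      calc vnorm s φ = vnorm s (f K + (φ - f K)) := by rw [add_sub_cancel]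
        _ ≤ _ := (vnorm_add_le s _ _).trans (add_le_add (hb K) (htail K))
    have h4 := hlim.const_add 1
    rw [add_zero] at h4
    exact ge_of_tendsto' h4 h3
  refine ⟨φ, hφ, eq_of_vnorm_sub_eq_zero (s := s) (le_antisymm ?_ zero_le)⟩
  have h3 : ∀ K : ℕ, vnorm s (Ψ φ - φ) ≤ 2 * 2⁻¹ ^ K + 2 * 2⁻¹ ^ K := fun K => by
    calc vnorm s (Ψ φ - φ) = vnorm s ((Ψ φ - Ψ (f K)) + (f (K + 1) - φ)) := by
          rw [hf]; congr 1; abel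
      _ ≤ vnorm s (Ψ φ - Ψ (f K)) + vnorm s (f (K + 1) - φ) := vnorm_add_le s _ _
      _ ≤ 2⁻¹ * (2 * 2⁻¹ ^ K) + 2 * 2⁻¹ ^ (K + 1) := by
          gcongr
          · exact (h2 _ _ hφ (hb K)).trans (by gcongr; exact htail K)
          · rw [vnorm_sub_comm]; exact htail _
      _ ≤ _ := by
          refine add_le_add (mul_le_of_le_one_left zero_le (ENNReal.inv_le_one.2 one_le_two)) ?_
          refine mul_le_mul_right ?_ _
          exact pow_le_pow_right_of_le_one' (ENNReal.inv_le_one.2 one_le_two) (Nat.le_succ K)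
  have h4 := hlim.add hlim
  rw [add_zero] at h4
  exact ge_of_tendsto' h4 h3

lemma comp_zero {a : (ι → ℝ) → ℝ} (ha : Continuous a) (h0 : a 0 = 0) : comp a ha 0 = 0 := by
  ext t
  have : (fun i : ι => (((0 : ι → C(T3, ℂ)) i) t).re) = 0 := by ext i; simp
  rw [comp_apply, this, h0]; simp

/-- Solvability of small quasilinear perturbations. -/
theorem exists_quasilinear_fixedPoint (s : ℕ) (hs : 6 ≤ s) {A : ι → ι → (ι → ℝ) → ℝ}
    (hA : ∀ i k, ContDiff ℝ ∞ (A i k)) (hA0 : ∀ i k, A i k 0 = 0)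
    (G G' : (ι → C(T3, ℂ)) → ι → C(T3, ℂ)) (R L : ℝ≥0)
    (hG : ∀ φ, vnorm s φ ≤ 1 → ∀ i, wnorm s (G φ i) ≤ R)
    (hG' : ∀ φ, vnorm s φ ≤ 1 → ∀ i, wnorm s (G' φ i) ≤ R)
    (hGL : ∀ φ ψ, vnorm s φ ≤ 1 → vnorm s ψ ≤ 1 →
      ∀ i, wnorm s (G φ i - G ψ i) ≤ L * vnorm s (φ - ψ))
    (hGL' : ∀ φ ψ, vnorm s φ ≤ 1 → vnorm s ψ ≤ 1 →
      ∀ i, wnorm s (G' φ i - G' ψ i) ≤ L * vnorm s (φ - ψ)) :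
    ∃ K : ℝ≥0, ∃ ε₀ : ℝ≥0, 0 < ε₀ ∧ ∀ ε : ℝ≥0, ε ≤ ε₀ → ∃ φ : ι → C(T3, ℂ), vnorm s φ ≤ 1 ∧
      vnorm s φ ≤ K * ε ∧ ∀ i, φ i = -∑ k, comp (A i k) (hA i k).continuous
        (fun l => (ε : ℂ) • G φ l) * rePart (G' φ k) := by
  choose C hC using fun i k => exists_wnorm_comp_sub_le s hs R (hA i k)
  let N : ℝ≥0 := Fintype.card ι
  -- For `ε ≤ 1`, `K1 * ε` will bound the size of `Ψ ε` on the unit ball and `K2 * ε` its Lipschitz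
  -- constant. The factor `ε` in the first comes from `A i k 0 = 0` and the Lipschitz bound for
  -- composition with `A i k`.
  let K1 : ℝ≥0 := ∑ i, ∑ k, C i k * (N * R) * R
  let K2 : ℝ≥0 := ∑ i, ∑ k, (C i k * (N * L) * R + C i k * (N * R) * L)
  let Ψ : ℝ≥0 → (ι → C(T3, ℂ)) → ι → C(T3, ℂ) := fun ε φ i => -∑ k, comp (A i k) (hA i k).continuous
        (fun l => (ε : ℂ) • G φ l) * rePart (G' φ k)
  have hεn : ∀ ε : ℝ≥0, ‖(ε : ℂ)‖ₑ = ε := fun ε => by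
    rw [enorm_eq_nnnorm]; congr 1; ext; simp
  have hεG : ∀ ε : ℝ≥0, ε ≤ 1 → ∀ φ, vnorm s φ ≤ 1 → ∀ l, wnorm s ((ε : ℂ) • G φ l) ≤ R := by
    intro ε hε φ hφ l
    rw [wnorm_smul, hεn]
    calc _ ≤ 1 * (R : ℝ≥0∞) := by
          gcongr
          · exact_mod_cast hε
          · exact hG φ hφ l
      _ = R := one_mul _
  have hu : ∀ ε : ℝ≥0, ε ≤ 1 → ∀ φ, vnorm s φ ≤ 1 → ∀ i k,
      wnorm s (comp (A i k) (hA i k).continuous (fun l => (ε : ℂ) • G φ l)) ≤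
        (C i k * (N * R) * ε : ℝ≥0) := by
    intro ε hε φ hφ i k
    have h := hC i k (fun l => (ε : ℂ) • G φ l) 0 (hεG ε hε φ hφ) (by simp)
    rw [comp_zero _ (hA0 i k), sub_zero] at h
    refine h.trans ?_
    simp only [Pi.zero_apply, sub_zero, wnorm_smul, hεn, ENNReal.coe_mul, mul_assoc]
    gcongr
    calc ∑ l, (ε : ℝ≥0∞) * wnorm s (G φ l) ≤ ∑ l : ι, (ε : ℝ≥0∞) * R := by
          gcongr with l; exact hG φ hφ l
      _ = _ := by simp [N]; ring
  have hud : ∀ ε : ℝ≥0, ε ≤ 1 → ∀ φ ψ, vnorm s φ ≤ 1 → vnorm s ψ ≤ 1 → ∀ i k,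
      wnorm s (comp (A i k) (hA i k).continuous (fun l => (ε : ℂ) • G φ l) -
        comp (A i k) (hA i k).continuous (fun l => (ε : ℂ) • G ψ l)) ≤
        (C i k * (N * L) * ε : ℝ≥0) * vnorm s (φ - ψ) := by
    intro ε hε φ ψ hφ hψ i k
    refine (hC i k _ _ (hεG ε hε φ hφ) (hεG ε hε ψ hψ)).trans ?_
    have e : ∀ l, wnorm s ((ε : ℂ) • G φ l - (ε : ℂ) • G ψ l) = ε * wnorm s (G φ l - G ψ l) :=
      fun l => by
        rw [← hεn, ← wnorm_smul]
        congr 1; ext t; simp [mul_sub]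
    simp only [e, ENNReal.coe_mul, mul_assoc]
    gcongr
    calc ∑ l, (ε : ℝ≥0∞) * wnorm s (G φ l - G ψ l) ≤
          ∑ l : ι, (ε : ℝ≥0∞) * (L * vnorm s (φ - ψ)) := by
          gcongr with l; exact hGL φ ψ hφ hψ l
      _ = _ := by simp [N]; ring
  have hv : ∀ φ, vnorm s φ ≤ 1 → ∀ k, wnorm s (rePart (G' φ k)) ≤ R := fun φ hφ k =>
    (wnorm_rePart_le s _).trans (hG' φ hφ k)
  have hΨ1 : ∀ ε : ℝ≥0, ε ≤ 1 → ∀ φ, vnorm s φ ≤ 1 → vnorm s (Ψ ε φ) ≤ K1 * ε := by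
    intro ε hε φ hφ
    calc vnorm s (Ψ ε φ) ≤ ∑ i, ∑ k, ((C i k * (N * R) * ε : ℝ≥0) * R : ℝ≥0∞) := by
          refine Finset.sum_le_sum fun i _ => ?_
          rw [wnorm_neg]
          refine (wnorm_sum_le _ _ _).trans (Finset.sum_le_sum fun k _ => ?_)
          refine (wnorm_mul_le _ _ (ne_top_of_le_ne_top ENNReal.coe_ne_top
            (hu ε hε φ hφ i k))).trans ?_
          gcongr
          · exact hu ε hε φ hφ i k
          · exact hv φ hφ k
      _ = _ := by
          simp only [K1]; push_cast
          rw [Finset.sum_mul]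
          refine Finset.sum_congr rfl fun i _ => ?_
          rw [Finset.sum_mul]
          refine Finset.sum_congr rfl fun k _ => ?_
          ring
  have hΨ2 : ∀ ε : ℝ≥0, ε ≤ 1 → ∀ φ ψ, vnorm s φ ≤ 1 → vnorm s ψ ≤ 1 →
      vnorm s (Ψ ε φ - Ψ ε ψ) ≤ K2 * ε * vnorm s (φ - ψ) := by
    intro ε hε φ ψ hφ hψ
    calc vnorm s (Ψ ε φ - Ψ ε ψ) ≤ ∑ i, ∑ k,
          ((C i k * (N * L) * ε : ℝ≥0) * vnorm s (φ - ψ) * R +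
            (C i k * (N * R) * ε : ℝ≥0) * (L * vnorm s (φ - ψ)) : ℝ≥0∞) := by
          refine Finset.sum_le_sum fun i _ => ?_
          -- The usual splitting `ab - a'b' = (a - a') b + a' (b - b')`: each summand carries one
          -- factor that is small with `ε`.
          have e : (Ψ ε φ - Ψ ε ψ) i = -∑ k,
              ((comp (A i k) (hA i k).continuous (fun l => (ε : ℂ) • G φ l) -
                comp (A i k) (hA i k).continuous (fun l => (ε : ℂ) • G ψ l)) * rePart (G' φ k) +
              comp (A i k) (hA i k).continuous (fun l => (ε : ℂ) • G ψ l) *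
                rePart (G' φ k - G' ψ k)) := by
            simp only [Ψ, Pi.sub_apply, ← Finset.sum_neg_distrib, ← Finset.sum_sub_distrib]
            refine Finset.sum_congr rfl fun k _ => ?_
            rw [rePart_sub]; ring
          rw [e, wnorm_neg]
          refine (wnorm_sum_le _ _ _).trans (Finset.sum_le_sum fun k _ => ?_)
          refine (wnorm_add_le _ _ _).trans (add_le_add ?_ ?_)
          · have hne : wnorm s (comp (A i k) (hA i k).continuous (fun l => (ε : ℂ) • G φ l) -
                comp (A i k) (hA i k).continuous (fun l => (ε : ℂ) • G ψ l)) ≠ ⊤ := by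
              rw [sub_eq_add_neg]
              refine ne_top_of_le_ne_top (ENNReal.add_ne_top.2
                ⟨ne_top_of_le_ne_top ENNReal.coe_ne_top (hu ε hε φ hφ i k), ?_⟩)
                (wnorm_add_le _ _ _)
              rw [wnorm_neg]
              exact ne_top_of_le_ne_top ENNReal.coe_ne_top (hu ε hε ψ hψ i k)
            refine (wnorm_mul_le _ _ hne).trans ?_
            gcongr
            · exact hud ε hε φ ψ hφ hψ i k
            · exact hv φ hφ k
          · refine (wnorm_mul_le _ _ (ne_top_of_le_ne_top ENNReal.coe_ne_top
              (hu ε hε ψ hψ i k))).trans ?_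
            gcongr
            · exact hu ε hε ψ hψ i k
            · exact (wnorm_rePart_le s _).trans (hGL' φ ψ hφ hψ k)
      _ = _ := by
          simp only [K2]; push_cast
          rw [Finset.sum_mul, Finset.sum_mul]
          refine Finset.sum_congr rfl fun i _ => ?_
          rw [Finset.sum_mul, Finset.sum_mul]
          refine Finset.sum_congr rfl fun k _ => ?_
          ring
  have hpos : (0 : ℝ≥0) < 2 * (1 + K1 + K2) := by positivity
  -- This choice gives `ε ≤ 1`, `K1 * ε ≤ 1` (the unit ball is preserved) and `K2 * ε ≤ 1/2`
  -- (contraction) simultaneously.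
  refine ⟨K1, (2 * (1 + K1 + K2))⁻¹, by positivity, fun ε hε => ?_⟩
  have hε' : ε * (2 * (1 + K1 + K2)) ≤ 1 := by
    calc _ ≤ (2 * (1 + K1 + K2))⁻¹ * (2 * (1 + K1 + K2)) := by gcongr
      _ = 1 := inv_mul_cancel₀ hpos.ne'
  have hε1 : ε ≤ 1 := by nlinarith [mul_nonneg (zero_le (a := ε)) (zero_le (a := K1)), mul_nonneg (zero_le (a := ε)) (zero_le (a := K2)), zero_le (a := ε)]
  have hK1 : K1 * ε ≤ 1 := by nlinarith [mul_nonneg (zero_le (a := ε)) (zero_le (a := K1)), mul_nonneg (zero_le (a := ε)) (zero_le (a := K2)), zero_le (a := ε)]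
  have hK2 : K2 * ε ≤ 2⁻¹ := by
    rw [← NNReal.coe_le_coe] at hε' ⊢
    push_cast at hε' ⊢
    have a1 : (0 : ℝ) ≤ ε * K1 := by positivity
    have a2 : (0 : ℝ) ≤ ε := by positivity
    nlinarith
  obtain ⟨φ, hφ, hfix⟩ := exists_fixedPoint s (Ψ ε)
    (fun φ hφ => (hΨ1 ε hε1 φ hφ).trans (by exact_mod_cast hK1))
    (fun φ ψ hφ hψ => (hΨ2 ε hε1 φ ψ hφ hψ).trans (by
      refine mul_le_mul_left ?_ _
      have h := ENNReal.coe_le_coe.2 hK2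
      rw [ENNReal.coe_inv two_ne_zero] at h
      simpa using h))
  refine ⟨φ, hφ, ?_, fun i => ?_⟩
  · conv_lhs => rw [← hfix]
    exact hΨ1 ε hε1 φ hφ
  · exact (congrFun hfix i).symm

end

section

set_option linter.unusedSectionVars false

/-! ### Calculus of multipliers -/

lemma wnorm_add_ne_top {s : ℕ} {u v : C(T3, ℂ)} (hu : wnorm s u ≠ ⊤) (hv : wnorm s v ≠ ⊤) :
    wnorm s (u + v) ≠ ⊤ :=
  ne_top_of_le_ne_top (ENNReal.add_ne_top.2 ⟨hu, hv⟩) (wnorm_add_le _ _ _)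

lemma wnorm_smul_ne_top {s : ℕ} (c : ℂ) {u : C(T3, ℂ)} (hu : wnorm s u ≠ ⊤) :
    wnorm s (c • u) ≠ ⊤ := by
  rw [wnorm_smul]; finiteness

lemma wnorm_sum_ne_top {κ : Type*} {s : ℕ} (t : Finset κ) {u : κ → C(T3, ℂ)}
    (hu : ∀ i, wnorm s (u i) ≠ ⊤) : wnorm s (∑ i ∈ t, u i) ≠ ⊤ :=
  ne_top_of_le_ne_top (ENNReal.sum_ne_top.2 fun i _ => hu i) (wnorm_sum_le _ _ _)

lemma lift_injective {u v : C(T3, ℂ)} (h : ∀ x, lift u x = lift v x) : u = v := by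
  ext t
  obtain ⟨x, rfl⟩ := toTorus_surjective t
  exact h x

lemma differentiable_lift {u : C(T3, ℂ)} (hu : wnorm 1 u ≠ ⊤) : Differentiable ℝ (lift u) :=
  (contDiff_lift hu).differentiable (by simp)

lemma pd_add (j : Fin 3) {u v : C(T3, ℂ)} (hu : wnorm 1 u ≠ ⊤) (hv : wnorm 1 v ≠ ⊤) :
    pd j (u + v) = pd j u + pd j v := by
  refine lift_injective fun x => ?_
  have e : lift (u + v) = fun x => lift u x + lift v x := rfl
  rw [← fderiv_lift_single j (wnorm_add_ne_top hu hv), e,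
    fderiv_fun_add (differentiable_lift hu x) (differentiable_lift hv x), _root_.add_apply,
    fderiv_lift_single j hu, fderiv_lift_single j hv]
  rfl

lemma pd_smul (j : Fin 3) (c : ℂ) {u : C(T3, ℂ)} (hu : wnorm 1 u ≠ ⊤) :
    pd j (c • u) = c • pd j u := by
  refine lift_injective fun x => ?_
  have e : lift (c • u) = fun x => c • lift u x := rfl
  rw [← fderiv_lift_single j (wnorm_smul_ne_top c hu), e,
    fderiv_fun_const_smul (differentiable_lift hu x), _root_.smul_apply,
    fderiv_lift_single j hu]
  rfl

lemma pd_sum {κ : Type*} (j : Fin 3) (t : Finset κ) {u : κ → C(T3, ℂ)}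
    (hu : ∀ i, wnorm 1 (u i) ≠ ⊤) : pd j (∑ i ∈ t, u i) = ∑ i ∈ t, pd j (u i) := by
  classical
  induction t using Finset.induction_on with
  | empty =>
    refine lift_injective fun x => ?_
    have e : lift (0 : C(T3, ℂ)) = fun x => 0 := rfl
    rw [Finset.sum_empty, Finset.sum_empty, ← fderiv_lift_single j (by simp), e]
    simp
  | insert a t ha ih =>
    rw [Finset.sum_insert ha, Finset.sum_insert ha, pd_add j (hu a) (wnorm_sum_ne_top t hu), ih]

lemma pd_mul (j : Fin 3) {u v : C(T3, ℂ)} (hu : wnorm 1 u ≠ ⊤) (hv : wnorm 1 v ≠ ⊤) :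
    pd j (u * v) = pd j u * v + u * pd j v := by
  refine lift_injective fun x => ?_
  have e : lift (u * v) = fun x => lift u x * lift v x := rfl
  rw [← fderiv_lift_single j (wnorm_mul_ne_top hu hv), e,
    fderiv_fun_mul (differentiable_lift hu x) (differentiable_lift hv x)]
  simp only [_root_.add_apply, _root_.smul_apply, fderiv_lift_single j hu, fderiv_lift_single j hv,
    lift, ContinuousMap.add_apply, ContinuousMap.mul_apply, smul_eq_mul]
  ring

lemma pd_mult (j : Fin 3) {m : (Fin 3 → ℤ) → ℂ} {K : ℝ≥0} (hm : ∀ n, ‖m n‖₊ ≤ K * wt n ^ 0)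
    {u : C(T3, ℂ)} (hu : wnorm 0 u ≠ ⊤) :
    pd j (mult m u) = mult (fun n => 2 * Real.pi * Complex.I * n j * m n) u := by
  unfold pd mult
  congr 1; ext n
  rw [← mult, fc_mult hm hu]
  ring

/-- The symbol of the `j`-th component of the fundamental solution of the Cauchy–Riemann
operator. -/
def crSymbol (j : Fin 3) (n : Fin 3 → ℤ) : ℂ :=
  (n j : ℂ) / (2 * Real.pi * Complex.I * ((n 0 : ℂ) ^ 2 + (n 1 : ℂ) ^ 2))

/-- The symbol of the mean over the first two variables. -/
def meanSymbol (n : Fin 3 → ℤ) : ℂ := if n 0 = 0 ∧ n 1 = 0 then 1 else 0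

lemma norm_meanSymbol_le (n : Fin 3 → ℤ) : ‖meanSymbol n‖₊ ≤ 1 * wt n ^ 0 := by
  unfold meanSymbol; split_ifs <;> simp

lemma int_abs_mul_le {j k : Fin 3} (hj : j = 0 ∨ j = 1) (hk : k = 0 ∨ k = 1) (n : Fin 3 → ℤ) :
    |(n j : ℝ) * n k| ≤ (n 0 : ℝ) ^ 2 + (n 1 : ℝ) ^ 2 := by
  rcases hj with rfl | rfl <;> rcases hk with rfl | rfl <;> rw [abs_le] <;> constructor <;>
  nlinarith [sq_nonneg ((n 0 : ℝ) - n 1), sq_nonneg ((n 0 : ℝ) + n 1), sq_nonneg (n 0 : ℝ),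
    sq_nonneg (n 1 : ℝ)]

/-- The symbol is `n_j n_k / (n_0² + n_1²)`, bounded by one, with value zero where the denominator
vanishes. On `ℓ¹` Fourier norms this boundedness is all that the second order Riesz transforms
require. -/
lemma norm_pd_crSymbol_le {j k : Fin 3} (hj : j = 0 ∨ j = 1) (hk : k = 0 ∨ k = 1)
    (n : Fin 3 → ℤ) :
    ‖2 * Real.pi * Complex.I * n k * crSymbol j n‖₊ ≤ 1 * wt n ^ 0 := by
  have h : 2 * Real.pi * Complex.I * n k * crSymbol j n =
      (((n j : ℝ) * n k / ((n 0 : ℝ) ^ 2 + (n 1 : ℝ) ^ 2) : ℝ) : ℂ) := by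
    have : (2 * Real.pi * Complex.I : ℂ) ≠ 0 := by simp [Real.pi_ne_zero]
    unfold crSymbol
    push_cast
    rw [mul_div_assoc', mul_assoc (2 * Real.pi * Complex.I : ℂ), mul_div_mul_left _ _ this,
      mul_comm (n k : ℂ)]
  rw [h, ← NNReal.coe_le_coe]
  simp only [coe_nnnorm, Complex.norm_real, Real.norm_eq_abs, abs_div, pow_zero, mul_one,
    NNReal.coe_one]
  rw [abs_of_nonneg (by positivity : 0 ≤ (n 0 : ℝ) ^ 2 + (n 1 : ℝ) ^ 2)]
  exact div_le_one_of_le₀ (int_abs_mul_le hj hk n) (by positivity)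

/-- Frequencies are integers: unless `n j = 0`, where the symbol vanishes, the factor `2π |n j|` is
at least one, and the bound for the differentiated symbol applies. -/
lemma norm_crSymbol_le {j : Fin 3} (hj : j = 0 ∨ j = 1) (n : Fin 3 → ℤ) :
    ‖crSymbol j n‖₊ ≤ 1 * wt n ^ 0 := by
  by_cases h0 : n j = 0
  · simp [crSymbol, h0]
  refine le_trans ?_ (norm_pd_crSymbol_le hj hj n)
  rw [nnnorm_mul]
  refine le_mul_of_one_le_left zero_le ?_
  rw [← NNReal.coe_le_coe]
  have h1 : (1 : ℝ) ≤ |(n j : ℝ)| := by exact_mod_cast Int.one_le_abs h0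
  simp only [NNReal.coe_one, coe_nnnorm, norm_mul, Complex.norm_ofNat, Complex.norm_real,
    Complex.norm_I, mul_one, Real.norm_eq_abs, abs_of_pos Real.pi_pos, Complex.norm_intCast]
  nlinarith [Real.pi_gt_three]

/-- The two multipliers invert the divergence in the first two variables, except on frequencies with
`n 0 = n 1 = 0`, where division by zero makes them vanish and `meanSymbol` records the defect. -/
lemma crSymbol_identity (n : Fin 3 → ℤ) :
    2 * Real.pi * Complex.I * n 0 * crSymbol 0 n + 2 * Real.pi * Complex.I * n 1 * crSymbol 1 n =
      1 - meanSymbol n := by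
  have h2 : (2 * Real.pi * Complex.I : ℂ) ≠ 0 := by simp [Real.pi_ne_zero]
  unfold crSymbol meanSymbol
  split_ifs with h
  · simp [h.1, h.2]
  · have h3 : ((n 0 : ℂ) ^ 2 + (n 1 : ℂ) ^ 2) ≠ 0 := by
      intro h4
      have h5 : (n 0) ^ 2 + (n 1) ^ 2 = 0 := by exact_mod_cast h4
      refine h ⟨?_, ?_⟩ <;> nlinarith [sq_nonneg (n 0), sq_nonneg (n 1)]
    rw [mul_div_assoc', mul_div_assoc', ← add_div, sub_zero, div_eq_one_iff_eq (mul_ne_zero h2 h3)]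
    ring

lemma crSymbol_symm (n : Fin 3 → ℤ) :
    2 * Real.pi * Complex.I * n 1 * crSymbol 0 n = 2 * Real.pi * Complex.I * n 0 * crSymbol 1 n := by
  unfold crSymbol; ring

lemma wnorm_mult_le_one {m : (Fin 3 → ℤ) → ℂ} (hm : ∀ n, ‖m n‖₊ ≤ 1 * wt n ^ 0) (s : ℕ)
    (u : C(T3, ℂ)) : wnorm s (mult m u) ≤ wnorm s u := by
  simpa using wnorm_mult_le hm s u

lemma mult_ne_top {m : (Fin 3 → ℤ) → ℂ} (hm : ∀ n, ‖m n‖₊ ≤ 1 * wt n ^ 0) {s : ℕ}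
    {u : C(T3, ℂ)} (hu : wnorm s u ≠ ⊤) : wnorm s (mult m u) ≠ ⊤ :=
  ne_top_of_le_ne_top hu (wnorm_mult_le_one hm s u)

lemma pd_crSymbol_add {u : C(T3, ℂ)} (hu : wnorm 0 u ≠ ⊤) :
    pd 0 (mult (crSymbol 0) u) + pd 1 (mult (crSymbol 1) u) = u - mult meanSymbol u := by
  rw [pd_mult 0 (norm_crSymbol_le (.inl rfl)) hu, pd_mult 1 (norm_crSymbol_le (.inr rfl)) hu]
  have h0 := norm_pd_crSymbol_le (j := 0) (k := 0) (.inl rfl) (.inl rfl)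
  have h1 := norm_pd_crSymbol_le (j := 1) (k := 1) (.inr rfl) (.inr rfl)
  refine eq_of_fc_eq (s := 0) (wnorm_add_ne_top (mult_ne_top h0 hu) (mult_ne_top h1 hu))
    (by rw [sub_eq_add_neg]; exact wnorm_add_ne_top hu
          (by rw [wnorm_neg]; exact mult_ne_top norm_meanSymbol_le hu)) fun n => ?_
  rw [map_add, map_sub, fc_mult h0 hu, fc_mult h1 hu, fc_mult norm_meanSymbol_le hu, ← add_mul,
    crSymbol_identity, sub_mul, one_mul]

lemma pd_crSymbol_symm {u : C(T3, ℂ)} (hu : wnorm 0 u ≠ ⊤) :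
    pd 1 (mult (crSymbol 0) u) = pd 0 (mult (crSymbol 1) u) := by
  rw [pd_mult 1 (norm_crSymbol_le (.inl rfl)) hu, pd_mult 0 (norm_crSymbol_le (.inr rfl)) hu]
  simp only [crSymbol_symm]

lemma pd_mean {j : Fin 3} (hj : j = 0 ∨ j = 1) {u : C(T3, ℂ)} (hu : wnorm 0 u ≠ ⊤) :
    pd j (mult meanSymbol u) = 0 := by
  rw [pd_mult j norm_meanSymbol_le hu]
  have h : ∀ n : Fin 3 → ℤ, 2 * Real.pi * Complex.I * n j * meanSymbol n = 0 := by
    intro n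
    unfold meanSymbol
    split_ifs with h
    · rcases hj with rfl | rfl <;> simp [h.1, h.2]
    · simp
  refine eq_of_fc_eq (s := 0) (ne_top_of_le_ne_top hu (wnorm_mult_le_one (fun n => by simp [h]) 0 u))
    (by simp) fun n => ?_
  rw [fc_mult (r := 0) (K := 0) (fun n => by simp [h]) hu, h]; simp

/-! ### Periodic coordinate functions -/

lemma exists_smooth_arcsin : ∃ κ : ℝ → ℝ, ContDiff ℝ ∞ κ ∧
    ∀ θ : ℝ, |θ| < 1 / 8 → κ (Real.sin (2 * Real.pi * θ)) = θ := by
  -- For `|θ| < 1/8` the sine is at most `√2/2 ≤ 3/4` in modulus, where the bump equals one; the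
  -- outer radius `7/8` stays away from the singularities `±1` of the arcsine.
  let χ : ContDiffBump (0 : ℝ) := ⟨3 / 4, 7 / 8, by norm_num, by norm_num⟩
  refine ⟨fun s => χ s * (Real.arcsin s / (2 * Real.pi)), ?_, fun θ hθ => ?_⟩
  · rw [contDiff_iff_contDiffAt]
    intro s
    by_cases hs : |s| < 1
    · have h1 : s ≠ -1 := by rintro rfl; simp at hs
      have h2 : s ≠ 1 := by rintro rfl; simp at hs
      exact χ.contDiff.contDiffAt.mul ((Real.contDiffAt_arcsin h1 h2).div_const _)
    · have h : (fun s => χ s * (Real.arcsin s / (2 * Real.pi))) =ᶠ[nhds s] fun _ => 0 := by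
        have ho : IsOpen {s : ℝ | 7 / 8 < |s|} := isOpen_lt continuous_const continuous_abs
        filter_upwards [ho.mem_nhds (show 7 / 8 < |s| by linarith)] with y hy
        rw [χ.zero_of_le_dist (by simpa using (le_of_lt hy)), zero_mul]
      exact contDiffAt_const.congr_of_eventuallyEq h
  · have hpi := Real.pi_pos
    rw [abs_lt] at hθ
    have h4 : |Real.sin (2 * Real.pi * θ)| ≤ 3 / 4 := by
      have hle : Real.sin (Real.pi / 4) ≤ 3 / 4 := by
        rw [Real.sin_pi_div_four]
        have : √2 ≤ 3 / 2 := by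
          rw [Real.sqrt_le_left (by norm_num)]; norm_num
        linarith
      rw [abs_le]
      constructor
      · have := Real.sin_le_sin_of_le_of_le_pi_div_two (x := -(Real.pi / 4))
          (y := 2 * Real.pi * θ) (by linarith) (by nlinarith) (by nlinarith)
        rw [Real.sin_neg] at this
        linarith
      · have := Real.sin_le_sin_of_le_of_le_pi_div_two (x := 2 * Real.pi * θ)
          (y := Real.pi / 4) (by nlinarith) (by linarith) (by nlinarith)
        linarith
    beta_reduce
    rw [χ.one_of_mem_closedBall (by simpa using h4), Real.arcsin_sin (by nlinarith) (by nlinarith)]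
    field_simp

lemma wnorm_mFourier_ne_top (s : ℕ) (m : Fin 3 → ℤ) : wnorm s (mFourier m) ≠ ⊤ := by
  rw [wnorm, tsum_eq_single m]
  · finiteness
  · intro n hn
    rw [fc_mFourier, if_neg hn]; simp

/-- There are smooth periodic functions which agree with the coordinates near the origin. -/
lemma exists_periodic_coordinates : ∃ (k : ℝ → ℝ) (X : Fin 3 → C(T3, ℂ)),
    ContDiff ℝ ∞ k ∧ (∀ θ : ℝ, |θ| < 1 / 8 → k θ = θ) ∧ (∀ j s, wnorm s (X j) ≠ ⊤) ∧
    ∀ j x, lift (X j) x = (k (x j) : ℂ) := by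
  obtain ⟨κ, hκ, hκ'⟩ := exists_smooth_arcsin
  have hκ2 : ContDiff ℝ ∞ fun y : Unit → ℝ => κ (y ()) := hκ.comp (contDiff_apply ℝ ℝ ())
  -- `comp` uses only real parts, and the real part of `-i` times the basic exponential in the
  -- `j`-th variable is the sine of `2π` times that variable.
  refine ⟨fun θ => κ (Real.sin (2 * Real.pi * θ)), fun j => comp _ hκ2.continuous
    fun _ => (-Complex.I) • mFourier (Pi.single j 1),
    hκ.comp (Real.contDiff_sin.comp (contDiff_const.mul contDiff_id)), hκ', fun j s => ?_,
    fun j x => ?_⟩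
  · have hfin := wnorm_smul_ne_top (-Complex.I) (wnorm_mFourier_ne_top (s + 6) (Pi.single j 1))
    obtain ⟨C, hC⟩ := exists_wnorm_comp_le (ι := Unit) (s + 6) (by omega)
      (wnorm (s + 6) ((-Complex.I) • mFourier (Pi.single j 1))).toNNReal (Nat.le_add_right s 6) hκ2
    exact ne_top_of_le_ne_top ENNReal.coe_ne_top
      (hC (fun _ => (-Complex.I) • mFourier (Pi.single j 1)) fun _ => by
        rw [ENNReal.coe_toNNReal hfin])
  · change ((κ (((-Complex.I) • mFourier (Pi.single j 1) : C(T3, ℂ)) (toTorus x)).re : ℝ) : ℂ) = _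
    congr 2
    rw [ContinuousMap.smul_apply, mFourier_toTorus]
    have : phase (Pi.single j 1) x = ((2 * Real.pi * x j : ℝ) : ℂ) * Complex.I := by
      rw [phase_apply, Finset.sum_eq_single j]
      · simp; ring
      · intro b _ hb; simp [hb]
      · simp
    rw [this, Complex.exp_mul_I, ← Complex.ofReal_cos, ← Complex.ofReal_sin]
    generalize Real.cos (2 * Real.pi * x j) = c
    generalize Real.sin (2 * Real.pi * x j) = d
    simp


/-! ### Local solutions of the perturbed Cauchy–Riemann system -/

variable {ι : Type} [Fintype ι] [DecidableEq ι]

/-- A right inverse, near the origin, of the constant coefficient operator `∂₀ + J ∂₁`. -/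
def crInverse (J : ι → ι → ℝ) (X : C(T3, ℂ)) (φ : ι → C(T3, ℂ)) (i : ι) : C(T3, ℂ) :=
  mult (crSymbol 0) (φ i) + ∑ k, (-J i k : ℂ) • mult (crSymbol 1) (φ k) +
    X * mult meanSymbol (φ i)

lemma crInverse_sub {s : ℕ} (J : ι → ι → ℝ) (X : C(T3, ℂ)) {φ ψ : ι → C(T3, ℂ)}
    (hφ : ∀ i, wnorm s (φ i) ≠ ⊤) (hψ : ∀ i, wnorm s (ψ i) ≠ ⊤) (i : ι) :
    crInverse J X φ i - crInverse J X ψ i = crInverse J X (φ - ψ) i := by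
  have h0 : ∀ i, wnorm 0 (φ i) ≠ ⊤ := fun i =>
    ne_top_of_le_ne_top (hφ i) (wnorm_mono (Nat.zero_le s) _)
  have h1 : ∀ i, wnorm 0 (ψ i) ≠ ⊤ := fun i =>
    ne_top_of_le_ne_top (hψ i) (wnorm_mono (Nat.zero_le s) _)
  simp only [crInverse, Pi.sub_apply, mult_sub (norm_crSymbol_le (.inl rfl)) (h0 _) (h1 _),
    mult_sub (norm_crSymbol_le (.inr rfl)) (h0 _) (h1 _),
    mult_sub norm_meanSymbol_le (h0 _) (h1 _)]
  ext t
  simp only [ContinuousMap.sub_apply, ContinuousMap.add_apply, ContinuousMap.sum_apply,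
    ContinuousMap.smul_apply, ContinuousMap.mul_apply, smul_eq_mul, mul_sub, Finset.sum_sub_distrib]
  ring

lemma wnorm_crInverse_le {s : ℕ} (J : ι → ι → ℝ) {X : C(T3, ℂ)} (hX : wnorm s X ≠ ⊤)
    (φ : ι → C(T3, ℂ)) (i : ι) : wnorm s (crInverse J X φ i) ≤
      ((1 + ∑ i, ∑ k, ‖J i k‖₊ + (wnorm s X).toNNReal : ℝ≥0) : ℝ≥0∞) * vnorm s φ := by
  push_cast
  rw [ENNReal.coe_toNNReal hX, add_mul, add_mul, one_mul]
  refine (wnorm_add_le _ _ _).trans (add_le_add ((wnorm_add_le _ _ _).trans (add_le_add ?_ ?_)) ?_)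
  · exact (wnorm_mult_le_one (norm_crSymbol_le (.inl rfl)) s _).trans (wnorm_le_vnorm s φ i)
  · refine (wnorm_sum_le _ _ _).trans ?_
    rw [Finset.sum_mul]
    refine le_trans ?_ (Finset.single_le_sum (f := fun i => (∑ k, (‖J i k‖₊ : ℝ≥0∞)) * vnorm s φ)
      (fun _ _ => zero_le) (Finset.mem_univ i))
    rw [Finset.sum_mul]
    gcongr with k
    rw [wnorm_smul]
    gcongr
    · rw [enorm_neg, enorm_eq_nnnorm]
      simp
    · exact (wnorm_mult_le_one (norm_crSymbol_le (.inr rfl)) s _).trans (wnorm_le_vnorm s φ k)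
  · refine (wnorm_mul_le _ _ hX).trans ?_
    gcongr
    exact (wnorm_mult_le_one norm_meanSymbol_le s _).trans (wnorm_le_vnorm s φ i)

lemma pd_crInverse {j : Fin 3} (hj : j = 0 ∨ j = 1) (J : ι → ι → ℝ) {X : C(T3, ℂ)}
    (hX : wnorm 1 X ≠ ⊤) {φ : ι → C(T3, ℂ)} (hφ : ∀ i, wnorm 1 (φ i) ≠ ⊤) (i : ι) :
    pd j (crInverse J X φ i) = pd j (mult (crSymbol 0) (φ i)) +
      ∑ k, (-J i k : ℂ) • pd j (mult (crSymbol 1) (φ k)) + pd j X * mult meanSymbol (φ i) := by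
  have h0 : ∀ i, wnorm 0 (φ i) ≠ ⊤ := fun i =>
    ne_top_of_le_ne_top (hφ i) (wnorm_mono (Nat.zero_le 1) _)
  have ha := mult_ne_top (norm_crSymbol_le (j := 0) (.inl rfl)) (hφ i)
  have hb := fun k => mult_ne_top (norm_crSymbol_le (j := 1) (.inr rfl)) (hφ k)
  have hc := mult_ne_top norm_meanSymbol_le (hφ i)
  have hb' := fun k => wnorm_smul_ne_top (-J i k : ℂ) (hb k)
  rw [crInverse, pd_add j (wnorm_add_ne_top ha (wnorm_sum_ne_top _ hb')) (wnorm_mul_ne_top hX hc),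
    pd_add j ha (wnorm_sum_ne_top _ hb'), pd_sum j _ hb', pd_mul j hX hc, pd_mean hj (h0 i),
    mul_zero, add_zero]
  simp only [pd_smul j _ (hb _)]

/-- No derivative is lost: `∂₁` composed with the first two terms is a multiplier of order zero, and
the term with `X` is annihilated since neither factor depends on the second variable. Hence the
quasilinear term maps the algebra to itself. -/
lemma wnorm_pd_crInverse_le {s : ℕ} (J : ι → ι → ℝ) {X : C(T3, ℂ)} (hX : wnorm (s + 1) X ≠ ⊤)
    (hX1 : pd 1 X = 0) {φ : ι → C(T3, ℂ)} (hφ : ∀ i, wnorm (s + 1) (φ i) ≠ ⊤) (i : ι) :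
    wnorm (s + 1) (pd 1 (crInverse J X φ i)) ≤
      ((1 + ∑ i, ∑ k, ‖J i k‖₊ : ℝ≥0) : ℝ≥0∞) * vnorm (s + 1) φ := by
  have h1 : ∀ i, wnorm 1 (φ i) ≠ ⊤ := fun i =>
    ne_top_of_le_ne_top (hφ i) (wnorm_mono (Nat.le_add_left 1 s) _)
  have h0 : ∀ i, wnorm 0 (φ i) ≠ ⊤ := fun i =>
    ne_top_of_le_ne_top (hφ i) (wnorm_mono (Nat.zero_le _) _)
  rw [pd_crInverse (.inr rfl) J (ne_top_of_le_ne_top hX (wnorm_mono (Nat.le_add_left 1 s) _)) h1,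
    hX1, zero_mul, add_zero]
  push_cast
  rw [add_mul, one_mul]
  refine (wnorm_add_le _ _ _).trans (add_le_add ?_ ?_)
  · rw [pd_mult 1 (norm_crSymbol_le (.inl rfl)) (h0 _)]
    exact (wnorm_mult_le_one (norm_pd_crSymbol_le (.inl rfl) (.inr rfl)) _ _).trans
      (wnorm_le_vnorm _ φ i)
  · refine (wnorm_sum_le _ _ _).trans ?_
    rw [Finset.sum_mul]
    refine le_trans ?_ (Finset.single_le_sum
      (f := fun i => (∑ k, (‖J i k‖₊ : ℝ≥0∞)) * vnorm (s + 1) φ)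
      (fun _ _ => zero_le) (Finset.mem_univ i))
    rw [Finset.sum_mul]
    gcongr with k
    rw [wnorm_smul]
    gcongr
    · rw [enorm_neg, enorm_eq_nnnorm]
      simp
    · rw [pd_mult 1 (norm_crSymbol_le (.inr rfl)) (h0 _)]
      exact (wnorm_mult_le_one (norm_pd_crSymbol_le (.inr rfl) (.inr rfl)) _ _).trans
        (wnorm_le_vnorm _ φ k)

/-- Let `S_j` have symbol `crSymbol j`. Since `J² = -1`, applying `∂₀ + J ∂₁` to `S₀ φ - J S₁ φ`
gives `∂₀ S₀ φ + ∂₁ S₁ φ + J (∂₁ S₀ - ∂₀ S₁) φ`. The last bracket vanishes by symmetry and the rest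
is `φ` minus its mean. The term `X * mean φ` restores the mean wherever `∂₀ X = 1`, the mean being
independent of the first two variables. -/
lemma cr_crInverse {J : ι → ι → ℝ} (hJ : ∀ i l, ∑ k, J i k * J k l = if i = l then -1 else 0)
    {X : C(T3, ℂ)} (hX : wnorm 1 X ≠ ⊤) (hX1 : pd 1 X = 0) {φ : ι → C(T3, ℂ)}
    (hφ : ∀ i, wnorm 1 (φ i) ≠ ⊤) {t : T3} (ht : pd 0 X t = 1) (i : ι) :
    pd 0 (crInverse J X φ i) t + ∑ k, (J i k : ℂ) * pd 1 (crInverse J X φ k) t = φ i t := by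
  have h0 : ∀ i, wnorm 0 (φ i) ≠ ⊤ := fun i =>
    ne_top_of_le_ne_top (hφ i) (wnorm_mono (Nat.zero_le 1) _)
  simp only [pd_crInverse (.inl rfl) J hX hφ, pd_crInverse (.inr rfl) J hX hφ, hX1, zero_mul,
    add_zero, pd_crSymbol_symm (h0 _), ContinuousMap.add_apply, ContinuousMap.sum_apply,
    ContinuousMap.smul_apply, ContinuousMap.mul_apply, ht, one_mul, smul_eq_mul, mul_add,
    Finset.sum_add_distrib, Finset.mul_sum]
  have h1 : ∑ k, ∑ l, (J i k : ℂ) * (-J k l * pd 1 (mult (crSymbol 1) (φ l)) t) =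
      pd 1 (mult (crSymbol 1) (φ i)) t := by
    rw [Finset.sum_comm]
    have : ∀ l, ∑ k, (J i k : ℂ) * (-J k l * pd 1 (mult (crSymbol 1) (φ l)) t) =
        if i = l then pd 1 (mult (crSymbol 1) (φ l)) t else 0 := by
      intro l
      have e : ∑ k, (J i k : ℂ) * (-J k l * pd 1 (mult (crSymbol 1) (φ l)) t) =
          -(((∑ k, J i k * J k l : ℝ) : ℂ)) * pd 1 (mult (crSymbol 1) (φ l)) t := by
        push_cast
        rw [← Finset.sum_neg_distrib, Finset.sum_mul]
        exact Finset.sum_congr rfl fun k _ => by ring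
      rw [e, hJ]
      split_ifs <;> simp
    rw [Finset.sum_congr rfl fun l _ => this l]
    simp
  have h2 := congrArg (fun u => u t) (pd_crSymbol_add (h0 i))
  simp only [ContinuousMap.add_apply, ContinuousMap.sub_apply] at h2
  rw [h1]
  simp only [neg_mul, Finset.sum_neg_distrib]
  linear_combination h2

end

section

set_option linter.unusedSectionVars false

variable {ι : Type} [Fintype ι] [DecidableEq ι]

lemma lift_pd_coordinate {k : ℝ → ℝ} {X : Fin 3 → C(T3, ℂ)} (hk : ContDiff ℝ ∞ k)
    (hX : ∀ j, wnorm 1 (X j) ≠ ⊤) (hXk : ∀ j x, lift (X j) x = (k (x j) : ℂ)) (i j : Fin 3)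
    (x : Fin 3 → ℝ) : lift (pd i (X j)) x = if i = j then ((deriv k (x j) : ℝ) : ℂ) else 0 := by
  have h1 : HasFDerivAt (fun x : Fin 3 → ℝ => k (x j))
      (deriv k (x j) • (ContinuousLinearMap.proj j : (Fin 3 → ℝ) →L[ℝ] ℝ)) x :=
    ((hk.differentiable (by simp) (x j)).hasDerivAt).comp_hasFDerivAt x
      (ContinuousLinearMap.proj (R := ℝ) (φ := fun _ : Fin 3 => ℝ) j).hasFDerivAt
  have h2 := Complex.ofRealCLM.hasFDerivAt.comp x h1
  have h3 : lift (X j) = Complex.ofRealCLM ∘ fun x : Fin 3 → ℝ => k (x j) := funext (hXk j)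
  rw [← fderiv_lift_single i (hX j), h3, h2.fderiv]
  by_cases h : i = j
  · subst h; simp
  · simp [h, Ne.symm h]

lemma fderiv_reLift {g : ι → C(T3, ℂ)} (hg : ∀ i, wnorm 1 (g i) ≠ ⊤) (j : Fin 3)
    (x : Fin 3 → ℝ) (i : ι) :
    fderiv ℝ (reLift g) x (Pi.single j 1) i = (lift (pd j (g i)) x).re := by
  have h1 : ∀ i, HasFDerivAt (fun x => (lift (g i) x).re)
      (Complex.reCLM.comp (fderiv ℝ (lift (g i)) x)) x := fun i =>
    Complex.reCLM.hasFDerivAt.comp x (differentiable_lift (hg i) x).hasFDerivAt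
  have h2 : HasFDerivAt (reLift g)
      (ContinuousLinearMap.pi fun i => Complex.reCLM.comp (fderiv ℝ (lift (g i)) x)) x :=
    hasFDerivAt_pi.2 h1
  rw [h2.fderiv]
  simp [fderiv_lift_single j (hg i)]

lemma norm_lift_le {s : ℕ} {u : C(T3, ℂ)} {R : ℝ≥0} (hu : wnorm s u ≤ R) (x : Fin 3 → ℝ) :
    ‖lift u x‖ ≤ R := by
  have h1 : ‖u‖ₑ ≤ R := (enorm_le_wnorm s _).trans hu
  have h2 : ‖u‖ ≤ R := by rw [enorm_eq_nnnorm] at h1; exact_mod_cast h1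
  exact (u.norm_coe_le_norm _).trans h2

/-- Local families of solutions of the quasilinear Cauchy–Riemann system
`∂₀ u + (J + A(ε u)) ∂₁ u = 0`, depending on a parameter, with prescribed approximate
derivatives at the origin. -/
theorem exists_local_solution (s : ℕ) (hs : 6 ≤ s) {J : ι → ι → ℝ}
    (hJ : ∀ i l, ∑ k, J i k * J k l = if i = l then -1 else 0) {A : ι → ι → (ι → ℝ) → ℝ}
    (hA : ∀ i k, ContDiff ℝ ∞ (A i k)) (hA0 : ∀ i k, A i k 0 = 0) (ξ v : ι → ℝ) :
    ∃ K : ℝ, ∃ ε₀ : ℝ, 0 < ε₀ ∧ ∀ ε : ℝ, 0 ≤ ε → ε ≤ ε₀ → ∃ u : (Fin 3 → ℝ) → ι → ℝ,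
      ContDiff ℝ s u ∧ (∀ x, ‖u x‖ ≤ K) ∧
      (∀ x : Fin 3 → ℝ, |x 0| < 1 / 8 → |x 1| < 1 / 8 → ∀ i,
        fderiv ℝ u x (Pi.single 0 1) i + ∑ k, J i k * fderiv ℝ u x (Pi.single 1 1) k =
          -∑ k, A i k (ε • u x) * fderiv ℝ u x (Pi.single 1 1) k) ∧
      ‖fderiv ℝ u 0 (Pi.single 0 1) - ξ‖ ≤ K * ε ∧
      ‖fderiv ℝ u 0 (Pi.single 2 1) - v‖ ≤ K * ε := by
  obtain ⟨k, X, hk, hkθ, hX, hXk⟩ := exists_periodic_coordinates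
  have hX1 := fun j => hX j 1
  have hpdX := lift_pd_coordinate hk hX1 hXk
  have hk1 : ∀ θ : ℝ, |θ| < 1 / 8 → deriv k θ = 1 := by
    intro θ hθ
    have ho : IsOpen {θ : ℝ | |θ| < 1 / 8} := isOpen_lt continuous_abs continuous_const
    have : k =ᶠ[nhds θ] fun θ => θ := by
      filter_upwards [ho.mem_nhds hθ] with y hy using hkθ y hy
    rw [this.deriv_eq]; simp
  -- One order is set aside, so that first derivatives of the correction can still be bounded
  -- pointwise through `wnorm s`.
  obtain ⟨s, rfl⟩ : ∃ r, s = r + 1 := ⟨s - 1, by omega⟩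
  -- Near the origin this is the linear map with partial derivatives `ξ`, `Jξ`, `v`. It solves the
  -- unperturbed equation there, because `ξ + J J ξ = 0`.
  let P : ι → C(T3, ℂ) := fun i => (ξ i : ℂ) • X 0 + ((∑ l, J i l * ξ l : ℝ) : ℂ) • X 1 +
    (v i : ℂ) • X 2
  have hPs : ∀ s i, wnorm s (P i) ≠ ⊤ := fun s i => wnorm_add_ne_top (wnorm_add_ne_top
    (wnorm_smul_ne_top _ (hX _ _)) (wnorm_smul_ne_top _ (hX _ _))) (wnorm_smul_ne_top _ (hX _ _))
  have hpdP : ∀ j i, pd j (P i) = (ξ i : ℂ) • pd j (X 0) +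
      ((∑ l, J i l * ξ l : ℝ) : ℂ) • pd j (X 1) + (v i : ℂ) • pd j (X 2) := by
    intro j i
    rw [pd_add j (wnorm_add_ne_top (wnorm_smul_ne_top _ (hX1 _)) (wnorm_smul_ne_top _ (hX1 _)))
      (wnorm_smul_ne_top _ (hX1 _)), pd_add j (wnorm_smul_ne_top _ (hX1 _))
      (wnorm_smul_ne_top _ (hX1 _)), pd_smul j _ (hX1 _), pd_smul j _ (hX1 _), pd_smul j _ (hX1 _)]
  have hX10 : pd 1 (X 0) = 0 := lift_injective fun x => by rw [hpdX]; simp; rfl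
  let S := crInverse J (X 0)
  -- `G φ` is the unknown `u` and `G' φ` its derivative in the second variable; the fixed point
  -- equation then reads `φ = -A(ε u) ∂₁ u`.
  let G : (ι → C(T3, ℂ)) → ι → C(T3, ℂ) := fun φ i => P i + S φ i
  let G' : (ι → C(T3, ℂ)) → ι → C(T3, ℂ) := fun φ i => pd 1 (P i) + pd 1 (S φ i)
  let L : ℝ≥0 := 1 + ∑ i, ∑ k, ‖J i k‖₊ + (wnorm (s + 1) (X 0)).toNNReal
  let R : ℝ≥0 := ∑ i, ((wnorm (s + 1) (P i)).toNNReal + (wnorm (s + 1) (pd 1 (P i))).toNNReal) + L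
  have hPpd : ∀ i, wnorm (s + 1) (pd 1 (P i)) ≠ ⊤ := fun i =>
    ne_top_of_le_ne_top (ENNReal.mul_ne_top (by simp) (hPs (s + 1 + 1) i)) (wnorm_pd_le _ _ _)
  have hPR : ∀ i, wnorm (s + 1) (P i) + wnorm (s + 1) (pd 1 (P i)) + L ≤ R := by
    intro i
    simp only [R]
    push_cast
    gcongr
    refine le_trans (le_of_eq ?_) (Finset.single_le_sum (f := fun i =>
      (((wnorm (s + 1) (P i)).toNNReal + (wnorm (s + 1) (pd 1 (P i))).toNNReal : ℝ≥0∞)))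
      (fun _ _ => zero_le) (Finset.mem_univ i))
    rw [ENNReal.coe_toNNReal (hPs _ i), ENNReal.coe_toNNReal (hPpd i)]
  have hfin : ∀ φ : ι → C(T3, ℂ), vnorm (s + 1) φ ≤ 1 → ∀ i, wnorm (s + 1) (φ i) ≠ ⊤ := fun φ hφ i =>
    ne_top_of_le_ne_top ENNReal.one_ne_top ((wnorm_le_vnorm _ _ _).trans hφ)
  have hS : ∀ φ i, wnorm (s + 1) (S φ i) ≤ L * vnorm (s + 1) φ :=
    wnorm_crInverse_le J (hX 0 _)
  have hS' : ∀ φ, (∀ i, wnorm (s + 1) (φ i) ≠ ⊤) → ∀ i,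
      wnorm (s + 1) (pd 1 (S φ i)) ≤ L * vnorm (s + 1) φ := fun φ hφ i =>
    (wnorm_pd_crInverse_le J (hX 0 _) hX10 hφ i).trans (by
      gcongr
      exact_mod_cast le_self_add)
  have hSfin : ∀ φ, vnorm (s + 1) φ ≤ 1 → ∀ i, wnorm (s + 1) (S φ i) ≠ ⊤ := fun φ hφ i =>
    ne_top_of_le_ne_top (ENNReal.mul_ne_top ENNReal.coe_ne_top
      (ne_top_of_le_ne_top ENNReal.one_ne_top hφ)) (hS φ i)
  have h1le : ∀ {u : C(T3, ℂ)}, wnorm (s + 1) u ≠ ⊤ → wnorm 1 u ≠ ⊤ := fun hu =>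
    ne_top_of_le_ne_top hu (wnorm_mono (Nat.le_add_left 1 s) _)
  have hGR : ∀ φ, vnorm (s + 1) φ ≤ 1 → ∀ i, wnorm (s + 1) (G φ i) ≤ R := by
    intro φ hφ i
    refine (wnorm_add_le _ _ _).trans (le_trans ?_ (hPR i))
    refine add_le_add le_self_add ((hS φ i).trans ?_)
    calc _ ≤ (L : ℝ≥0∞) * 1 := by gcongr
      _ = L := mul_one _
  have hsub : ∀ φ ψ, vnorm (s + 1) φ ≤ 1 → vnorm (s + 1) ψ ≤ 1 → ∀ i,
      S φ i - S ψ i = S (φ - ψ) i := fun φ ψ hφ hψ i =>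
    crInverse_sub J (X 0) (hfin φ hφ) (hfin ψ hψ) i
  obtain ⟨K, ε₀, hε₀, hmain⟩ := exists_quasilinear_fixedPoint (s + 1) hs hA hA0 G G' R L hGR
    (fun φ hφ i => by
      refine (wnorm_add_le _ _ _).trans (le_trans ?_ (hPR i))
      refine add_le_add le_add_self ((hS' φ (hfin φ hφ) i).trans ?_)
      calc _ ≤ (L : ℝ≥0∞) * 1 := by gcongr
        _ = L := mul_one _)
    (fun φ ψ hφ hψ i => by
      simp only [G, add_sub_add_left_eq_sub, hsub φ ψ hφ hψ]
      exact hS _ i)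
    (fun φ ψ hφ hψ i => by
      simp only [G', add_sub_add_left_eq_sub]
      have hfd : ∀ i, wnorm (s + 1) ((φ - ψ) i) ≠ ⊤ := fun i => by
        rw [Pi.sub_apply, sub_eq_add_neg]
        exact wnorm_add_ne_top (hfin φ hφ i) (by rw [wnorm_neg]; exact hfin ψ hψ i)
      have e : pd 1 (S φ i) - pd 1 (S ψ i) = pd 1 (S (φ - ψ) i) := by
        rw [← hsub φ ψ hφ hψ, sub_eq_iff_eq_add, ← pd_add, sub_add_cancel]
        · rw [hsub φ ψ hφ hψ]
          refine h1le (ne_top_of_le_ne_top (ENNReal.mul_ne_top ENNReal.coe_ne_top ?_) (hS _ i))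
          exact ENNReal.sum_ne_top.2 fun i _ => hfd i
        · exact h1le (hSfin ψ hψ i)
      rw [e]
      exact hS' _ hfd i)
  -- `R` bounds the solution. The derivatives of `S φ`, which are the error at the origin, are at
  -- most `7 * L * K * ε`, since `φ` has norm at most `K * ε`.
  refine ⟨max R (7 * L * K), ε₀, hε₀, fun ε hε hεle => ?_⟩
  lift ε to ℝ≥0 using hε
  obtain ⟨φ, hφ1, hφK, hφ⟩ := hmain ε (by exact_mod_cast hεle)
  have hGfin : ∀ i, wnorm (s + 1) (G φ i) ≠ ⊤ := fun i =>
    ne_top_of_le_ne_top ENNReal.coe_ne_top (hGR φ hφ1 i)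
  have hG1 := fun i => h1le (hGfin i)
  have hpdG : ∀ j i, pd j (G φ i) = pd j (P i) + pd j (S φ i) := fun j i =>
    pd_add j (hPs 1 i) (h1le (hSfin φ hφ1 i))
  have hpdSn : ∀ j i x, ‖lift (pd j (S φ i)) x‖ ≤ 7 * L * K * ε := by
    intro j i x
    have : wnorm s (pd j (S φ i)) ≤ (7 * L * K * ε : ℝ≥0) := by
      refine (wnorm_pd_le j s _).trans ?_
      calc (7 : ℝ≥0∞) * wnorm (s + 1) (S φ i) ≤ 7 * (L * (K * ε)) := by
            gcongr
            exact (hS φ i).trans (by gcongr)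
        _ = _ := by push_cast; ring
    exact_mod_cast norm_lift_le this x
  have happrox : ∀ j (w : ι → ℝ), (∀ i, (lift (pd j (P i)) 0) = w i) →
      ‖fderiv ℝ (reLift (G φ)) 0 (Pi.single j 1) - w‖ ≤ max R (7 * L * K) * ε := by
    intro j w hw
    have h1 : ‖fderiv ℝ (reLift (G φ)) 0 (Pi.single j 1) - w‖ ≤ 7 * L * K * ε := by
      refine (pi_norm_le_iff_of_nonneg (by positivity)).2 fun i => ?_
      rw [Pi.sub_apply, fderiv_reLift hG1, hpdG]
      have : (lift (pd j (P i) + pd j (S φ i)) 0).re - w i = (lift (pd j (S φ i)) 0).re := by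
        change (lift (pd j (P i)) 0 + lift (pd j (S φ i)) 0).re - w i = _
        rw [hw]; simp
      rw [this]
      exact (Complex.abs_re_le_norm _).trans (hpdSn j i 0)
    refine h1.trans ?_
    gcongr
    exact le_max_right _ _
  have h8 : |(0 : ℝ)| < 1 / 8 := by norm_num
  refine ⟨reLift (G φ), contDiff_reLift hGfin, fun x => (norm_reLift_le (hGR φ hφ1) x).trans
    (le_max_left _ _), fun x hx0 hx1 i => ?_, happrox 0 ξ fun i => ?_, happrox 2 v fun i => ?_⟩
  · simp only [fderiv_reLift hG1]
    have hcr := cr_crInverse hJ (hX1 0) hX10 (fun i => h1le (hfin φ hφ1 i)) (t := toTorus x)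
      (by
        have := hpdX 0 0 x
        rw [lift] at this
        rw [this, if_pos rfl, hk1 _ hx0]; simp) i
    have hcr2 : lift (pd 0 (G φ i)) x + ∑ l, (J i l : ℂ) * lift (pd 1 (G φ l)) x =
        lift (φ i) x := by
      simp only [hpdG]
      have e1 : ∀ j i, lift (pd j (P i) + pd j (S φ i)) x =
          lift (pd j (P i)) x + lift (pd j (S φ i)) x := fun _ _ => rfl
      have e2 : ∀ j i, lift (pd j (P i)) x = ξ i * lift (pd j (X 0)) x +
          ((∑ l, J i l * ξ l : ℝ) : ℂ) * lift (pd j (X 1)) x + v i * lift (pd j (X 2)) x := by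
        intro j i; rw [hpdP]; rfl
      simp only [e1, e2, hpdX, if_true, hk1 _ hx0, hk1 _ hx1, mul_add, Finset.sum_add_distrib,
        Complex.ofReal_one, mul_one]
      have e3 : ∑ l, (J i l : ℂ) * ((∑ m, J l m * ξ m : ℝ) : ℂ) = -ξ i := by
        have : ∑ l, J i l * ∑ m, J l m * ξ m = -ξ i := by
          simp only [Finset.mul_sum, ← mul_assoc]
          rw [Finset.sum_comm]
          simp only [← Finset.sum_mul, hJ]
          simp
        exact_mod_cast this
      rw [e3]
      simp
      have hcr' : lift (pd 0 (S φ i)) x + ∑ l, (J i l : ℂ) * lift (pd 1 (S φ l)) x =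
        lift (φ i) x := hcr
      linear_combination hcr'
    have hre := congrArg Complex.re hcr2
    rw [Complex.add_re, Complex.re_sum] at hre
    simp only [Complex.re_ofReal_mul] at hre
    rw [hre, hφ i]
    have e4 : lift (-∑ l, comp (A i l) (hA i l).continuous (fun l => ((ε : ℝ) : ℂ) • G φ l) *
        rePart (G' φ l)) x = -∑ l, ((A i l ((ε : ℝ) • reLift (G φ) x) : ℝ) : ℂ) *
          (((lift (pd 1 (G φ l)) x).re : ℝ) : ℂ) := by
      simp only [lift, ContinuousMap.neg_apply, ContinuousMap.sum_apply, ContinuousMap.mul_apply,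
        comp_apply, hpdG]
      congr 1
      refine Finset.sum_congr rfl fun l _ => ?_
      congr 3
      ext m
      simp [reLift, lift]
    rw [e4, Complex.neg_re, Complex.re_sum]
    simp only [Complex.re_ofReal_mul, Complex.ofReal_re]
  · rw [hpdP]
    change (ξ i : ℂ) * lift (pd 0 (X 0)) 0 + _ * lift (pd 0 (X 1)) 0 + _ * lift (pd 0 (X 2)) 0 = _
    simp only [hpdX, Pi.zero_apply, hk1 0 h8]
    simp
  · rw [hpdP]
    change (ξ i : ℂ) * lift (pd 2 (X 0)) 0 + _ * lift (pd 2 (X 1)) 0 + _ * lift (pd 2 (X 2)) 0 = _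
    simp only [hpdX, Pi.zero_apply, hk1 0 h8]
    simp

end

/-! ### Families of pseudoholomorphic discs in a vector space. -/

section

/-- The linear map `(t, x + iy) ↦ (x/8, y/8, t)`. -/
def parameterMap : ℝ × ℂ →L[ℝ] (Fin 3 → ℝ) :=
  ContinuousLinearMap.pi ![(8⁻¹ : ℝ) • Complex.reCLM.comp (ContinuousLinearMap.snd ℝ ℝ ℂ),
    (8⁻¹ : ℝ) • Complex.imCLM.comp (ContinuousLinearMap.snd ℝ ℝ ℂ), ContinuousLinearMap.fst ℝ ℝ ℂ]

lemma parameterMap_zero (t : ℝ) (z : ℂ) : parameterMap (t, z) 0 = 8⁻¹ * z.re := by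
  simp [parameterMap]

lemma parameterMap_one (t : ℝ) (z : ℂ) : parameterMap (t, z) 1 = 8⁻¹ * z.im := by
  simp [parameterMap]

lemma parameterMap_two (t : ℝ) (z : ℂ) : parameterMap (t, z) 2 = t := by
  simp [parameterMap]

lemma parameterMap_real : parameterMap (0, 1) = (8⁻¹ : ℝ) • Pi.single 0 1 := by
  ext i; fin_cases i <;> simp [parameterMap_zero, parameterMap_one, parameterMap_two]

lemma parameterMap_I : parameterMap (0, Complex.I) = (8⁻¹ : ℝ) • Pi.single 1 1 := by
  ext i; fin_cases i <;> simp [parameterMap_zero, parameterMap_one, parameterMap_two]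

lemma parameterMap_time : parameterMap (1, 0) = Pi.single 2 1 := by
  ext i; fin_cases i <;> simp [parameterMap_zero, parameterMap_one, parameterMap_two]

/-- Local existence of families of pseudoholomorphic discs in a vector space, with approximately
prescribed derivatives at the centre. -/
theorem exists_disc_family {E : Type*} [NormedAddCommGroup E] [NormedSpace ℝ E]
    [FiniteDimensional ℝ E] (s : ℕ) (hs : 6 ≤ s) {J : E → E →L[ℝ] E} (hJ : ContDiff ℝ ∞ J) (x₀ : E)
    (hJ0 : ∀ v, J x₀ (J x₀ v) = -v) (ξ v : E) :
    ∃ K : ℝ, ∃ ε₀ : ℝ, 0 < ε₀ ∧ ∀ ε : ℝ, 0 ≤ ε → ε ≤ ε₀ → ∃ F : ℝ × ℂ → E,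
      ContDiff ℝ s F ∧ (∀ p, ‖F p‖ ≤ K) ∧
      (∀ (t : ℝ) (z : ℂ), ‖z‖ < 1 → fderiv ℝ F (t, z) (0, 1) +
        J (x₀ + ε • F (t, z)) (fderiv ℝ F (t, z) (0, Complex.I)) = 0) ∧
      ‖fderiv ℝ F 0 (0, 1) - ξ‖ ≤ K * ε ∧ ‖fderiv ℝ F 0 (1, 0) - v‖ ≤ K * ε := by
  let e : E ≃L[ℝ] (Fin (Module.finrank ℝ E) → ℝ) := (Module.finBasis ℝ E).equivFunL
  let mat : (E →L[ℝ] E) → Fin (Module.finrank ℝ E) → Fin (Module.finrank ℝ E) → ℝ :=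
    fun B i k => e (B (e.symm (Pi.single k 1))) i
  have hmat : ∀ (B : E →L[ℝ] E) w i, ∑ k, mat B i k * w k = e (B (e.symm w)) i := by
    intro B w i
    conv_rhs => rw [← Finset.univ_sum_single w, map_sum, map_sum, map_sum, Finset.sum_apply]
    refine Finset.sum_congr rfl fun k _ => ?_
    have : Pi.single k (w k) = w k • (Pi.single k 1 : Fin (Module.finrank ℝ E) → ℝ) := by
      simp [← Pi.single_smul]
    rw [this]
    simp [mat, mul_comm]
  have h1 : ∀ i l, ∑ k, mat (J x₀) i k * mat (J x₀) k l = if i = l then -1 else 0 := by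
    intro i l
    rw [hmat (J x₀) (fun k => mat (J x₀) k l) i]
    have : (fun k => mat (J x₀) k l) = e (J x₀ (e.symm (Pi.single l 1))) := rfl
    rw [this, e.symm_apply_apply, hJ0]
    simp [Pi.single_apply]
    split_ifs <;> simp
  -- The coefficient is split into its value at `x₀` and a perturbation vanishing at `0`. Thus `J² =
  -- -1` is needed at `x₀` only, which permits a cut-off `J`.
  have hA : ∀ i k, ContDiff ℝ ∞ fun y => mat (J (x₀ + e.symm y) - J x₀) i k := by
    intro i k
    have h2 : ContDiff ℝ ∞ fun y => J (x₀ + e.symm y) - J x₀ :=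
      (hJ.comp (contDiff_const.add e.symm.contDiff)).sub contDiff_const
    exact (contDiff_apply ℝ ℝ i).comp (e.contDiff.comp (h2.clm_apply contDiff_const))
  -- `parameterMap` shrinks the unit disc by `8` to fit the region where the equation holds;
  -- prescribing `8 • ξ` compensates for this in the derivative.
  obtain ⟨K, ε₀, hε₀, hmain⟩ := exists_local_solution s hs h1 hA
    (fun i k => by simp [mat]) (e ((8 : ℝ) • ξ)) (e v)
  have hKn : 0 ≤ K := by
    obtain ⟨u, -, hu, -⟩ := hmain 0 le_rfl hε₀.le
    exact (norm_nonneg _).trans (hu 0)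
  let c : ℝ := ‖(e.symm : (Fin (Module.finrank ℝ E) → ℝ) →L[ℝ] E)‖
  refine ⟨c * K, ε₀, hε₀, fun ε hε hεle => ?_⟩
  obtain ⟨u, hu, huK, hcr, hξ, hv⟩ := hmain ε hε hεle
  have hd : ∀ p w, fderiv ℝ (fun p => e.symm (u (parameterMap p))) p w =
      e.symm (fderiv ℝ u (parameterMap p) (parameterMap w)) := by
    intro p w
    have hud := (hu.differentiable (by norm_cast; omega) (parameterMap p)).hasFDerivAt
    have h3 := (e.symm.hasFDerivAt.comp p (hud.comp p parameterMap.hasFDerivAt))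
    have h4 : (fun p => e.symm (u (parameterMap p))) = e.symm ∘ (u ∘ parameterMap) := rfl
    rw [h4, h3.fderiv]; rfl
  have hb : ∀ w, ‖e.symm w‖ ≤ c * ‖w‖ := fun w =>
    (e.symm : (Fin (Module.finrank ℝ E) → ℝ) →L[ℝ] E).le_opNorm w
  refine ⟨fun p => e.symm (u (parameterMap p)), e.symm.contDiff.comp (hu.comp parameterMap.contDiff),
    fun p => (hb _).trans (by gcongr; exact huK _), fun t z hz => ?_, ?_, ?_⟩
  · rw [hd, hd, parameterMap_real, parameterMap_I]
    apply e.injective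
    have hz0 : |parameterMap (t, z) 0| < 1 / 8 := by
      rw [parameterMap_zero, abs_mul, abs_of_pos (by norm_num : (0:ℝ) < 8⁻¹)]
      linarith [Complex.abs_re_le_norm z]
    have hz1 : |parameterMap (t, z) 1| < 1 / 8 := by
      rw [parameterMap_one, abs_mul, abs_of_pos (by norm_num : (0:ℝ) < 8⁻¹)]
      linarith [Complex.abs_im_le_norm z]
    ext i
    have h5 := hcr _ hz0 hz1 i
    rw [hmat, hmat] at h5
    simp only [map_smul, map_add, map_zero, Pi.add_apply, Pi.smul_apply, Pi.zero_apply,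
      e.apply_symm_apply, smul_eq_mul]
    simp only [_root_.sub_apply, map_sub, Pi.sub_apply, map_smul] at h5
    linear_combination (8⁻¹ : ℝ) * h5
  · rw [hd, map_zero, parameterMap_real]
    have : e.symm (fderiv ℝ u 0 ((8⁻¹ : ℝ) • Pi.single 0 1)) - ξ =
        (8⁻¹ : ℝ) • e.symm (fderiv ℝ u 0 (Pi.single 0 1) - e ((8 : ℝ) • ξ)) := by
      rw [map_sub, e.symm_apply_apply, map_smul, map_smul, smul_sub, smul_smul]; norm_num
    rw [this, norm_smul]
    calc _ ≤ 1 * (c * (K * ε)) := by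
          gcongr
          · norm_num
          · exact (hb _).trans (by gcongr)
      _ = _ := by ring
  · rw [hd, map_zero, parameterMap_time]
    have : e.symm (fderiv ℝ u 0 (Pi.single 2 1)) - v =
        e.symm (fderiv ℝ u 0 (Pi.single 2 1) - e v) := by
      rw [map_sub, e.symm_apply_apply]
    rw [this]
    calc _ ≤ c * (K * ε) := (hb _).trans (by gcongr)
      _ = _ := by ring

end

end WienerTorus

namespace PseudoHolomorphic

section

/-! ### Smooth functions and the norms on the disc -/

lemma extendByZero_apply (g : disc → ℝ) (ζ : disc) : extendByZero g ζ = g ζ :=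
  Subtype.val_injective.extend_apply g 0 ζ

lemma extendByZero_eqOn (G : ℂ → ℝ) : Set.EqOn (extendByZero fun ζ : disc => G ζ) G disc :=
  fun z hz => extendByZero_apply (fun ζ : disc => G ζ) ⟨z, hz⟩

lemma isOpen_disc : IsOpen (disc : Set ℂ) := disc.isOpen

lemma mem_disc {z : ℂ} : z ∈ disc ↔ ‖z‖ < 1 := by
  change z ∈ Metric.ball (0 : ℂ) 1 ↔ _
  simp

lemma convex_disc : Convex ℝ (disc : Set ℂ) := convex_ball _ _

lemma contDiffOn_extendByZero {G : ℂ → ℝ} {n : WithTop ℕ∞} (hG : ContDiffOn ℝ n G disc) :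
    ContDiffOn ℝ n (extendByZero fun ζ : disc => G ζ) disc :=
  hG.congr (extendByZero_eqOn G)

lemma iteratedFDeriv_eq_of_eqOn {g G : ℂ → ℝ} (h : Set.EqOn g G disc) (j : ℕ) {z : ℂ}
    (hz : z ∈ disc) : iteratedFDeriv ℝ j g z = iteratedFDeriv ℝ j G z :=
  Filter.EventuallyEq.eq_of_nhds
    ((h.eventuallyEq_of_mem (isOpen_disc.mem_nhds hz)).iteratedFDeriv ℝ j)

/-- One extra derivative gives a Lipschitz bound on the convex disc. Distances there are at most
`2`, so passing to the exponent `α` costs a factor `2 ^ (1 - α) ≤ 2`. -/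
lemma holderNormLE_of_bound {k : ℕ} {α : ℝ} (hα₀ : 0 < α) (hα₁ : α < 1) {G : ℂ → ℝ}
    (hG : ContDiff ℝ (k + 1) G) {C : ℝ} (hC : 0 ≤ C)
    (hb : ∀ j ≤ k + 1, ∀ z ∈ disc, ‖iteratedFDeriv ℝ j G z‖ ≤ C) :
    HolderNormLE k α (extendByZero fun ζ : disc => G ζ) (2 * C) := by
  refine ⟨contDiffOn_extendByZero (hG.of_le (by norm_cast; omega)).contDiffOn,
    fun j hj => ⟨fun z hz => ?_, fun z hz w hw => ?_⟩⟩
  · rw [iteratedFDeriv_eq_of_eqOn (extendByZero_eqOn G) j hz]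
    linarith [hb j (by omega) z hz]
  · rw [iteratedFDeriv_eq_of_eqOn (extendByZero_eqOn G) j hz,
      iteratedFDeriv_eq_of_eqOn (extendByZero_eqOn G) j hw]
    have hd : Differentiable ℝ (iteratedFDeriv ℝ j G) :=
      hG.differentiable_iteratedFDeriv (by norm_cast; omega)
    have h1 := convex_disc.norm_image_sub_le_of_norm_fderiv_le (𝕜 := ℝ)
      (fun x _ => hd x) (fun x hx => by
        rw [norm_fderiv_iteratedFDeriv]; exact hb (j + 1) (by omega) x hx) hw hz
    refine h1.trans ?_
    by_cases hzw : z = w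
    · subst hzw; simp [Real.zero_rpow hα₀.ne']
    have hpos : 0 < ‖z - w‖ := norm_pos_iff.2 (sub_ne_zero.2 hzw)
    have h2 : ‖z - w‖ ≤ 2 := by
      have := norm_sub_le z w
      linarith [mem_disc.1 hz, mem_disc.1 hw]
    have h3 : ‖z - w‖ = ‖z - w‖ ^ (1 - α) * ‖z - w‖ ^ α := by
      rw [← Real.rpow_add hpos]; simp
    have h4 : ‖z - w‖ ^ (1 - α) ≤ 2 := by
      calc ‖z - w‖ ^ (1 - α) ≤ 2 ^ (1 - α) :=
            Real.rpow_le_rpow hpos.le h2 (by linarith)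
        _ ≤ 2 ^ (1 : ℝ) := Real.rpow_le_rpow_of_exponent_le one_le_two (by linarith)
        _ = 2 := by simp
    calc C * ‖z - w‖ = C * (‖z - w‖ ^ (1 - α) * ‖z - w‖ ^ α) := by rw [← h3]
      _ ≤ C * (2 * ‖z - w‖ ^ α) := by gcongr
      _ = _ := by ring

/-- A function supported inside the disc times a `C^n` function on the disc is `C^n`. -/
lemma contDiff_mul_of_tsupport_subset {n : WithTop ℕ∞} {u w : ℂ → ℝ} (hu : ContDiffOn ℝ n u disc)
    (hw : ContDiff ℝ n w) (hws : tsupport w ⊆ disc) : ContDiff ℝ n fun z => u z * w z := by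
  rw [contDiff_iff_contDiffAt]
  intro z
  by_cases hz : z ∈ tsupport w
  · exact (hu.contDiffAt (isOpen_disc.mem_nhds (hws hz))).mul hw.contDiffAt
  · have h1 : (fun z => u z * w z) =ᶠ[𝓝 z] fun _ => 0 := by
      filter_upwards [notMem_tsupport_iff_eventuallyEq.1 hz] with y hy; simp [hy]
    exact contDiffAt_const.congr_of_eventuallyEq h1

lemma continuous_mul_of_tsupport_subset {u w : ℂ → ℝ} (hu : ContinuousOn u disc)
    (hw : Continuous w) (hws : tsupport w ⊆ disc) : Continuous fun z => u z * w z :=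
  contDiff_zero.1 (contDiff_mul_of_tsupport_subset (contDiffOn_zero.2 hu) (contDiff_zero.2 hw) hws)

lemma tsupport_fderiv_apply_subset (φ : ℂ → ℝ) (v : ℂ) :
    tsupport (fun z => fderiv ℝ φ z v) ⊆ tsupport φ :=
  (closure_mono fun z hz => by
    simp only [Function.mem_support] at hz ⊢
    intro h; exact hz (by rw [h]; rfl)).trans (tsupport_fderiv_subset ℝ)

lemma setIntegral_disc_eq_integral {f : ℂ → ℝ} (hf : tsupport f ⊆ disc) :
    ∫ z in (disc : Set ℂ), f z = ∫ z, f z :=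
  MeasureTheory.setIntegral_eq_integral_of_forall_compl_eq_zero fun _ hz =>
    image_eq_zero_of_notMem_tsupport fun h => hz (hf h)

open MeasureTheory in
/-- Integration by parts on the disc. -/
lemma integral_mul_fderiv_of_contDiffOn {g φ : ℂ → ℝ} (hg : ContDiffOn ℝ 1 g disc)
    (hφ : ContDiff ℝ 1 φ) (hc : HasCompactSupport φ) (hs : tsupport φ ⊆ disc) (v : ℂ) :
    ∫ z in (disc : Set ℂ), g z * fderiv ℝ φ z v
      = - ∫ z in (disc : Set ℂ), fderiv ℝ g z v * φ z := by
  have hsub := tsupport_fderiv_apply_subset φ v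
  rw [setIntegral_disc_eq_integral ((tsupport_mul_subset_right).trans (hsub.trans hs)),
    setIntegral_disc_eq_integral ((tsupport_mul_subset_right).trans hs)]
  have hint : ∀ {u w : ℂ → ℝ}, ContinuousOn u disc → Continuous w → HasCompactSupport w →
      tsupport w ⊆ disc → Integrable fun z => u z * w z := fun hu hw hwc hws =>
    (continuous_mul_of_tsupport_subset hu hw hws).integrable_of_hasCompactSupport hwc.mul_left
  have hφ' : Continuous fun z => fderiv ℝ φ z v :=
    (hφ.continuous_fderiv (by simp)).clm_apply continuous_const
  have hg' : ContinuousOn (fun z => fderiv ℝ g z v) disc :=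
    (hg.continuousOn_fderiv_of_isOpen isOpen_disc (by simp)).clm_apply continuousOn_const
  exact integral_mul_fderiv_eq_neg_fderiv_mul_of_integrable (μ := (volume : Measure ℂ))
    (𝕜 := ℝ) (v := v) (hint hg' hφ.continuous hc hs)
    (hint hg.continuousOn hφ' (hc.of_isClosed_subset (isClosed_tsupport _) hsub) (hsub.trans hs))
    (hint hg.continuousOn hφ.continuous hc hs)
    (fun z hz => (hg.contDiffAt (isOpen_disc.mem_nhds (hs hz))).differentiableAt (by simp))
    (fun z _ => hφ.differentiable (by simp) z)

lemma isWeakPartial_of_contDiffOn {g : ℂ → ℝ} (hg : ContDiffOn ℝ 1 g disc) (v : ℂ) :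
    IsWeakPartial v g fun z => fderiv ℝ g z v := fun _ hφ hc hs =>
  integral_mul_fderiv_of_contDiffOn hg (hφ.of_le (by norm_cast)) hc hs v

open MeasureTheory in
/-- The constant in the comparison of `L^p` norms and sup norms. -/
def lpConst (p : ℝ) : ℝ :=
  (((volume.restrict (disc : Set ℂ)) Set.univ) ^ ((ENNReal.ofReal p).toReal⁻¹)).toReal

lemma volume_disc_lt_top : MeasureTheory.volume (disc : Set ℂ) < ⊤ :=
  MeasureTheory.measure_ball_lt_top

instance : MeasureTheory.IsFiniteMeasure (MeasureTheory.volume.restrict (disc : Set ℂ)) :=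
  ⟨by rw [MeasureTheory.Measure.restrict_apply_univ]; exact volume_disc_lt_top⟩

open MeasureTheory in
lemma lpNormLE_of_bound (p : ℝ) {g : ℂ → ℝ} (hg : ContinuousOn g disc) {C : ℝ}
    (hb : ∀ z ∈ disc, ‖g z‖ ≤ C) : LpNormLE p g (lpConst p * C) := by
  have hm : AEStronglyMeasurable g (volume.restrict (disc : Set ℂ)) :=
    hg.aestronglyMeasurable isOpen_disc.measurableSet
  have hae : ∀ᵐ z ∂(volume.restrict (disc : Set ℂ)), ‖g z‖ ≤ C :=
    (ae_restrict_iff' isOpen_disc.measurableSet).2 (Filter.Eventually.of_forall hb)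
  refine ⟨MemLp.of_bound hm C hae, (eLpNorm_le_of_ae_bound hae).trans ?_⟩
  rw [lpConst, ENNReal.ofReal_mul ENNReal.toReal_nonneg, ENNReal.ofReal_toReal]
  exact ENNReal.rpow_ne_top_of_nonneg (by positivity) (measure_ne_top _ _)

lemma isWeakPartial_congr {v : ℂ} {g g' d d' : ℂ → ℝ} (h : IsWeakPartial v g d)
    (hg : Set.EqOn g' g disc) (hd : Set.EqOn d' d disc) : IsWeakPartial v g' d' := by
  intro φ hφ hc hs
  have e1 : ∫ z in (disc : Set ℂ), g' z * fderiv ℝ φ z v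
      = ∫ z in (disc : Set ℂ), g z * fderiv ℝ φ z v :=
    MeasureTheory.setIntegral_congr_fun isOpen_disc.measurableSet
      fun z hz => by rw [hg hz]
  have e2 : ∫ z in (disc : Set ℂ), d' z * φ z = ∫ z in (disc : Set ℂ), d z * φ z :=
    MeasureTheory.setIntegral_congr_fun isOpen_disc.measurableSet
      fun z hz => by rw [hd hz]
  rw [e1, e2, h φ hφ hc hs]

/-- Classical derivatives are weak derivatives. The function `g` is kept apart from `G` because an
extension by zero agrees with a smooth function only on the disc. -/
lemma sobolevNormLE_of_bound (p : ℝ) (k : ℕ) {g G : ℂ → ℝ} (hG : ContDiff ℝ k G)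
    (hgG : Set.EqOn g G disc) {C : ℝ}
    (hb : ∀ j ≤ k, ∀ z ∈ disc, ‖iteratedFDeriv ℝ j G z‖ ≤ C) :
    SobolevNormLE p k g (lpConst p * C) := by
  induction k generalizing g G with
  | zero =>
    refine lpNormLE_of_bound p (hG.continuous.continuousOn.congr hgG) fun z hz => ?_
    rw [hgG hz, ← norm_iteratedFDeriv_zero (𝕜 := ℝ) (f := G)]
    exact hb 0 le_rfl z hz
  | succ k ih =>
    have h1 : ∀ v : ℂ, ‖v‖ = 1 → SobolevNormLE p k (fun z => fderiv ℝ G z v) (lpConst p * C) := by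
      intro v hv
      have hfd : ContDiff ℝ k (fderiv ℝ G) := hG.fderiv_right (by norm_cast)
      refine ih (hfd.clm_apply contDiff_const) (Set.eqOn_refl _ _) fun j hj z hz => ?_
      refine (norm_iteratedFDeriv_clm_apply_const hfd.contDiffAt (by exact_mod_cast hj)).trans ?_
      rw [norm_iteratedFDeriv_fderiv, hv, one_mul]
      exact hb (j + 1) (by omega) z hz
    have hw : ∀ v : ℂ, IsWeakPartial v g fun z => fderiv ℝ G z v := fun v =>
      isWeakPartial_congr (isWeakPartial_of_contDiffOn
        ((hG.of_le (by norm_cast; omega)).contDiffOn) v) hgG (Set.eqOn_refl _ _)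
    refine ⟨lpNormLE_of_bound p (hG.continuous.continuousOn.congr hgG) fun z hz => ?_,
      _, _, hw 1, hw Complex.I, h1 1 (by simp), h1 Complex.I (by simp)⟩
    rw [hgG hz, ← norm_iteratedFDeriv_zero (𝕜 := ℝ) (f := G)]
    exact hb 0 (Nat.zero_le _) z hz

lemma LpNormLE.mono {p : ℝ} {g : ℂ → ℝ} {C C' : ℝ} (hC : C ≤ C') (h : LpNormLE p g C) :
    LpNormLE p g C' :=
  ⟨h.1, h.2.trans (ENNReal.ofReal_le_ofReal hC)⟩

lemma SobolevNormLE.mono {p : ℝ} {k : ℕ} {g : ℂ → ℝ} {C C' : ℝ} (hC : C ≤ C')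
    (h : SobolevNormLE p k g C) : SobolevNormLE p k g C' := by
  induction k generalizing g with
  | zero => exact LpNormLE.mono hC h
  | succ k ih =>
    obtain ⟨h0, g₁, g₂, w₁, w₂, h₁, h₂⟩ := h
    exact ⟨h0.mono hC, g₁, g₂, w₁, w₂, ih h₁, ih h₂⟩

lemma SmoothnessClass.NormLE.mono {X : SmoothnessClass} {g : disc → ℝ} {C C' : ℝ} (hC : C ≤ C')
    (h : X.NormLE g C) : X.NormLE g C' := by
  cases X with
  | holder k α hk hα₀ hα₁ =>
    refine ⟨h.1, fun j hj => ⟨fun z hz => ((h.2 j hj).1 z hz).trans hC, fun z hz w hw =>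
      ((h.2 j hj).2 z hz w hw).trans ?_⟩⟩
    have := Real.rpow_nonneg (norm_nonneg (z - w)) α
    gcongr
  | sobolev k p hk hp => exact SobolevNormLE.mono hC h

/-- The number of derivatives that control the norm of the class `X`. -/
def SmoothnessClass.order : SmoothnessClass → ℕ
  | .holder k _ _ _ _ => k + 1
  | .sobolev k _ _ _ => k

lemma SmoothnessClass.exists_normLE_of_bound (X : SmoothnessClass) : ∃ K : ℝ, 0 ≤ K ∧
    ∀ (G : ℂ → ℝ) (C : ℝ), ContDiff ℝ X.order G → 0 ≤ C →
      (∀ j ≤ X.order, ∀ z ∈ disc, ‖iteratedFDeriv ℝ j G z‖ ≤ C) →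
      X.NormLE (fun ζ => G ζ) (K * C) := by
  cases X with
  | holder k α hk hα₀ hα₁ =>
    exact ⟨2, zero_le_two, fun G C hG hC hb =>
      holderNormLE_of_bound hα₀ hα₁ (by exact_mod_cast hG) hC hb⟩
  | sobolev k p hk hp =>
    exact ⟨lpConst p, ENNReal.toReal_nonneg, fun G C hG _ hb =>
      sobolevNormLE_of_bound p k hG (extendByZero_eqOn G) hb⟩

/-! ### Difference quotients -/

/-- The remainder of the difference quotient in the first variable. -/
def quotientRemainder {F : Type*} [NormedAddCommGroup F] [NormedSpace ℝ F] (H : ℝ × ℂ → F)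
    (t : ℝ) (z : ℂ) : F := t⁻¹ • (H (t, z) - H (0, z)) - fderiv ℝ H (0, z) (1, 0)

/-- The mean value inequality for `s ↦ H (s, z) - s • ∂H (0, z)`, uniformly in `z` because the
derivative is uniformly continuous on a compact set. -/
lemma quotientRemainder_small {F : Type*} [NormedAddCommGroup F] [NormedSpace ℝ F]
    {H : ℝ × ℂ → F} (hH : ContDiff ℝ 1 H) {δ : ℝ} (hδ : 0 < δ) :
    ∀ᶠ t : ℝ in 𝓝[≠] 0, ∀ z ∈ Metric.closedBall (0 : ℂ) 1, ‖quotientRemainder H t z‖ ≤ δ := by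
  have hc : Continuous fun p : ℝ × ℂ => fderiv ℝ H p (1, 0) :=
    (hH.continuous_fderiv one_ne_zero).clm_apply continuous_const
  have hK : IsCompact (Set.Icc (-1 : ℝ) 1 ×ˢ Metric.closedBall (0 : ℂ) 1) :=
    isCompact_Icc.prod (isCompact_closedBall _ _)
  have hu := hK.uniformContinuousOn_of_continuous hc.continuousOn
  rw [Metric.uniformContinuousOn_iff] at hu
  obtain ⟨η, hη, hu⟩ := hu δ hδ
  have h0 : ∀ᶠ t : ℝ in 𝓝[≠] 0, |t| < min η 1 := by
    refine nhdsWithin_le_nhds ?_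
    have : Metric.ball (0 : ℝ) (min η 1) ∈ 𝓝 (0 : ℝ) := Metric.ball_mem_nhds _ (by positivity)
    filter_upwards [this] with t ht
    simpa using ht
  filter_upwards [h0, self_mem_nhdsWithin] with t ht ht0 z hz
  have ht1 : |t| < 1 := ht.trans_le (min_le_right _ _)
  have htη : |t| < η := ht.trans_le (min_le_left _ _)
  let f : ℝ → F := fun s => H (s, z) - s • fderiv ℝ H (0, z) (1, 0)
  have hd : ∀ s, HasDerivAt f (fderiv ℝ H (s, z) (1, 0) - (1 : ℝ) • fderiv ℝ H (0, z) (1, 0)) s := by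
    intro s
    have h1 : HasDerivAt (fun s : ℝ => (s, z)) ((1 : ℝ), (0 : ℂ)) s :=
      (hasDerivAt_id s).prodMk (hasDerivAt_const s z)
    exact ((hH.differentiable one_ne_zero (s, z)).hasFDerivAt.comp_hasDerivAt s h1).sub
      ((hasDerivAt_id s).smul_const _)
  have hmv := (convex_uIcc (0 : ℝ) t).norm_image_sub_le_of_norm_hasDerivWithin_le (f := f)
    (C := δ) (fun s _ => (hd s).hasDerivWithinAt) (fun s hs => by
      have hs' : |s| ≤ |t| := by
        have := Set.abs_sub_left_of_mem_uIcc hs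
        simpa using this
      rw [one_smul, ← dist_eq_norm]
      refine (hu (s, z) ⟨?_, hz⟩ (0, z) ⟨by norm_num, hz⟩ ?_).le
      · rw [Set.mem_Icc, ← abs_le]; linarith
      · rw [Prod.dist_eq]; simp; linarith) Set.left_mem_uIcc Set.right_mem_uIcc
  have ht0' : t ≠ 0 := ht0
  have e : quotientRemainder H t z = t⁻¹ • (f t - f 0) := by
    simp only [quotientRemainder, f]
    rw [zero_smul, sub_zero, sub_right_comm, smul_sub t⁻¹ (H (t, z) - H (0, z)), smul_smul,
      inv_mul_cancel₀ ht0', one_smul]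
  rw [e, norm_smul, norm_inv, Real.norm_eq_abs]
  rw [sub_zero, Real.norm_eq_abs] at hmv
  have : 0 < |t| := abs_pos.2 ht0'
  rw [inv_mul_le_iff₀ this]
  linarith

/-- By symmetry of second derivatives, the derivative of the remainder is the remainder of the
derivative. The `C^0` estimate therefore propagates to all orders. -/
lemma fderiv_quotientRemainder {F : Type*} [NormedAddCommGroup F] [NormedSpace ℝ F]
    {H : ℝ × ℂ → F} (hH : ContDiff ℝ 2 H) (t : ℝ) (z : ℂ) :
    fderiv ℝ (quotientRemainder H t) z =
      quotientRemainder (fun p => (fderiv ℝ H p).comp (ContinuousLinearMap.inr ℝ ℝ ℂ)) t z := by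
  have h1 : ∀ s, HasFDerivAt (fun z => H (s, z))
      ((fderiv ℝ H (s, z)).comp (ContinuousLinearMap.inr ℝ ℝ ℂ)) z := fun s =>
    (hH.differentiable (by simp) (s, z)).hasFDerivAt.comp z (hasFDerivAt_prodMk_right s z)
  have hfd : ContDiff ℝ 1 (fderiv ℝ H) := hH.fderiv_right (by norm_num)
  have h2 : ∀ p, HasFDerivAt (fderiv ℝ H) (fderiv ℝ (fderiv ℝ H) p) p := fun p =>
    (hfd.differentiable one_ne_zero p).hasFDerivAt
  have h3 : HasFDerivAt (fun z => fderiv ℝ H (0, z) (1, 0))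
      ((ContinuousLinearMap.apply ℝ F ((1 : ℝ), (0 : ℂ))).comp
        ((fderiv ℝ (fderiv ℝ H) (0, z)).comp (ContinuousLinearMap.inr ℝ ℝ ℂ))) z :=
    (ContinuousLinearMap.apply ℝ F ((1 : ℝ), (0 : ℂ))).hasFDerivAt.comp z
      ((h2 (0, z)).comp z (hasFDerivAt_prodMk_right 0 z))
  have h4 : HasFDerivAt (quotientRemainder H t) _ z :=
    (((h1 t).sub (h1 0)).const_smul t⁻¹).sub h3
  rw [h4.fderiv, quotientRemainder]
  have h5 : HasFDerivAt (fun p => (fderiv ℝ H p).comp (ContinuousLinearMap.inr ℝ ℝ ℂ))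
      (((ContinuousLinearMap.compL ℝ ℂ (ℝ × ℂ) F).flip (ContinuousLinearMap.inr ℝ ℝ ℂ)).comp
        (fderiv ℝ (fderiv ℝ H) (0, z))) (0, z) :=
    (((ContinuousLinearMap.compL ℝ ℂ (ℝ × ℂ) F).flip
      (ContinuousLinearMap.inr ℝ ℝ ℂ)).hasFDerivAt).comp (0, z) (h2 (0, z))
  rw [h5.fderiv]
  congr 1
  ext w
  have hsymm : IsSymmSndFDerivAt ℝ H (0, z) :=
    hH.contDiffAt.isSymmSndFDerivAt (by simp)
  simpa using hsymm.eq (0, w) (1, 0)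

lemma iteratedFDeriv_quotientRemainder_small (j : ℕ) : ∀ {F : Type} [NormedAddCommGroup F]
    [NormedSpace ℝ F] {H : ℝ × ℂ → F}, ContDiff ℝ (j + 1) H → ∀ {δ : ℝ}, 0 < δ →
    ∀ᶠ t : ℝ in 𝓝[≠] 0, ∀ z ∈ Metric.closedBall (0 : ℂ) 1,
      ‖iteratedFDeriv ℝ j (quotientRemainder H t) z‖ ≤ δ := by
  induction j with
  | zero =>
    intro F _ _ H hH δ hδ
    simpa only [norm_iteratedFDeriv_zero] using quotientRemainder_small (by simpa using hH) hδ
  | succ j ih =>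
    intro F _ _ H hH δ hδ
    have hH' : ContDiff ℝ (j + 1) fun p => (fderiv ℝ H p).comp (ContinuousLinearMap.inr ℝ ℝ ℂ) :=
      (hH.fderiv_right (by norm_cast)).clm_comp contDiff_const
    filter_upwards [ih hH' hδ] with t ht z hz
    have e : fderiv ℝ (quotientRemainder H t) = quotientRemainder
        (fun p => (fderiv ℝ H p).comp (ContinuousLinearMap.inr ℝ ℝ ℂ)) t :=
      funext fun z => fderiv_quotientRemainder
        (hH.of_le (by norm_cast; omega)) t z
    rw [← norm_iteratedFDeriv_fderiv, e]
    exact ht z hz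

lemma contDiff_quotientRemainder {n : ℕ} {H : ℝ × ℂ → ℝ} (hH : ContDiff ℝ (n + 1) H) (t : ℝ) :
    ContDiff ℝ n (quotientRemainder H t) := by
  have h0 : ContDiff ℝ n H := hH.of_le (by norm_cast; omega)
  have h1 : ∀ s : ℝ, ContDiff ℝ n fun z : ℂ => ((s, z) : ℝ × ℂ) := fun s =>
    contDiff_const.prodMk contDiff_id
  exact (((h0.comp (h1 t)).sub (h0.comp (h1 0))).const_smul _).sub
    (((hH.fderiv_right (by norm_cast)).comp (h1 0)).clm_apply contDiff_const)

/-- The difference quotients of a function which is differentiable to sufficiently high order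
converge in the norm of the class `X`. -/
theorem SmoothnessClass.normLE_quotientRemainder (X : SmoothnessClass) {H : ℝ × ℂ → ℝ}
    (hH : ContDiff ℝ (X.order + 1) H) {ε : ℝ} (hε : 0 < ε) :
    ∀ᶠ t : ℝ in 𝓝[≠] 0, X.NormLE (fun ζ => quotientRemainder H t ζ) ε := by
  obtain ⟨K, hK, hX⟩ := X.exists_normLE_of_bound
  have hδ : 0 < ε / (K + 1) := by positivity
  have h : ∀ᶠ t : ℝ in 𝓝[≠] 0, ∀ j ∈ Finset.range (X.order + 1),
      ∀ z ∈ Metric.closedBall (0 : ℂ) 1, ‖iteratedFDeriv ℝ j (quotientRemainder H t) z‖ ≤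
        ε / (K + 1) := by
    rw [Filter.eventually_all_finset]
    intro j hj
    rw [Finset.mem_range] at hj
    exact iteratedFDeriv_quotientRemainder_small j (hH.of_le (by norm_cast)) hδ
  filter_upwards [h] with t ht
  refine SmoothnessClass.NormLE.mono ?_ (hX _ _ (contDiff_quotientRemainder hH t) hδ.le fun j hj z hz =>
    ht j (Finset.mem_range.2 (by omega)) z ?_)
  · rw [mul_div_assoc', div_le_iff₀ (by positivity)]; nlinarith
  · simpa using (mem_disc.1 hz).le

/-- A sufficiently differentiable function on the plane is of class `X` on the disc. -/
theorem SmoothnessClass.exists_normLE (X : SmoothnessClass) {G : ℂ → ℝ}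
    (hG : ContDiff ℝ X.order G) : ∃ C, X.NormLE (fun ζ => G ζ) C := by
  obtain ⟨K, -, hX⟩ := X.exists_normLE_of_bound
  have h : ∀ j ∈ Finset.range (X.order + 1), ∃ C, ∀ z ∈ Metric.closedBall (0 : ℂ) 1,
      ‖iteratedFDeriv ℝ j G z‖ ≤ C := fun j hj =>
    (isCompact_closedBall _ _).exists_bound_of_continuousOn
      (hG.continuous_iteratedFDeriv (by
        have := Finset.mem_range.1 hj; norm_cast; omega)).continuousOn
  choose! C hC using h
  refine ⟨_, hX G (∑ j ∈ Finset.range (X.order + 1), |C j|) hG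
    (Finset.sum_nonneg fun _ _ => abs_nonneg _) fun j hj z hz => ?_⟩
  have hj' : j ∈ Finset.range (X.order + 1) := Finset.mem_range.2 (by omega)
  refine (hC j hj' z (by simpa using (mem_disc.1 hz).le)).trans ((le_abs_self _).trans ?_)
  exact Finset.single_le_sum (f := fun j => |C j|) (fun _ _ => abs_nonneg _) hj'

end

section

open MeasureTheory

/-! ### The class `X` and the Sobolev space `W^{1,2}` -/

lemma exists_lpNormLE_two {p : ℝ} (hp : 2 < p) : ∃ K : ℝ, 0 ≤ K ∧ ∀ (g : ℂ → ℝ) (C : ℝ),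
    LpNormLE p g C → LpNormLE 2 g (K * C) := by
  have hpq : ENNReal.ofReal 2 ≤ ENNReal.ofReal p := ENNReal.ofReal_le_ofReal hp.le
  refine ⟨((volume.restrict (disc : Set ℂ)) Set.univ
    ^ (1 / (ENNReal.ofReal 2).toReal - 1 / (ENNReal.ofReal p).toReal)).toReal,
    ENNReal.toReal_nonneg, fun g C h => ⟨h.1.mono_exponent hpq, ?_⟩⟩
  refine (eLpNorm_le_eLpNorm_mul_rpow_measure_univ hpq h.1.1).trans ?_
  rw [ENNReal.ofReal_mul ENNReal.toReal_nonneg, ENNReal.ofReal_toReal, mul_comm]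
  · gcongr; exact h.2
  · refine ENNReal.rpow_ne_top_of_nonneg ?_ (measure_ne_top _ _)
    rw [ENNReal.toReal_ofReal (by norm_num), ENNReal.toReal_ofReal (by linarith), sub_nonneg]
    exact one_div_le_one_div_of_le (by norm_num) hp.le

lemma SobolevNormLE.lpNormLE {p : ℝ} {k : ℕ} {g : ℂ → ℝ} {C : ℝ} (h : SobolevNormLE p k g C) :
    LpNormLE p g C := by
  cases k with
  | zero => exact h
  | succ k => exact h.1

/-- The disc has finite measure, `k ≥ 1` and `p > 2`, so `W^{1,2}` contains every class. The
linearised equation is derived using this common weaker norm, which treats the Hölder and Sobolev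
cases at once. -/
lemma SmoothnessClass.exists_sobolevNormLE_two (X : SmoothnessClass) : ∃ K : ℝ, 0 ≤ K ∧
    ∀ (g : disc → ℝ) (C : ℝ), X.NormLE g C → SobolevNormLE 2 1 (extendByZero g) (K * C) := by
  cases X with
  | holder k α hk hα₀ hα₁ =>
    refine ⟨lpConst 2, ENNReal.toReal_nonneg, fun g C h => ?_⟩
    have hd : ContDiffOn ℝ 1 (extendByZero g) disc := h.1.of_le (by norm_cast)
    have hd' : ContinuousOn (fderiv ℝ (extendByZero g)) disc :=
      hd.continuousOn_fderiv_of_isOpen isOpen_disc (by simp)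
    have hb : ∀ v : ℂ, ‖v‖ = 1 →
        LpNormLE 2 (fun z => fderiv ℝ (extendByZero g) z v) (lpConst 2 * C) := fun v hv =>
      lpNormLE_of_bound 2 (hd'.clm_apply continuousOn_const) fun z hz => by
        refine ((fderiv ℝ (extendByZero g) z).le_opNorm v).trans ?_
        rw [hv, mul_one, ← norm_iteratedFDeriv_one]
        exact (h.2 1 hk).1 z hz
    refine ⟨lpNormLE_of_bound 2 hd.continuousOn fun z hz => ?_, _, _,
      isWeakPartial_of_contDiffOn hd 1, isWeakPartial_of_contDiffOn hd Complex.I,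
      hb 1 (by simp), hb Complex.I (by simp)⟩
    rw [← norm_iteratedFDeriv_zero (𝕜 := ℝ) (f := extendByZero g)]
    exact (h.2 0 (Nat.zero_le _)).1 z hz
  | sobolev k p hk hp =>
    obtain ⟨K, hK, hp⟩ := exists_lpNormLE_two hp
    refine ⟨K, hK, fun g C h => ?_⟩
    obtain ⟨k, rfl⟩ := Nat.exists_eq_add_of_le' hk
    obtain ⟨h0, g₁, g₂, w₁, w₂, h₁, h₂⟩ := h
    exact ⟨hp _ _ h0, g₁, g₂, w₁, w₂, hp _ _ h₁.lpNormLE, hp _ _ h₂.lpNormLE⟩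

lemma LpNormLE.memLp_two {g : ℂ → ℝ} {C : ℝ} (h : LpNormLE 2 g C) :
    MemLp g 2 (volume.restrict (disc : Set ℂ)) := by
  simpa using h.1

lemma lpNormLE_two_of_memLp {g : ℂ → ℝ} (h : MemLp g 2 (volume.restrict (disc : Set ℂ))) :
    ∃ C, 0 ≤ C ∧ LpNormLE 2 g C :=
  ⟨(eLpNorm g 2 (volume.restrict (disc : Set ℂ))).toReal, ENNReal.toReal_nonneg,
    by simpa using h, by simp [ENNReal.ofReal_toReal h.2.ne]⟩

lemma LpNormLE.add {g g' : ℂ → ℝ} {C C' : ℝ} (hC : 0 ≤ C) (hC' : 0 ≤ C') (h : LpNormLE 2 g C)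
    (h' : LpNormLE 2 g' C') : LpNormLE 2 (fun z => g z + g' z) (C + C') := by
  refine ⟨h.1.add h'.1, (eLpNorm_add_le h.1.1 h'.1.1 (by simp)).trans ?_⟩
  rw [ENNReal.ofReal_add hC hC']
  exact add_le_add h.2 h'.2

lemma LpNormLE.sub {g g' : ℂ → ℝ} {C C' : ℝ} (hC : 0 ≤ C) (hC' : 0 ≤ C') (h : LpNormLE 2 g C)
    (h' : LpNormLE 2 g' C') : LpNormLE 2 (fun z => g z - g' z) (C + C') := by
  refine ⟨h.1.sub h'.1, (eLpNorm_sub_le h.1.1 h'.1.1 (by simp)).trans ?_⟩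
  rw [ENNReal.ofReal_add hC hC']
  exact add_le_add h.2 h'.2

lemma LpNormLE.const_mul {g : ℂ → ℝ} {C : ℝ} (c : ℝ) (h : LpNormLE 2 g C) :
    LpNormLE 2 (fun z => c * g z) (|c| * C) := by
  refine ⟨h.1.const_mul c, ?_⟩
  have := eLpNorm_const_smul c g (ENNReal.ofReal 2) (volume.restrict (disc : Set ℂ))
  rw [show (fun z => c * g z) = c • g from rfl, this, ENNReal.ofReal_mul (abs_nonneg c)]
  gcongr
  · rw [← Real.norm_eq_abs, ofReal_norm]
  · exact h.2

lemma LpNormLE.bdd_mul {g ψ : ℂ → ℝ} {C S : ℝ} (hS : 0 ≤ S) (h : LpNormLE 2 g C)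
    (hψ : Continuous ψ) (hb : ∀ z, |ψ z| ≤ S) : LpNormLE 2 (fun z => ψ z * g z) (S * C) := by
  have hm : AEStronglyMeasurable (fun z => ψ z * g z) (volume.restrict (disc : Set ℂ)) :=
    hψ.aestronglyMeasurable.mul h.1.1
  have hle : ∀ᵐ z ∂(volume.restrict (disc : Set ℂ)), ‖ψ z * g z‖ ≤ ‖S * g z‖ :=
    Filter.Eventually.of_forall fun z => by
      rw [norm_mul, norm_mul, Real.norm_of_nonneg hS]
      gcongr; exact hb z
  have h' := h.const_mul S
  refine ⟨h'.1.of_le hm hle, (eLpNorm_mono_ae hle).trans ?_⟩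
  simpa [abs_of_nonneg hS] using h'.2

lemma LpNormLE.integrable_mul {f g : ℂ → ℝ} {A B : ℝ} (hf : LpNormLE 2 f A)
    (hg : LpNormLE 2 g B) :
    Integrable (fun z => f z * g z) (volume.restrict (disc : Set ℂ)) :=
  hf.memLp_two.integrable_mul hg.memLp_two

/-- The Cauchy–Schwarz inequality on the disc. -/
lemma LpNormLE.abs_integral_mul_le {f g : ℂ → ℝ} {A B : ℝ} (hA : 0 ≤ A) (hB : 0 ≤ B)
    (hf : LpNormLE 2 f A) (hg : LpNormLE 2 g B) :
    |∫ z in (disc : Set ℂ), f z * g z| ≤ A * B := by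
  have h2 : ENNReal.ofReal 2 = 2 := by simp
  have h1 := eLpNorm_le_eLpNorm_mul_eLpNorm_of_nnnorm (p := 2) (q := 2) (r := 1)
    hf.1.1 hg.1.1 (fun a b : ℝ => a * b) 1 (Filter.Eventually.of_forall fun z => by simp)
  have h3 : eLpNorm (fun z => f z * g z) 1 (volume.restrict (disc : Set ℂ))
      ≤ ENNReal.ofReal (A * B) := by
    refine h1.trans ?_
    rw [ENNReal.ofReal_mul hA, ← h2]
    simp only [ENNReal.coe_one, one_mul]
    exact mul_le_mul' hf.2 hg.2
  rw [← Real.norm_eq_abs]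
  refine (norm_integral_le_integral_norm _).trans ?_
  rw [integral_norm_eq_lintegral_enorm (hf.integrable_mul hg).1, ← eLpNorm_one_eq_lintegral_enorm]
  exact ENNReal.toReal_le_of_le_ofReal (mul_nonneg hA hB) h3

lemma lpNormLE_of_continuous {ψ : ℂ → ℝ} (hψ : Continuous ψ) (hc : HasCompactSupport ψ) :
    ∃ C, 0 ≤ C ∧ LpNormLE 2 ψ C :=
  lpNormLE_two_of_memLp ((hψ.memLp_of_hasCompactSupport hc).restrict _)

lemma IsWeakPartial.sub {v : ℂ} {g g' d d' : ℂ → ℝ} {A A' B B' : ℝ} (h : IsWeakPartial v g d)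
    (h' : IsWeakPartial v g' d') (hg : LpNormLE 2 g A) (hg' : LpNormLE 2 g' A')
    (hd : LpNormLE 2 d B) (hd' : LpNormLE 2 d' B') :
    IsWeakPartial v (fun z => g z - g' z) fun z => d z - d' z := by
  intro φ hφ hc hs
  obtain ⟨S, -, hS⟩ := lpNormLE_of_continuous hφ.continuous hc
  have hφ' : Continuous fun z => fderiv ℝ φ z v :=
    (hφ.continuous_fderiv (by simp)).clm_apply continuous_const
  obtain ⟨S', -, hS'⟩ := lpNormLE_of_continuous hφ'
    (hc.of_isClosed_subset (isClosed_tsupport _) (tsupport_fderiv_apply_subset φ v))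
  simp only [sub_mul]
  rw [integral_sub (hg.integrable_mul hS') (hg'.integrable_mul hS'),
    integral_sub (hd.integrable_mul hS) (hd'.integrable_mul hS), h φ hφ hc hs, h' φ hφ hc hs]
  ring

lemma SobolevNormLE.sub {g g' : ℂ → ℝ} {C C' : ℝ} (hC : 0 ≤ C) (hC' : 0 ≤ C')
    (h : SobolevNormLE 2 1 g C) (h' : SobolevNormLE 2 1 g' C') :
    SobolevNormLE 2 1 (fun z => g z - g' z) (C + C') := by
  obtain ⟨h0, g₁, g₂, w₁, w₂, h₁, h₂⟩ := h
  obtain ⟨h0', g₁', g₂', w₁', w₂', h₁', h₂'⟩ := h'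
  exact ⟨h0.sub hC hC' h0', _, _, w₁.sub w₁' h0 h0' h₁ h₁', w₂.sub w₂' h0 h0' h₂ h₂',
    LpNormLE.sub hC hC' h₁ h₁', LpNormLE.sub hC hC' h₂ h₂'⟩

/-- A function on the disc which is orthogonal to all test functions vanishes. -/
lemma ae_eq_zero_of_integral_mul_eq_zero {f : ℂ → ℝ} (hf : LocallyIntegrableOn f disc)
    (h : ∀ φ : ℂ → ℝ, ContDiff ℝ ∞ φ → HasCompactSupport φ → tsupport φ ⊆ disc →
      ∫ z in (disc : Set ℂ), f z * φ z = 0) :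
    ∀ᵐ z ∂(volume : Measure ℂ), z ∈ disc → f z = 0 :=
  isOpen_disc.ae_eq_zero_of_integral_contDiff_smul_eq_zero hf fun φ hφ hc hs => by
    rw [← h φ hφ hc hs, ← setIntegral_disc_eq_integral ((tsupport_smul_subset_left φ f).trans hs)]
    simp only [smul_eq_mul, mul_comm]

/-- Weak derivatives are unique almost everywhere, so for a `C^1` function the `L²` bound passes to
the classical derivative. -/
lemma IsWeakPartial.lpNormLE_fderiv {v : ℂ} {g d : ℂ → ℝ} {C : ℝ} (h : IsWeakPartial v g d)
    (hg : ContDiffOn ℝ 1 g disc) (hd : LpNormLE 2 d C) :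
    LpNormLE 2 (fun z => fderiv ℝ g z v) C := by
  have hg' : ContinuousOn (fun z => fderiv ℝ g z v) disc :=
    (hg.continuousOn_fderiv_of_isOpen isOpen_disc (by simp)).clm_apply continuousOn_const
  have hdi : IntegrableOn d disc := hd.memLp_two.integrable one_le_two
  have hl : LocallyIntegrableOn (fun z => fderiv ℝ g z v - d z) disc :=
    (hg'.locallyIntegrableOn isOpen_disc.measurableSet).sub hdi.locallyIntegrableOn
  have h0 := ae_eq_zero_of_integral_mul_eq_zero hl fun φ hφ hc hs => by
    have e1 := h φ hφ hc hs
    have e2 := isWeakPartial_of_contDiffOn hg v φ hφ hc hs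
    obtain ⟨S, -, hS⟩ := lpNormLE_of_continuous hφ.continuous hc
    have i1 : Integrable (fun z => fderiv ℝ g z v * φ z) :=
      (continuous_mul_of_tsupport_subset hg' hφ.continuous hs).integrable_of_hasCompactSupport
        hc.mul_left
    simp only [sub_mul]
    rw [integral_sub i1.restrict (hd.integrable_mul hS)]
    linarith
  have h1 : d =ᵐ[volume.restrict (disc : Set ℂ)] fun z => fderiv ℝ g z v := by
    rw [Filter.EventuallyEq, ae_restrict_iff' isOpen_disc.measurableSet]
    filter_upwards [h0] with z hz hzd
    linarith [hz hzd]
  exact ⟨(memLp_congr_ae h1).1 hd.1, by rw [← eLpNorm_congr_ae h1]; exact hd.2⟩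

lemma SobolevNormLE.lpNormLE_fderiv {g : ℂ → ℝ} {C : ℝ} (h : SobolevNormLE 2 1 g C)
    (hg : ContDiffOn ℝ 1 g disc) {v : ℂ} (hv : v = 1 ∨ v = Complex.I) :
    LpNormLE 2 (fun z => fderiv ℝ g z v) C := by
  obtain ⟨-, g₁, g₂, w₁, w₂, h₁, h₂⟩ := h
  rcases hv with rfl | rfl
  · exact w₁.lpNormLE_fderiv hg h₁
  · exact w₂.lpNormLE_fderiv hg h₂

end

section

open MeasureTheory

/-! ### Families of functions which are differentiable in `W^{1,2}` -/

/-- The difference quotient of the family `B` at the parameter `0`. -/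
def diffQuotient (B : ℝ → ℂ → ℝ) (t : ℝ) (z : ℂ) : ℝ := t⁻¹ * (B t z - B 0 z)

/-- The family `B` of `C^1` functions on the disc has derivative `b` in `W^{1,2}` at the
parameter `0`. -/
structure SobolevDifferentiable (B : ℝ → ℂ → ℝ) (b : ℂ → ℝ) : Prop where
  contDiffOn : ∀ t, ContDiffOn ℝ 1 (B t) disc
  exists_lpNormLE : ∀ t, ∃ C, 0 ≤ C ∧ LpNormLE 2 (B t) C
  sobolev : ∀ ε : ℝ, 0 < ε → ∀ᶠ t : ℝ in 𝓝[≠] 0,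
    SobolevNormLE 2 1 (fun z => diffQuotient B t z - b z) ε

namespace SobolevDifferentiable

variable {B H : ℝ → ℂ → ℝ} {b h : ℂ → ℝ}

lemma contDiffOn_diffQuotient (hB : SobolevDifferentiable B b) (t : ℝ) :
    ContDiffOn ℝ 1 (diffQuotient B t) disc :=
  contDiffOn_const.mul ((hB.contDiffOn t).sub (hB.contDiffOn 0))

lemma exists_lpNormLE_diffQuotient (hB : SobolevDifferentiable B b) (t : ℝ) :
    ∃ C, 0 ≤ C ∧ LpNormLE 2 (diffQuotient B t) C := by
  obtain ⟨C, hC, h⟩ := hB.exists_lpNormLE t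
  obtain ⟨C', hC', h'⟩ := hB.exists_lpNormLE 0
  exact ⟨_, by positivity, (h.sub hC hC' h').const_mul t⁻¹⟩

/-- The velocity is a difference quotient minus a remainder of finite norm; a single value of `t`
suffices. -/
lemma exists_lpNormLE_velocity (hB : SobolevDifferentiable B b) :
    ∃ C, 0 ≤ C ∧ LpNormLE 2 b C := by
  obtain ⟨t, ht⟩ := (hB.sobolev 1 one_pos).exists
  obtain ⟨C, hC, h⟩ := hB.exists_lpNormLE_diffQuotient t
  have h' := h.sub hC zero_le_one ht.lpNormLE
  simp only [sub_sub_cancel] at h'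
  exact ⟨_, by positivity, h'⟩

lemma tendsto_integral_mul (hB : SobolevDifferentiable B b) {ψ : ℂ → ℝ} (hψ : Continuous ψ)
    (hc : HasCompactSupport ψ) :
    Filter.Tendsto (fun t => ∫ z in (disc : Set ℂ), diffQuotient B t z * ψ z) (𝓝[≠] 0)
      (𝓝 (∫ z in (disc : Set ℂ), b z * ψ z)) := by
  obtain ⟨S, hS, hψS⟩ := lpNormLE_of_continuous hψ hc
  obtain ⟨N, hN, hb⟩ := hB.exists_lpNormLE_velocity
  rw [Metric.tendsto_nhds]
  intro ε hε
  filter_upwards [hB.sobolev (ε / (S + 1)) (by positivity)] with t ht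
  obtain ⟨C, hC, h⟩ := hB.exists_lpNormLE_diffQuotient t
  rw [Real.dist_eq, ← integral_sub (h.integrable_mul hψS) (hb.integrable_mul hψS)]
  simp only [← sub_mul]
  refine (ht.lpNormLE.abs_integral_mul_le (by positivity) hS hψS).trans_lt ?_
  rw [div_mul_eq_mul_div, div_lt_iff₀ (by positivity)]
  nlinarith

lemma fderiv_sub_apply (hB : SobolevDifferentiable B b) {t : ℝ} {z : ℂ} (hz : z ∈ disc) (v : ℂ) :
    fderiv ℝ (B t) z v - fderiv ℝ (B 0) z v = fderiv ℝ (fun z => B t z - B 0 z) z v := by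
  have hd : ∀ s, DifferentiableAt ℝ (B s) z := fun s =>
    ((hB.contDiffOn s).contDiffAt (isOpen_disc.mem_nhds hz)).differentiableAt (by simp)
  rw [fderiv_fun_sub (hd t) (hd 0)]
  rfl

lemma fderiv_diffQuotient (hB : SobolevDifferentiable B b) (t : ℝ) {z : ℂ} (hz : z ∈ disc) (v : ℂ) :
    fderiv ℝ (diffQuotient B t) z v = t⁻¹ * (fderiv ℝ (B t) z v - fderiv ℝ (B 0) z v) := by
  have hd : ∀ s, DifferentiableAt ℝ (B s) z := fun s =>
    ((hB.contDiffOn s).contDiffAt (isOpen_disc.mem_nhds hz)).differentiableAt (by simp)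
  rw [hB.fderiv_sub_apply hz, show diffQuotient B t = fun z => t⁻¹ * (B t z - B 0 z) from rfl,
    fderiv_const_mul (a := fun z => B t z - B 0 z) ((hd t).sub (hd 0))]
  rfl

/-- The derivatives of a `W^{1,2}` differentiable family converge in `L^2` away from the
boundary. -/
lemma exists_lpNormLE_mul_fderiv_sub (hB : SobolevDifferentiable B b) {φ : ℂ → ℝ}
    (hφ : Continuous φ) (hc : HasCompactSupport φ) (hs : tsupport φ ⊆ disc) {v : ℂ}
    (hv : v = 1 ∨ v = Complex.I) : ∃ N : ℝ, 0 ≤ N ∧ ∀ᶠ t : ℝ in 𝓝[≠] 0,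
      LpNormLE 2 (fun z => φ z * (fderiv ℝ (B t) z v - fderiv ℝ (B 0) z v)) (|t| * N) := by
  obtain ⟨S, hS⟩ := hφ.bounded_above_of_compact_support hc
  have hS0 : 0 ≤ S := (norm_nonneg _).trans (hS 0)
  -- The velocity `b` need not be differentiable classically, so quotients are compared with the
  -- `C^1` quotient at a fixed `t₀`. Both lie within `1` of `b`, hence within `2` of each other, in
  -- `W^{1,2}`.
  obtain ⟨t₀, ht₀⟩ := (hB.sobolev 1 one_pos).exists
  have hcont : ContinuousOn (fun z => fderiv ℝ (diffQuotient B t₀) z v) disc :=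
    ((hB.contDiffOn_diffQuotient t₀).continuousOn_fderiv_of_isOpen isOpen_disc
      (by simp)).clm_apply continuousOn_const
  obtain ⟨A, hA, h₀⟩ := lpNormLE_of_continuous (continuous_mul_of_tsupport_subset hcont hφ hs)
    hc.mul_left
  refine ⟨S * (1 + 1) + A, by positivity, ?_⟩
  filter_upwards [hB.sobolev 1 one_pos, self_mem_nhdsWithin] with t ht ht0
  have h1 : SobolevNormLE 2 1 (fun z => diffQuotient B t z - diffQuotient B t₀ z) (1 + 1) := by
    have := ht.sub zero_le_one zero_le_one ht₀
    simpa only [sub_sub_sub_cancel_right] using this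
  have h2 := h1.lpNormLE_fderiv ((hB.contDiffOn_diffQuotient t).sub
    (hB.contDiffOn_diffQuotient t₀)) hv
  have h3 := ((h2.bdd_mul hS0 hφ hS).add (by positivity) hA h₀).const_mul t
  have h4 : ∀ z, φ z * (fderiv ℝ (B t) z v - fderiv ℝ (B 0) z v) =
      t * (φ z * fderiv ℝ (fun z => diffQuotient B t z - diffQuotient B t₀ z) z v
        + fderiv ℝ (diffQuotient B t₀) z v * φ z) := by
    intro z
    by_cases hz : z ∈ tsupport φ
    · have hd : ∀ s, DifferentiableAt ℝ (diffQuotient B s) z := fun s =>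
        ((hB.contDiffOn_diffQuotient s).contDiffAt
          (isOpen_disc.mem_nhds (hs hz))).differentiableAt (by simp)
      rw [fderiv_fun_sub (hd t) (hd t₀), _root_.sub_apply, hB.fderiv_diffQuotient t (hs hz)]
      field_simp [show t ≠ 0 from ht0]
      ring
    · simp [image_eq_zero_of_notMem_tsupport hz]
  simp only [h4]
  exact h3

/-- The derivative at `0` of `∫ φ B_t ∂_v H_t`, where the derivative of `H` has been moved to the
other factors. -/
lemma tendsto_integral_mul_fderiv (hB : SobolevDifferentiable B b) (hH : SobolevDifferentiable H h)
    {φ : ℂ → ℝ} (hφ : ContDiff ℝ 1 φ) (hc : HasCompactSupport φ) (hs : tsupport φ ⊆ disc) {v : ℂ}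
    (hv : v = 1 ∨ v = Complex.I) :
    Filter.Tendsto (fun t => t⁻¹ * (∫ z in (disc : Set ℂ), B t z * fderiv ℝ (H t) z v * φ z)
        - t⁻¹ * ∫ z in (disc : Set ℂ), B 0 z * fderiv ℝ (H 0) z v * φ z) (𝓝[≠] 0)
      (𝓝 (-(∫ z in (disc : Set ℂ), h z * fderiv ℝ (fun z => B 0 z * φ z) z v)
        + ∫ z in (disc : Set ℂ), b z * (fderiv ℝ (H 0) z v * φ z))) := by
  have hBφ : ContDiff ℝ 1 fun z => B 0 z * φ z :=
    contDiff_mul_of_tsupport_subset (hB.contDiffOn 0) hφ hs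
  have hBφc : HasCompactSupport fun z => B 0 z * φ z := hc.mul_left
  have hBφs : tsupport (fun z => B 0 z * φ z) ⊆ disc := tsupport_mul_subset_right.trans hs
  have hH' : ∀ t, ContinuousOn (fun z => fderiv ℝ (H t) z v) disc := fun t =>
    ((hH.contDiffOn t).continuousOn_fderiv_of_isOpen isOpen_disc
      (by simp)).clm_apply continuousOn_const
  have hint : ∀ {f : ℂ → ℝ}, ContinuousOn f disc →
      Integrable (fun z => f z * φ z) (volume.restrict (disc : Set ℂ)) := fun hf =>
    ((continuous_mul_of_tsupport_subset hf hφ.continuous hs).integrable_of_hasCompactSupport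
      hc.mul_left).restrict
  have l1 := (hH.tendsto_integral_mul ((hBφ.continuous_fderiv one_ne_zero).clm_apply
    (continuous_const (y := v))) (hBφc.of_isClosed_subset (isClosed_tsupport _)
      (tsupport_fderiv_apply_subset _ v))).neg
  have l2 := hB.tendsto_integral_mul
    (continuous_mul_of_tsupport_subset (hH' 0) hφ.continuous hs) hc.mul_left
  -- The quadratic term of the product rule: the quotient of `B` stays bounded in `L²`, while the
  -- increment of the derivative of `H`, cut off by `φ`, is `O(|t|)` there.
  have l3 : Filter.Tendsto (fun t => ∫ z in (disc : Set ℂ), diffQuotient B t z *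
      (φ z * (fderiv ℝ (H t) z v - fderiv ℝ (H 0) z v))) (𝓝[≠] 0) (𝓝 0) := by
    obtain ⟨N, hN, hHN⟩ := hH.exists_lpNormLE_mul_fderiv_sub hφ.continuous hc hs hv
    obtain ⟨A, hA, hb⟩ := hB.exists_lpNormLE_velocity
    have hz : Filter.Tendsto (fun t : ℝ => (1 + A) * (|t| * N)) (𝓝[≠] 0) (𝓝 0) := by
      have : Continuous fun t : ℝ => (1 + A) * (|t| * N) := by fun_prop
      simpa using (this.tendsto 0).mono_left nhdsWithin_le_nhds
    refine squeeze_zero_norm' ?_ hz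
    filter_upwards [hHN, hB.sobolev 1 one_pos] with t ht htB
    have h1 := htB.lpNormLE.add zero_le_one hA hb
    simp only [sub_add_cancel] at h1
    exact h1.abs_integral_mul_le (by positivity) (by positivity) ht
  have l := (l1.add l2).add l3
  rw [add_zero] at l
  refine l.congr' ?_
  filter_upwards [self_mem_nhdsWithin] with t ht0
  have ht0' : t ≠ 0 := ht0
  rw [integral_mul_fderiv_of_contDiffOn (hH.contDiffOn_diffQuotient t) hBφ hBφc hBφs v, neg_neg,
    ← integral_const_mul, ← integral_const_mul]
  have i1 : ContinuousOn (fun z => fderiv ℝ (diffQuotient H t) z v * B 0 z) disc :=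
    (((hH.contDiffOn_diffQuotient t).continuousOn_fderiv_of_isOpen isOpen_disc
      (by simp)).clm_apply continuousOn_const).mul (hB.contDiffOn 0).continuousOn
  have hq := (hB.contDiffOn_diffQuotient t).continuousOn
  have i2 : ContinuousOn (fun z => diffQuotient B t z * fderiv ℝ (H 0) z v) disc := hq.mul (hH' 0)
  have i3 : ContinuousOn (fun z => diffQuotient B t z *
      (fderiv ℝ (H t) z v - fderiv ℝ (H 0) z v)) disc := hq.mul ((hH' t).sub (hH' 0))
  have i4 : ∀ s, ContinuousOn (fun z => t⁻¹ * (B s z * fderiv ℝ (H s) z v)) disc := fun s =>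
    continuousOn_const.mul ((hB.contDiffOn s).continuousOn.mul (hH' s))
  have j1 := hint i1
  have j2 := hint i2
  have j3 := hint i3
  have j4 := hint (i4 t)
  have j5 := hint (i4 0)
  simp only [mul_assoc] at j1 j2 j3 j4 j5
  simp only [mul_assoc]
  have j12 : Integrable (fun z => fderiv ℝ (diffQuotient H t) z v * (B 0 z * φ z) +
      diffQuotient B t z * (fderiv ℝ (H 0) z v * φ z)) (volume.restrict (disc : Set ℂ)) := j1.add j2
  have j3' : Integrable (fun z => diffQuotient B t z *
      (φ z * (fderiv ℝ (H t) z v - fderiv ℝ (H 0) z v))) (volume.restrict (disc : Set ℂ)) := by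
    simpa only [mul_comm (φ _)] using j3
  rw [← integral_sub j4 j5, ← integral_add j1 j2, ← integral_add j12 j3']
  refine setIntegral_congr_fun isOpen_disc.measurableSet fun z hz => ?_
  rw [hH.fderiv_diffQuotient t hz, diffQuotient]
  field_simp
  ring

end SobolevDifferentiable

end

section

open MeasureTheory

/-! ### The linearised equations satisfied by the tangent vectors of the space of discs -/

lemma extendByZero_add (g g' : disc → ℝ) :
    extendByZero (fun ζ => g ζ + g' ζ) = fun z => extendByZero g z + extendByZero g' z := by
  funext z
  by_cases hz : z ∈ disc
  · have h : ∀ g : disc → ℝ, extendByZero g z = g ⟨z, hz⟩ := fun g =>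
      extendByZero_apply g ⟨z, hz⟩
    simp only [h]
  · have h : ∀ g : disc → ℝ, extendByZero g z = 0 := fun g =>
      Function.extend_apply' _ _ _ fun ⟨a, ha⟩ => hz (ha ▸ a.2)
    simp only [h, add_zero]

lemma extendByZero_const_mul (c : ℝ) (g : disc → ℝ) :
    extendByZero (fun ζ => c * g ζ) = fun z => c * extendByZero g z := by
  funext z
  by_cases hz : z ∈ disc
  · have h : ∀ g : disc → ℝ, extendByZero g z = g ⟨z, hz⟩ := fun g =>
      extendByZero_apply g ⟨z, hz⟩
    simp only [h]
  · have h : ∀ g : disc → ℝ, extendByZero g z = 0 := fun g =>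
      Function.extend_apply' _ _ _ fun ⟨a, ha⟩ => hz (ha ▸ a.2)
    simp only [h, mul_zero]

lemma contDiffOn_extendByZero_of_contMDiff {n : WithTop ℕ∞} {g : disc → ℝ}
    (hg : ContMDiff 𝓘(ℝ, ℂ) 𝓘(ℝ, ℝ) n g) : ContDiffOn ℝ n (extendByZero g) disc := by
  intro z hz
  refine ContDiffAt.contDiffWithinAt (contMDiffAt_iff_contDiffAt.1 ?_)
  refine (contMDiffAt_subtype_iff (x := (⟨z, hz⟩ : disc))).1 ?_
  simp only [extendByZero_apply]
  exact hg _

variable {E : Type*} [NormedAddCommGroup E] [NormedSpace ℝ E]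
  {M : Type*} [TopologicalSpace M] [ChartedSpace E M] [IsManifold 𝓘(ℝ, E) ∞ M]
  {X : SmoothnessClass} {J : AlmostComplexStructure E M}

namespace JDisc

/-- The function `h` along the disc `c`, extended by zero. -/
def pull (c : JDisc X J) (h : M → ℝ) : ℂ → ℝ := extendByZero fun ζ => h (eval ζ c)

/-- The derivative of the function `h` in the direction of the field `u` along the disc `f`,
extended by zero. -/
def pullDifferential (f : JDisc X J) (h : M → ℝ) (u : FieldAlong f) : ℂ → ℝ :=
  extendByZero fun ζ => differential h (eval ζ f) (u ζ)

lemma contDiffOn_pull (c : JDisc X J) {h : M → ℝ} (hh : ContMDiff 𝓘(ℝ, E) 𝓘(ℝ, ℝ) ∞ h) :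
    ContDiffOn ℝ 1 (c.pull h) disc :=
  contDiffOn_extendByZero_of_contMDiff ((hh.of_le (by norm_cast)).comp c.contMDiff)

lemma pullDifferential_add (f : JDisc X J) (h : M → ℝ) (u w : FieldAlong f) :
    f.pullDifferential h (u + w) = fun z => f.pullDifferential h u z + f.pullDifferential h w z := by
  rw [pullDifferential, pullDifferential, pullDifferential, ← extendByZero_add]
  congr 1
  funext ζ
  exact map_add _ _ _

lemma pullDifferential_smul (f : JDisc X J) (h : M → ℝ) (a : ℝ) (u : FieldAlong f) :
    f.pullDifferential h (a • u) = fun z => a * f.pullDifferential h u z := by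
  rw [pullDifferential, pullDifferential, ← extendByZero_const_mul]
  congr 1
  funext ζ
  exact map_smul _ _ _

lemma pullDifferential_zero (f : JDisc X J) (h : M → ℝ) :
    f.pullDifferential h 0 = fun _ => 0 := by
  rw [← zero_smul ℝ (0 : FieldAlong f), pullDifferential_smul]
  simp

lemma HasVelocity.sobolevDifferentiable {c : ℝ → JDisc X J} {f : JDisc X J} {u : FieldAlong f}
    (hc : HasVelocity c f u) {h : M → ℝ} (hh : ContMDiff 𝓘(ℝ, E) 𝓘(ℝ, ℝ) ∞ h) :
    SobolevDifferentiable (fun t => (c t).pull h) (f.pullDifferential h u) := by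
  obtain ⟨K, hK, hX⟩ := X.exists_sobolevNormLE_two
  refine ⟨fun t => (c t).contDiffOn_pull hh, fun t => ?_, fun ε hε => ?_⟩
  · obtain ⟨C, hC⟩ := (c t).memClass h hh
    exact ⟨K * |C|, by positivity, (hX _ _ (hC.mono (le_abs_self C))).lpNormLE⟩
  · filter_upwards [(hc.2 h hh).2 (ε / (K + 1)) (by positivity)] with t ht
    have h1 := SobolevNormLE.mono (C' := ε) (by
      rw [mul_div_assoc', div_le_iff₀ (by positivity)]; nlinarith) (hX _ _ ht)
    convert h1 using 1
    simp only [diffQuotient, pull, pullDifferential, hc.1]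
    have e : ∀ ζ : disc, t⁻¹ * (h (eval ζ (c t)) - h (eval ζ f))
        - differential h (eval ζ f) (u ζ) = t⁻¹ * (h (eval ζ (c t)) + (-1) * h (eval ζ f))
        + (-1) * differential h (eval ζ f) (u ζ) := fun ζ => by ring
    simp only [e, extendByZero_add, extendByZero_const_mul]
    funext z
    ring

section Linearisation

variable {κ : Type*} [Fintype κ] {a g : κ → M → ℝ} {v : κ → ℂ}

/-- The left hand side of the linearisation of the equations `∑ a_k ∂_{v_k} g_k = 0` at `f`,
tested against `φ`. -/
def weakLinearisation (f : JDisc X J) (a g : κ → M → ℝ) (v : κ → ℂ) (φ : ℂ → ℝ)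
    (u : FieldAlong f) : ℝ :=
  ∑ k, (-(∫ z in (disc : Set ℂ), f.pullDifferential (g k) u z *
      fderiv ℝ (fun z => f.pull (a k) z * φ z) z (v k))
    + ∫ z in (disc : Set ℂ), f.pullDifferential (a k) u z *
      (fderiv ℝ (f.pull (g k)) z (v k) * φ z))

/-- Every disc of the curve satisfies the equations, so the tested equations have vanishing
difference quotients, while these converge to `weakLinearisation` by `tendsto_integral_mul_fderiv`.
-/
lemma HasVelocity.weakLinearisation_eq_zero (ha : ∀ k, ContMDiff 𝓘(ℝ, E) 𝓘(ℝ, ℝ) ∞ (a k))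
    (hg : ∀ k, ContMDiff 𝓘(ℝ, E) 𝓘(ℝ, ℝ) ∞ (g k)) (hv : ∀ k, v k = 1 ∨ v k = Complex.I)
    (heq : ∀ c : JDisc X J, ∀ z ∈ disc,
      ∑ k, c.pull (a k) z * fderiv ℝ (c.pull (g k)) z (v k) = 0)
    {c : ℝ → JDisc X J} {f : JDisc X J} {u : FieldAlong f} (hc : HasVelocity c f u)
    {φ : ℂ → ℝ} (hφ : ContDiff ℝ 1 φ) (hcs : HasCompactSupport φ) (hs : tsupport φ ⊆ disc) :
    f.weakLinearisation a g v φ u = 0 := by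
  have hl := tendsto_finsetSum Finset.univ fun k _ =>
    (hc.sobolevDifferentiable (ha k)).tendsto_integral_mul_fderiv
      (hc.sobolevDifferentiable (hg k)) hφ hcs hs (hv k)
  simp only [hc.1] at hl
  refine tendsto_nhds_unique hl (tendsto_const_nhds.congr fun t => ?_)
  have h0 : ∀ c : JDisc X J, ∑ k, ∫ z in (disc : Set ℂ),
      c.pull (a k) z * fderiv ℝ (c.pull (g k)) z (v k) * φ z = 0 := fun c => by
    rw [← integral_finsetSum]
    · rw [← integral_zero ℂ ℝ (μ := volume.restrict (disc : Set ℂ))]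
      refine setIntegral_congr_fun isOpen_disc.measurableSet fun z hz => ?_
      rw [← Finset.sum_mul, heq c z hz, zero_mul]
    · intro k _
      exact ((continuous_mul_of_tsupport_subset ((c.contDiffOn_pull (ha k)).continuousOn.mul
        (((c.contDiffOn_pull (hg k)).continuousOn_fderiv_of_isOpen isOpen_disc
          (by simp)).clm_apply continuousOn_const)) hφ.continuous hs).integrable_of_hasCompactSupport
            hcs.mul_left).restrict
  rw [Finset.sum_sub_distrib, ← Finset.mul_sum, ← Finset.mul_sum, h0, h0, mul_zero, sub_zero]

/-- The tangent vectors of the space of discs satisfy the linearised equations weakly. -/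
lemma weakLinearisation_eq_zero_of_mem_tangent (ha : ∀ k, ContMDiff 𝓘(ℝ, E) 𝓘(ℝ, ℝ) ∞ (a k))
    (hg : ∀ k, ContMDiff 𝓘(ℝ, E) 𝓘(ℝ, ℝ) ∞ (g k)) (hv : ∀ k, v k = 1 ∨ v k = Complex.I)
    (heq : ∀ c : JDisc X J, ∀ z ∈ disc,
      ∑ k, c.pull (a k) z * fderiv ℝ (c.pull (g k)) z (v k) = 0)
    {f : JDisc X J} {u : FieldAlong f} (hu : u ∈ tangent f)
    {φ : ℂ → ℝ} (hφ : ContDiff ℝ 1 φ) (hcs : HasCompactSupport φ) (hs : tsupport φ ⊆ disc) :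
    f.weakLinearisation a g v φ u = 0 := by
  have hψ : ∀ k, ∃ C, 0 ≤ C ∧
      LpNormLE 2 (fun z => fderiv ℝ (fun z => f.pull (a k) z * φ z) z (v k)) C := fun k =>
    lpNormLE_of_continuous (((contDiff_mul_of_tsupport_subset (f.contDiffOn_pull (ha k)) hφ
      hs).continuous_fderiv one_ne_zero).clm_apply continuous_const)
      (hcs.mul_left.of_isClosed_subset (isClosed_tsupport _) (tsupport_fderiv_apply_subset _ _))
  have hχ : ∀ k, ∃ C, 0 ≤ C ∧
      LpNormLE 2 (fun z => fderiv ℝ (f.pull (g k)) z (v k) * φ z) C := fun k =>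
    lpNormLE_of_continuous (continuous_mul_of_tsupport_subset
      (((f.contDiffOn_pull (hg k)).continuousOn_fderiv_of_isOpen isOpen_disc
          (by simp)).clm_apply continuousOn_const) hφ.continuous hs) hcs.mul_left
  -- Additivity of the integrals in `u` needs integrability, so the `L²` bounds are carried through
  -- the induction over the span.
  suffices H : (∀ h : M → ℝ, ContMDiff 𝓘(ℝ, E) 𝓘(ℝ, ℝ) ∞ h →
      ∃ C, 0 ≤ C ∧ LpNormLE 2 (f.pullDifferential h u) C) ∧
      f.weakLinearisation a g v φ u = 0 from H.2
  induction hu using Submodule.span_induction with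
  | mem u hu =>
    obtain ⟨c, hc⟩ := hu
    exact ⟨fun h hh => (hc.sobolevDifferentiable hh).exists_lpNormLE_velocity,
      hc.weakLinearisation_eq_zero ha hg hv heq hφ hcs hs⟩
  | zero =>
    refine ⟨fun h hh => ⟨0, le_rfl, ?_⟩, by simp [weakLinearisation, pullDifferential_zero]⟩
    rw [pullDifferential_zero]
    exact ⟨MemLp.zero', by simp⟩
  | add u w _ _ hu hw =>
    refine ⟨fun h hh => ?_, ?_⟩
    · obtain ⟨C, hC, h1⟩ := hu.1 h hh
      obtain ⟨C', hC', h2⟩ := hw.1 h hh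
      exact ⟨_, add_nonneg hC hC', by rw [pullDifferential_add]; exact h1.add hC hC' h2⟩
    · have e : f.weakLinearisation a g v φ (u + w)
          = f.weakLinearisation a g v φ u + f.weakLinearisation a g v φ w := by
        simp only [weakLinearisation]
        rw [← Finset.sum_add_distrib]
        refine Finset.sum_congr rfl fun k _ => ?_
        obtain ⟨_, _, h1⟩ := hψ k
        obtain ⟨_, _, h2⟩ := hχ k
        obtain ⟨_, _, u1⟩ := hu.1 _ (hg k)
        obtain ⟨_, _, u2⟩ := hu.1 _ (ha k)
        obtain ⟨_, _, w1⟩ := hw.1 _ (hg k)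
        obtain ⟨_, _, w2⟩ := hw.1 _ (ha k)
        simp only [pullDifferential_add, add_mul]
        rw [integral_add (u1.integrable_mul h1) (w1.integrable_mul h1),
          integral_add (u2.integrable_mul h2) (w2.integrable_mul h2)]
        ring
      rw [e, hu.2, hw.2, add_zero]
  | smul r u _ hu =>
    refine ⟨fun h hh => ?_, ?_⟩
    · obtain ⟨C, hC, h1⟩ := hu.1 h hh
      exact ⟨|r| * C, by positivity, by rw [pullDifferential_smul]; exact h1.const_mul r⟩
    · have e : f.weakLinearisation a g v φ (r • u) = r * f.weakLinearisation a g v φ u := by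
        simp only [weakLinearisation, pullDifferential_smul, Finset.mul_sum, mul_assoc,
          integral_const_mul, mul_add, mul_neg]
      rw [e, hu.2, mul_zero]

/-- The tangent vectors of the space of discs that are differentiable satisfy the linearised
equations pointwise. -/
theorem linearisation_of_mem_tangent (ha : ∀ k, ContMDiff 𝓘(ℝ, E) 𝓘(ℝ, ℝ) ∞ (a k))
    (hg : ∀ k, ContMDiff 𝓘(ℝ, E) 𝓘(ℝ, ℝ) ∞ (g k)) (hv : ∀ k, v k = 1 ∨ v k = Complex.I)
    (heq : ∀ c : JDisc X J, ∀ z ∈ disc,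
      ∑ k, c.pull (a k) z * fderiv ℝ (c.pull (g k)) z (v k) = 0)
    {f : JDisc X J} {u : FieldAlong f} (hu : u ∈ tangent f)
    (hug : ∀ k, ContDiffOn ℝ 1 (f.pullDifferential (g k) u) disc)
    (hua : ∀ k, ContinuousOn (f.pullDifferential (a k) u) disc) {z : ℂ} (hz : z ∈ disc) :
    ∑ k, (f.pull (a k) z * fderiv ℝ (f.pullDifferential (g k) u) z (v k)
      + f.pullDifferential (a k) u z * fderiv ℝ (f.pull (g k)) z (v k)) = 0 := by
  have hc1 : ∀ k, ContinuousOn (fun z => f.pull (a k) z *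
      fderiv ℝ (f.pullDifferential (g k) u) z (v k)) disc := fun k =>
    (f.contDiffOn_pull (ha k)).continuousOn.mul
      (((hug k).continuousOn_fderiv_of_isOpen isOpen_disc (by simp)).clm_apply continuousOn_const)
  have hc2 : ∀ k, ContinuousOn (fun z => f.pullDifferential (a k) u z *
      fderiv ℝ (f.pull (g k)) z (v k)) disc := fun k =>
    (hua k).mul (((f.contDiffOn_pull (hg k)).continuousOn_fderiv_of_isOpen isOpen_disc
      (by simp)).clm_apply continuousOn_const)
  let F : ℂ → ℝ := fun z => ∑ k, (f.pull (a k) z * fderiv ℝ (f.pullDifferential (g k) u) z (v k)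
      + f.pullDifferential (a k) u z * fderiv ℝ (f.pull (g k)) z (v k))
  have hF : ContinuousOn F disc := continuousOn_finsetSum _ fun k _ => (hc1 k).add (hc2 k)
  have h0 := ae_eq_zero_of_integral_mul_eq_zero (f := F)
    (hF.locallyIntegrableOn isOpen_disc.measurableSet) fun φ hφ hcs hs => by
      have hφ1 : ContDiff ℝ 1 φ := hφ.of_le (by norm_cast)
      have hint : ∀ {w : ℂ → ℝ}, ContinuousOn w disc →
          Integrable (fun z => w z * φ z) (volume.restrict (disc : Set ℂ)) := fun hw =>
        ((continuous_mul_of_tsupport_subset hw hφ.continuous hs).integrable_of_hasCompactSupport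
          hcs.mul_left).restrict
      rw [← weakLinearisation_eq_zero_of_mem_tangent ha hg hv heq hu hφ1 hcs hs]
      simp only [F, weakLinearisation, Finset.sum_mul]
      have hi : ∀ k ∈ (Finset.univ : Finset κ), Integrable (fun z =>
          (f.pull (a k) z * fderiv ℝ (f.pullDifferential (g k) u) z (v k)
            + f.pullDifferential (a k) u z * fderiv ℝ (f.pull (g k)) z (v k)) * φ z)
          (volume.restrict (disc : Set ℂ)) := fun k _ => hint ((hc1 k).add (hc2 k))
      rw [integral_finsetSum _ hi]
      refine Finset.sum_congr rfl fun k _ => ?_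
      rw [integral_mul_fderiv_of_contDiffOn (hug k)
        (contDiff_mul_of_tsupport_subset (f.contDiffOn_pull (ha k)) hφ1 hs) hcs.mul_left
        (tsupport_mul_subset_right.trans hs), neg_neg]
      have i1 := hint (hc1 k)
      have i2 := hint (hc2 k)
      simp only [add_mul]
      rw [integral_add i1 i2]
      congr 2
      · funext z; ring
      · funext z; ring
  have h1 : Set.EqOn F (fun _ => 0) disc :=
    Measure.eqOn_open_of_ae_eq ((ae_restrict_iff' isOpen_disc.measurableSet).2 h0) isOpen_disc hF
      continuousOn_const
  exact h1 hz

end Linearisation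

end JDisc

end

section

/-! ### Charts -/

lemma hasMFDerivAt_disc_val (ζ : disc) :
    HasMFDerivAt 𝓘(ℝ, ℂ) 𝓘(ℝ, ℂ) (Subtype.val : disc → ℂ) ζ (ContinuousLinearMap.id ℝ ℂ) := by
  refine ⟨continuous_subtype_val.continuousAt, ?_⟩
  have h := TopologicalSpace.Opens.chartAt_subtype_val_symm_eventuallyEq (H := ℂ) disc (x := ζ)
  have h2 : (writtenInExtChartAt 𝓘(ℝ, ℂ) 𝓘(ℝ, ℂ) ζ (Subtype.val : disc → ℂ))
      =ᶠ[𝓝 (extChartAt 𝓘(ℝ, ℂ) ζ ζ)] id := by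
    have h3 : extChartAt 𝓘(ℝ, ℂ) ζ ζ = chartAt ℂ ζ.val ζ.val := by
      simp [TopologicalSpace.Opens.chartAt_eq]
    rw [h3]
    filter_upwards [h] with z hz
    simp only [chartAt_self_eq] at hz
    simpa [writtenInExtChartAt, chartAt_self_eq] using hz.symm
  exact ((hasFDerivAt_id _).congr_of_eventuallyEq h2).hasFDerivWithinAt

variable {E : Type*} [NormedAddCommGroup E] [NormedSpace ℝ E]
  {M : Type*} [TopologicalSpace M] [ChartedSpace E M] [IsManifold 𝓘(ℝ, E) ∞ M]
  {X : SmoothnessClass} {J : AlmostComplexStructure E M}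

/-- The differential of the chart at `x₀`. -/
def chartDeriv (x₀ x : M) : TangentSpace 𝓘(ℝ, E) x →L[ℝ] E :=
  mfderiv 𝓘(ℝ, E) 𝓘(ℝ, E) (extChartAt 𝓘(ℝ, E) x₀) x

/-- The differential of the inverse of the chart at `x₀`. -/
def chartSymmDeriv (x₀ : M) (y : E) :
    E →L[ℝ] TangentSpace 𝓘(ℝ, E) ((extChartAt 𝓘(ℝ, E) x₀).symm y) :=
  mfderiv 𝓘(ℝ, E) 𝓘(ℝ, E) (extChartAt 𝓘(ℝ, E) x₀).symm y

lemma isManifold_one : IsManifold 𝓘(ℝ, E) 1 M :=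
  IsManifold.of_le (n := ∞) (by norm_cast)

section
variable {x₀ : M}

lemma hasMFDerivAt_chart_symm {y : E} (hy : y ∈ (extChartAt 𝓘(ℝ, E) x₀).target) :
    HasMFDerivAt 𝓘(ℝ, E) 𝓘(ℝ, E) (extChartAt 𝓘(ℝ, E) x₀).symm y (chartSymmDeriv x₀ y) := by
  have : IsManifold 𝓘(ℝ, E) 1 M := isManifold_one
  have := mdifferentiableWithinAt_extChartAt_symm (I := 𝓘(ℝ, E)) hy
  rw [ModelWithCorners.range_eq_univ, mdifferentiableWithinAt_univ] at this
  exact this.hasMFDerivAt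

lemma hasMFDerivAt_chart {x : M} (hx : x ∈ (extChartAt 𝓘(ℝ, E) x₀).source) :
    HasMFDerivAt 𝓘(ℝ, E) 𝓘(ℝ, E) (extChartAt 𝓘(ℝ, E) x₀) x (chartDeriv x₀ x) := by
  have : IsManifold 𝓘(ℝ, E) 1 M := isManifold_one
  rw [extChartAt_source] at hx
  exact (mdifferentiableAt_extChartAt hx).hasMFDerivAt

lemma chartDeriv_chartSymmDeriv {y : E} (hy : y ∈ (extChartAt 𝓘(ℝ, E) x₀).target) (w : E) :
    chartDeriv x₀ ((extChartAt 𝓘(ℝ, E) x₀).symm y) (chartSymmDeriv x₀ y w) = w := by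
  have : IsManifold 𝓘(ℝ, E) 1 M := isManifold_one
  have := mfderiv_extChartAt_comp_mfderivWithin_extChartAt_symm (I := 𝓘(ℝ, E)) hy
  rw [ModelWithCorners.range_eq_univ, mfderivWithin_univ] at this
  exact DFunLike.congr_fun this w

lemma chartSymmDeriv_chartDeriv {y : E} (hy : y ∈ (extChartAt 𝓘(ℝ, E) x₀).target)
    (w : TangentSpace 𝓘(ℝ, E) ((extChartAt 𝓘(ℝ, E) x₀).symm y)) :
    chartSymmDeriv x₀ y (chartDeriv x₀ ((extChartAt 𝓘(ℝ, E) x₀).symm y) w) = w := by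
  have : IsManifold 𝓘(ℝ, E) 1 M := isManifold_one
  have := mfderivWithin_extChartAt_symm_comp_mfderiv_extChartAt (I := 𝓘(ℝ, E)) hy
  rw [ModelWithCorners.range_eq_univ, mfderivWithin_univ] at this
  exact DFunLike.congr_fun this w

end

namespace AlmostComplexStructure

variable (J : AlmostComplexStructure E M) (x₀ : M)

/-- The almost complex structure in the chart at `x₀`. -/
def inChart (y : E) : E →L[ℝ] E :=
  (chartDeriv x₀ ((extChartAt 𝓘(ℝ, E) x₀).symm y)).comp
    ((J.toFun ((extChartAt 𝓘(ℝ, E) x₀).symm y)).comp (chartSymmDeriv x₀ y))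

variable {x₀}

lemma chartSymmDeriv_inChart {y : E} (hy : y ∈ (extChartAt 𝓘(ℝ, E) x₀).target) (w : E) :
    chartSymmDeriv x₀ y (J.inChart x₀ y w) =
      J.toFun ((extChartAt 𝓘(ℝ, E) x₀).symm y) (chartSymmDeriv x₀ y w) :=
  chartSymmDeriv_chartDeriv hy _

lemma inChart_inChart {y : E} (hy : y ∈ (extChartAt 𝓘(ℝ, E) x₀).target) (w : E) :
    J.inChart x₀ y (J.inChart x₀ y w) = -w := by
  change chartDeriv x₀ _ (J.toFun _ (chartSymmDeriv x₀ y (J.inChart x₀ y w))) = -w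
  rw [chartSymmDeriv_inChart J hy, J.sq_eq_neg, map_neg, chartDeriv_chartSymmDeriv hy]

lemma inChart_chartDeriv {y : E} (hy : y ∈ (extChartAt 𝓘(ℝ, E) x₀).target)
    (w : TangentSpace 𝓘(ℝ, E) ((extChartAt 𝓘(ℝ, E) x₀).symm y)) :
    J.inChart x₀ y (chartDeriv x₀ _ w) = chartDeriv x₀ _ (J.toFun _ w) := by
  change chartDeriv x₀ _ (J.toFun _ (chartSymmDeriv x₀ y (chartDeriv x₀ _ w))) = _
  rw [chartSymmDeriv_chartDeriv hy]

/-- In the trivialisation at `x₀` of the endomorphism bundle, the section `J` is conjugated by the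
tangent trivialisations, which are the differentials of the chart and of its inverse. -/
lemma contDiffOn_inChart : ContDiffOn ℝ ∞ (J.inChart x₀) (extChartAt 𝓘(ℝ, E) x₀).target := by
  have : IsManifold 𝓘(ℝ, E) 1 M := isManifold_one
  have h1 := (Bundle.Trivialization.contMDiffOn_section_baseSet_iff (IB := 𝓘(ℝ, E)) (n := ∞)
    (s := J.toFun) (trivializationAt (E →L[ℝ] E)
      (fun x : M => TangentSpace 𝓘(ℝ, E) x →L[ℝ] TangentSpace 𝓘(ℝ, E) x) x₀)).1 J.smooth.contMDiffOn
  have h2 : ContMDiffOn 𝓘(ℝ, E) 𝓘(ℝ, E) ∞ (extChartAt 𝓘(ℝ, E) x₀).symm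
      (extChartAt 𝓘(ℝ, E) x₀).target := contMDiffOn_extChartAt_symm x₀
  have h3 := h1.comp h2 fun y hy => by
    have := (extChartAt 𝓘(ℝ, E) x₀).map_target hy
    rw [extChartAt_source] at this
    simpa using this
  rw [← contMDiffOn_iff_contDiffOn]
  refine h3.congr fun y hy => ?_
  have hx := (extChartAt 𝓘(ℝ, E) x₀).map_target hy
  rw [extChartAt_source] at hx
  have e1 := TangentBundle.continuousLinearMapAt_trivializationAt (I := 𝓘(ℝ, E)) hx
  have e2 := TangentBundle.symmL_trivializationAt (I := 𝓘(ℝ, E)) hx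
  rw [ModelWithCorners.range_eq_univ, mfderivWithin_univ,
    (extChartAt 𝓘(ℝ, E) x₀).right_inv hy] at e2
  change J.inChart x₀ y = ContinuousLinearMap.inCoordinates E (TangentSpace 𝓘(ℝ, E)) E
    (TangentSpace 𝓘(ℝ, E)) x₀ _ x₀ _ _
  rw [ContinuousLinearMap.inCoordinates, e1, e2]
  rfl

end AlmostComplexStructure

end

/-! ### Differentials of global functions, read in a chart. -/

section

variable {E : Type*} [NormedAddCommGroup E] [NormedSpace ℝ E]
  {M : Type*} [TopologicalSpace M] [ChartedSpace E M] [IsManifold 𝓘(ℝ, E) ∞ M]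
  {X : SmoothnessClass} {J : AlmostComplexStructure E M} {x₀ : M}

lemma contDiffOn_comp_chart_symm {h : M → ℝ} (hh : ContMDiff 𝓘(ℝ, E) 𝓘(ℝ, ℝ) ∞ h) (x₀ : M) :
    ContDiffOn ℝ ∞ (fun y => h ((extChartAt 𝓘(ℝ, E) x₀).symm y))
      (extChartAt 𝓘(ℝ, E) x₀).target := by
  rw [← contMDiffOn_iff_contDiffOn]
  exact hh.comp_contMDiffOn (contMDiffOn_extChartAt_symm x₀)

lemma differential_chartSymmDeriv {h : M → ℝ} (hh : ContMDiff 𝓘(ℝ, E) 𝓘(ℝ, ℝ) ∞ h) {y : E}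
    (hy : y ∈ (extChartAt 𝓘(ℝ, E) x₀).target) (w : E) :
    differential h ((extChartAt 𝓘(ℝ, E) x₀).symm y) (chartSymmDeriv x₀ y w) =
      fderiv ℝ (fun y => h ((extChartAt 𝓘(ℝ, E) x₀).symm y)) y w := by
  have h1 := ((hh _).mdifferentiableAt (by simp)).hasMFDerivAt.comp y (hasMFDerivAt_chart_symm hy)
  have h2 := h1.mfderiv
  rw [mfderiv_eq_fderiv] at h2
  exact (DFunLike.congr_fun h2 w).symm

lemma differential_eq_of_eventuallyEq_chart {h : M → ℝ} {ℓ : E →L[ℝ] ℝ} {x : M}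
    (hx : x ∈ (extChartAt 𝓘(ℝ, E) x₀).source)
    (hh : h =ᶠ[𝓝 x] fun x => ℓ (extChartAt 𝓘(ℝ, E) x₀ x)) (w : TangentSpace 𝓘(ℝ, E) x) :
    differential h x w = ℓ (chartDeriv x₀ x w) := by
  have h1 : HasMFDerivAt 𝓘(ℝ, E) 𝓘(ℝ, ℝ) (fun x => ℓ (extChartAt 𝓘(ℝ, E) x₀ x)) x
      (ℓ.comp (chartDeriv x₀ x)) :=
    (ℓ.hasFDerivAt.hasMFDerivAt).comp x (hasMFDerivAt_chart hx)
  have h2 := (h1.congr_of_eventuallyEq hh).mfderiv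
  exact DFunLike.congr_fun h2 w

/-- A point equals the inverse chart of its coordinates only propositionally, so the base point of
the tangent vector is left free here. -/
lemma AlmostComplexStructure.inChart_chartDeriv_of_eq (J : AlmostComplexStructure E M) {x : M}
    {y : E} (hx : x = (extChartAt 𝓘(ℝ, E) x₀).symm y) (hy : y ∈ (extChartAt 𝓘(ℝ, E) x₀).target)
    (w : TangentSpace 𝓘(ℝ, E) x) :
    J.inChart x₀ y (chartDeriv x₀ x w) = chartDeriv x₀ x (J.toFun x w) := by
  subst hx
  exact J.inChart_chartDeriv hy w

lemma JDisc.hasMFDerivAt (c : JDisc X J) (ζ : disc) : HasMFDerivAt 𝓘(ℝ, ℂ) 𝓘(ℝ, E) c.toFun ζ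
    (mfderiv 𝓘(ℝ, ℂ) 𝓘(ℝ, E) c.toFun ζ) :=
  ((c.contMDiff ζ).mdifferentiableAt one_ne_zero).hasMFDerivAt

lemma JDisc.fderiv_pull (c : JDisc X J) {h : M → ℝ} (hh : ContMDiff 𝓘(ℝ, E) 𝓘(ℝ, ℝ) ∞ h)
    (ζ : disc) (v : ℂ) : fderiv ℝ (c.pull h) ζ v =
      differential h (c.toFun ζ) (mfderiv 𝓘(ℝ, ℂ) 𝓘(ℝ, E) c.toFun ζ v) := by
  have h1 := ((hh (c.toFun ζ)).mdifferentiableAt (by simp)).hasMFDerivAt.comp ζ (c.hasMFDerivAt ζ)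
  have hd : DifferentiableAt ℝ (c.pull h) ζ :=
    ((c.contDiffOn_pull hh).contDiffAt (isOpen_disc.mem_nhds ζ.2)).differentiableAt (by simp)
  have h2 := (hd.hasFDerivAt.hasMFDerivAt).comp ζ (hasMFDerivAt_disc_val ζ)
  have e : c.pull h ∘ Subtype.val = h ∘ c.toFun := funext fun ζ =>
    extendByZero_apply (fun ζ => h (JDisc.eval ζ c)) ζ
  rw [e] at h2
  exact DFunLike.congr_fun (hasMFDerivAt_unique h2 h1) v

/-! ### Discs in a chart -/

lemma SmoothnessClass.one_le_order (X : SmoothnessClass) : 1 ≤ X.order := by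
  cases X with
  | holder k α hk hα₀ hα₁ => exact Nat.le_add_left 1 k
  | sobolev k p hk hp => exact hk

/-- The disc which is given by the map `y` in the chart at `x₀`. -/
def JDisc.ofChart (X : SmoothnessClass) (J : AlmostComplexStructure E M) (x₀ : M) (y : ℂ → E)
    (hy : ContDiff ℝ X.order y) (ht : ∀ z, y z ∈ (extChartAt 𝓘(ℝ, E) x₀).target)
    (hCR : ∀ z ∈ disc, fderiv ℝ y z Complex.I = J.inChart x₀ (y z) (fderiv ℝ y z 1)) :
    JDisc X J where
  toFun ζ := (extChartAt 𝓘(ℝ, E) x₀).symm (y ζ)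
  contMDiff := by
    have h1 : ContMDiffOn 𝓘(ℝ, E) 𝓘(ℝ, E) 1 (extChartAt 𝓘(ℝ, E) x₀).symm
      (extChartAt 𝓘(ℝ, E) x₀).target :=
        (contMDiffOn_extChartAt_symm (n := ∞) x₀).of_le (by norm_cast)
    have h2 : ContMDiff 𝓘(ℝ, ℂ) 𝓘(ℝ, E) 1 fun ζ : disc => y ζ :=
      ((hy.of_le (by exact_mod_cast X.one_le_order)).contMDiff).comp contMDiff_subtype_val
    exact h1.comp_contMDiff h2 fun ζ => ht ζ
  cauchyRiemann ζ v := by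
    have hd : HasFDerivAt y (fderiv ℝ y ζ) ζ := (hy.differentiable
      (by have := X.one_le_order; norm_cast; omega) (ζ : ℂ)).hasFDerivAt
    have h : HasMFDerivAt 𝓘(ℝ, ℂ) 𝓘(ℝ, E)
        (fun ζ : disc => (extChartAt 𝓘(ℝ, E) x₀).symm (y ζ)) ζ
        ((chartSymmDeriv x₀ (y ζ)).comp
          ((fderiv ℝ y ζ).comp (ContinuousLinearMap.id ℝ ℂ))) :=
      (hasMFDerivAt_chart_symm (ht ζ)).comp ζ (hd.hasMFDerivAt.comp ζ (hasMFDerivAt_disc_val ζ))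
    rw [h.mfderiv]
    change chartSymmDeriv x₀ (y ζ) (fderiv ℝ y ζ (Complex.I * v)) =
      J.toFun _ (chartSymmDeriv x₀ (y ζ) (fderiv ℝ y ζ v))
    rw [← J.chartSymmDeriv_inChart (ht ζ)]
    congr 1
    -- The hypothesis concerns the direction `1` only; real linearity together with `J² = -1` gives
    -- all directions.
    have e : ∀ w : ℂ, w = w.re • (1 : ℂ) + w.im • Complex.I := fun w => by
      simp
    have e2 : ∀ w : ℂ, fderiv ℝ y ζ w =
        w.re • fderiv ℝ y ζ 1 + w.im • J.inChart x₀ (y ζ) (fderiv ℝ y ζ 1) := fun w => by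
      conv_lhs => rw [e w]
      rw [map_add, map_smul, map_smul, hCR ζ ζ.2]
    rw [e2 (Complex.I * v), e2 v, map_add, map_smul, map_smul, J.inChart_inChart (ht ζ)]
    simp only [Complex.mul_re, Complex.mul_im, Complex.I_re, Complex.I_im]
    module
  memClass h hh := by
    refine X.exists_normLE (G := fun z => h ((extChartAt 𝓘(ℝ, E) x₀).symm (y z))) ?_
    exact ((contDiffOn_comp_chart_symm hh x₀).of_le (by norm_cast; exact le_top)).comp_contDiff hy ht

/-- Every global test function becomes, along the family, a function of `(t, z)` with one derivative
more than the class needs, and its difference quotients converge by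
`SmoothnessClass.normLE_quotientRemainder`. -/
lemma JDisc.hasVelocity_ofChart {Y : ℝ × ℂ → E} (hY : ContDiff ℝ (X.order + 1) Y)
    (ht : ∀ p, Y p ∈ (extChartAt 𝓘(ℝ, E) x₀).target)
    (hc : ∀ t : ℝ, ContDiff ℝ X.order fun z => Y (t, z))
    (hCR : ∀ t : ℝ, ∀ z ∈ disc, fderiv ℝ (fun z => Y (t, z)) z Complex.I =
      J.inChart x₀ (Y (t, z)) (fderiv ℝ (fun z => Y (t, z)) z 1)) :
    HasVelocity (fun t => JDisc.ofChart X J x₀ (fun z => Y (t, z)) (hc t) (fun z => ht (t, z)) (hCR t))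
      (JDisc.ofChart X J x₀ (fun z => Y (0, z)) (hc 0) (fun z => ht (0, z)) (hCR 0))
      (fun ζ => chartSymmDeriv x₀ (Y (0, ζ)) (fderiv ℝ Y (0, ζ) (1, 0))) := by
  refine ⟨rfl, fun h hh => ?_⟩
  let H : ℝ × ℂ → ℝ := fun p => h ((extChartAt 𝓘(ℝ, E) x₀).symm (Y p))
  have hh' := contDiffOn_comp_chart_symm hh x₀
  have hH : ContDiff ℝ (X.order + 1) H :=
    (hh'.of_le (by norm_cast; exact le_top)).comp_contDiff hY ht
  have hne : ((X.order + 1 : ℕ) : WithTop ℕ∞) ≠ 0 := by norm_cast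
  have hfd : ∀ ζ : disc, fderiv ℝ H (0, ζ) (1, 0) = differential h
      ((extChartAt 𝓘(ℝ, E) x₀).symm (Y (0, ζ)))
      (chartSymmDeriv x₀ (Y (0, ζ)) (fderiv ℝ Y (0, ζ) (1, 0))) := by
    intro ζ
    rw [differential_chartSymmDeriv hh (ht _)]
    have h1 : DifferentiableAt ℝ (fun y => h ((extChartAt 𝓘(ℝ, E) x₀).symm y)) (Y (0, ζ)) :=
      (hh'.contDiffAt ((isOpen_extChartAt_target x₀).mem_nhds (ht _))).differentiableAt (by simp)
    have h2 : DifferentiableAt ℝ Y (0, (ζ : ℂ)) :=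
      hY.differentiable (by exact_mod_cast hne) _
    have := fderiv_comp (0, (ζ : ℂ)) h1 h2
    exact DFunLike.congr_fun this (1, 0)
  refine ⟨fun ζ => ?_, fun ε hε => ?_⟩
  · have h1 : HasDerivAt (fun t : ℝ => (t, (ζ : ℂ))) ((1 : ℝ), (0 : ℂ)) 0 :=
      (hasDerivAt_id 0).prodMk (hasDerivAt_const 0 (ζ : ℂ))
    have h2 := (hH.differentiable (by exact_mod_cast hne)
      (0, (ζ : ℂ))).hasFDerivAt.comp_hasDerivAt (0 : ℝ) h1
    rw [hfd ζ] at h2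
    exact h2
  · filter_upwards [X.normLE_quotientRemainder hH hε] with t ht
    simp only [quotientRemainder, hfd] at ht
    exact ht

end

section

variable {E : Type*} [NormedAddCommGroup E] [NormedSpace ℝ E]
  {M : Type*} [TopologicalSpace M] [ChartedSpace E M] [IsManifold 𝓘(ℝ, E) ∞ M]
  {X : SmoothnessClass} {J : AlmostComplexStructure E M} {x₀ : M}

/-! ### The linearised Cauchy–Riemann equation in a chart -/

lemma JDisc.eqOn_pull {f : JDisc X J} {y : ℂ → E}
    (hf : ∀ ζ : disc, f.toFun ζ = (extChartAt 𝓘(ℝ, E) x₀).symm (y ζ)) {h : M → ℝ} {H : E → ℝ}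
    (hH : ∀ z ∈ disc, (fun y => h ((extChartAt 𝓘(ℝ, E) x₀).symm y)) =ᶠ[𝓝 (y z)] H) :
    Set.EqOn (f.pull h) (fun z => H (y z)) disc := fun z hz => by
  refine (extendByZero_apply (fun ζ => h (JDisc.eval ζ f)) ⟨z, hz⟩).trans ?_
  beta_reduce
  rw [← (hH z hz).eq_of_nhds, ← hf ⟨z, hz⟩]
  rfl

lemma JDisc.eqOn_pullDifferential {f : JDisc X J} {u : FieldAlong f} {y η : ℂ → E}
    (hu : ∀ h : M → ℝ, ContMDiff 𝓘(ℝ, E) 𝓘(ℝ, ℝ) ∞ h → ∀ ζ : disc,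
      differential h (eval ζ f) (u ζ) =
        fderiv ℝ (fun y => h ((extChartAt 𝓘(ℝ, E) x₀).symm y)) (y ζ) (η ζ))
    {h : M → ℝ} (hh : ContMDiff 𝓘(ℝ, E) 𝓘(ℝ, ℝ) ∞ h) {H : E → ℝ}
    (hH : ∀ z ∈ disc, (fun y => h ((extChartAt 𝓘(ℝ, E) x₀).symm y)) =ᶠ[𝓝 (y z)] H) :
    Set.EqOn (f.pullDifferential h u) (fun z => fderiv ℝ H (y z) (η z)) disc := fun z hz => by
  refine (extendByZero_apply (fun ζ => differential h (eval ζ f) (u ζ)) ⟨z, hz⟩).trans ?_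
  beta_reduce
  rw [← (hH z hz).fderiv_eq]
  exact hu h hh ⟨z, hz⟩

lemma fderiv_eq_of_eqOn_disc {F G : ℂ → ℝ} (h : Set.EqOn F G disc) {z : ℂ} (hz : z ∈ disc) :
    fderiv ℝ F z = fderiv ℝ G z :=
  (h.eventuallyEq_of_mem (isOpen_disc.mem_nhds hz)).fderiv_eq

section Basis

variable [FiniteDimensional ℝ E]

/-- The coordinate functions of `E`. -/
def coordinate (i : Fin (Module.finrank ℝ E)) : E →L[ℝ] ℝ :=
  LinearMap.toContinuousLinearMap ((Module.finBasis ℝ E).coord i)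

lemma sum_coordinate_apply (ℓ : E →L[ℝ] ℝ) (T : E →L[ℝ] E) (w : E) :
    ∑ j, ℓ (T (Module.finBasis ℝ E j)) * coordinate j w = ℓ (T w) := by
  conv_rhs => rw [← (Module.finBasis ℝ E).sum_repr w]
  simp only [map_sum, map_smul, smul_eq_mul]
  refine Finset.sum_congr rfl fun j _ => ?_
  rw [mul_comm]
  rfl

lemma eq_of_coordinate_eq {w w' : E} (h : ∀ i, coordinate i w = coordinate i w') : w = w' :=
  (Module.finBasis ℝ E).ext_elem h

variable [T2Space M]

/-- The `j`-th coordinate of the chart at `x₀`, cut off by `ρ`. -/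
def cutoffCoordinate (ρ : SmoothBumpFunction 𝓘(ℝ, E) x₀) (j : Fin (Module.finrank ℝ E)) (x : M) : ℝ :=
  ρ x * coordinate j (extChartAt 𝓘(ℝ, E) x₀ x)

lemma contMDiff_cutoffCoordinate (ρ : SmoothBumpFunction 𝓘(ℝ, E) x₀)
    (j : Fin (Module.finrank ℝ E)) :
    ContMDiff 𝓘(ℝ, E) 𝓘(ℝ, ℝ) ∞ (cutoffCoordinate ρ j) :=
  ρ.contMDiff_smul ((coordinate j).contDiff.contMDiff.comp_contMDiffOn
    (contMDiffOn_extChartAt (x := x₀)))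

/-- The coefficients of the Cauchy–Riemann operator in the chart at `x₀`, cut off by `β`. -/
def cutoffCoefficient (J : AlmostComplexStructure E M) (β : SmoothBumpFunction 𝓘(ℝ, E) x₀)
    (i : Fin (Module.finrank ℝ E)) : Option (Fin (Module.finrank ℝ E)) → M → ℝ
  | none, x => β x
  | some j, x => β x * -coordinate i (J.inChart x₀ (extChartAt 𝓘(ℝ, E) x₀ x)
      (Module.finBasis ℝ E j))

lemma contMDiff_cutoffCoefficient (J : AlmostComplexStructure E M)
    (β : SmoothBumpFunction 𝓘(ℝ, E) x₀) (i : Fin (Module.finrank ℝ E))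
    (k : Option (Fin (Module.finrank ℝ E))) :
    ContMDiff 𝓘(ℝ, E) 𝓘(ℝ, ℝ) ∞ (cutoffCoefficient J β i k) := by
  cases k with
  | none => exact β.contMDiff
  | some j =>
    refine β.contMDiff_smul ?_
    have h1 : ContDiffOn ℝ ∞ (fun y => -coordinate i (J.inChart x₀ y (Module.finBasis ℝ E j)))
        (extChartAt 𝓘(ℝ, E) x₀).target :=
      ((coordinate i).contDiff.comp_contDiffOn
        (J.contDiffOn_inChart.clm_apply contDiffOn_const)).neg
    refine h1.contMDiffOn.comp (contMDiffOn_extChartAt (x := x₀)) fun x hx => ?_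
    rw [← extChartAt_source 𝓘(ℝ, E)] at hx
    exact (extChartAt 𝓘(ℝ, E) x₀).map_source hx

/-- The index of the coordinate that is differentiated. -/
def coordinateIndex {n : ℕ} (i : Fin n) : Option (Fin n) → Fin n
  | none => i
  | some j => j

/-- The direction of differentiation. -/
def direction {n : ℕ} : Option (Fin n) → ℂ
  | none => Complex.I
  | some _ => 1

/-- The Cauchy–Riemann equations in a chart, in terms of globally defined functions. -/
lemma JDisc.sum_cutoffCoefficient_mul_fderiv (c : JDisc X J)
    {ρ β : SmoothBumpFunction 𝓘(ℝ, E) x₀} (hρβ : ∀ x ∈ tsupport β, ρ =ᶠ[𝓝 x] 1)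
    (i : Fin (Module.finrank ℝ E)) {z : ℂ} (hz : z ∈ disc) :
    ∑ k, c.pull (cutoffCoefficient J β i k) z *
      fderiv ℝ (c.pull (cutoffCoordinate ρ (coordinateIndex i k))) z (direction k) = 0 := by
  obtain ⟨ζ, rfl⟩ : ∃ ζ : disc, (ζ : ℂ) = z := ⟨⟨z, hz⟩, rfl⟩
  set x := c.toFun ζ with hx
  have hp : ∀ h : M → ℝ, c.pull h ζ = h x := fun h =>
    extendByZero_apply (fun ζ => h (JDisc.eval ζ c)) ζ
  simp only [hp]
  rw [Fintype.sum_option]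
  simp only [cutoffCoefficient, coordinateIndex, direction]
  -- Outside the support of `β` every coefficient vanishes, which covers points of the disc outside
  -- the chart. On it `ρ` is locally one, so the cut-off coordinates are the true ones to first
  -- order.
  by_cases hβ : β x = 0
  · simp [hβ]
  have hxs : x ∈ tsupport β := subset_tsupport _ hβ
  have hsrc : x ∈ (extChartAt 𝓘(ℝ, E) x₀).source := β.tsupport_subset_extChartAt_source hxs
  have hloc : ∀ j, cutoffCoordinate ρ j =ᶠ[𝓝 x]
      fun x => coordinate j (extChartAt 𝓘(ℝ, E) x₀ x) := fun j => by
    filter_upwards [hρβ x hxs] with x' hx'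
    simp [cutoffCoordinate, hx']
  have hfd : ∀ j (v : ℂ), fderiv ℝ (c.pull (cutoffCoordinate ρ j)) ζ v =
      coordinate j (chartDeriv x₀ x (mfderiv 𝓘(ℝ, ℂ) 𝓘(ℝ, E) c.toFun ζ v)) := fun j v =>
    (c.fderiv_pull (contMDiff_cutoffCoordinate ρ j) ζ v).trans
      (differential_eq_of_eventuallyEq_chart hsrc (hloc j) _)
  have hcr : chartDeriv x₀ x (mfderiv 𝓘(ℝ, ℂ) 𝓘(ℝ, E) c.toFun ζ Complex.I) =
      J.inChart x₀ (extChartAt 𝓘(ℝ, E) x₀ x)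
        (chartDeriv x₀ x (mfderiv 𝓘(ℝ, ℂ) 𝓘(ℝ, E) c.toFun ζ (1 : ℂ))) := by
    have h1 := c.cauchyRiemann ζ 1
    rw [mul_one] at h1
    rw [J.inChart_chartDeriv_of_eq ((extChartAt 𝓘(ℝ, E) x₀).left_inv hsrc).symm
      ((extChartAt 𝓘(ℝ, E) x₀).map_source hsrc)]
    exact congrArg (chartDeriv x₀ x) h1
  rw [hfd, hcr, ← sum_coordinate_apply, Finset.mul_sum, ← Finset.sum_add_distrib]
  refine Finset.sum_eq_zero fun j _ => ?_
  rw [hfd]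
  ring

/-- A differentiable tangent vector of the space of discs satisfies the linearised
Cauchy–Riemann equation. -/
theorem JDisc.linearised_cauchyRiemann {ρ β : SmoothBumpFunction 𝓘(ℝ, E) x₀}
    (hρβ : ∀ x ∈ tsupport β, ρ =ᶠ[𝓝 x] 1) {f : JDisc X J} {u : FieldAlong f} (hu : u ∈ tangent f)
    {y η : ℂ → E} (hy : ContDiff ℝ 1 y) (hη : ContDiff ℝ 1 η)
    (hyt : ∀ z ∈ disc, y z ∈ (extChartAt 𝓘(ℝ, E) x₀).target)
    (hyβ : ∀ z ∈ disc, β =ᶠ[𝓝 ((extChartAt 𝓘(ℝ, E) x₀).symm (y z))] 1)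
    (hf : ∀ ζ : disc, f.toFun ζ = (extChartAt 𝓘(ℝ, E) x₀).symm (y ζ))
    (huη : ∀ h : M → ℝ, ContMDiff 𝓘(ℝ, E) 𝓘(ℝ, ℝ) ∞ h → ∀ ζ : disc,
      differential h (eval ζ f) (u ζ) =
        fderiv ℝ (fun y => h ((extChartAt 𝓘(ℝ, E) x₀).symm y)) (y ζ) (η ζ))
    {z : ℂ} (hz : z ∈ disc) :
    fderiv ℝ η z Complex.I = J.inChart x₀ (y z) (fderiv ℝ η z 1)
      + fderiv ℝ (J.inChart x₀) (y z) (η z) (fderiv ℝ y z 1) := by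
  have hsymm : ∀ z ∈ disc, ContinuousAt (extChartAt 𝓘(ℝ, E) x₀).symm (y z) := fun z hz =>
    continuousAt_extChartAt_symm'' (hyt z hz)
  -- Both cut-offs equal one in a neighbourhood of each point of the disc, so they may be ignored in
  -- values and in derivatives.
  have hnear : ∀ z ∈ disc, ∀ᶠ y' in 𝓝 (y z), y' ∈ (extChartAt 𝓘(ℝ, E) x₀).target ∧
      β ((extChartAt 𝓘(ℝ, E) x₀).symm y') = 1 ∧ ρ ((extChartAt 𝓘(ℝ, E) x₀).symm y') = 1 := by
    intro z hz
    have h1 := (hsymm z hz).eventually (hyβ z hz)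
    have hs : (extChartAt 𝓘(ℝ, E) x₀).symm (y z) ∈ tsupport β := subset_tsupport _ (by
      rw [Function.mem_support, (hyβ z hz).eq_of_nhds]; simp)
    have h2 := (hsymm z hz).eventually (hρβ _ hs)
    filter_upwards [h1, h2, (isOpen_extChartAt_target x₀).mem_nhds (hyt z hz)] with y' a b c
    exact ⟨c, a, b⟩
  have hcoord : ∀ j, ∀ z ∈ disc, (fun y => cutoffCoordinate ρ j
      ((extChartAt 𝓘(ℝ, E) x₀).symm y)) =ᶠ[𝓝 (y z)] coordinate j := fun j z hz => by
    filter_upwards [hnear z hz] with y' ⟨a, b, c⟩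
    rw [cutoffCoordinate, c, one_mul, (extChartAt 𝓘(ℝ, E) x₀).right_inv a]
  have hnone : ∀ i, ∀ z ∈ disc, (fun y => cutoffCoefficient J β i none
      ((extChartAt 𝓘(ℝ, E) x₀).symm y)) =ᶠ[𝓝 (y z)] fun _ => 1 := fun i z hz => by
    filter_upwards [hnear z hz] with y' ⟨a, b, c⟩
    exact b
  have hsome : ∀ i j, ∀ z ∈ disc, (fun y => cutoffCoefficient J β i (some j)
      ((extChartAt 𝓘(ℝ, E) x₀).symm y)) =ᶠ[𝓝 (y z)]
        fun y => -coordinate i (J.inChart x₀ y (Module.finBasis ℝ E j)) := fun i j z hz => by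
    filter_upwards [hnear z hz] with y' ⟨a, b, c⟩
    rw [cutoffCoefficient, b, one_mul, (extChartAt 𝓘(ℝ, E) x₀).right_inv a]
  have hJd : ∀ z ∈ disc, HasFDerivAt (J.inChart x₀) (fderiv ℝ (J.inChart x₀) (y z)) (y z) :=
    fun z hz => ((J.contDiffOn_inChart.contDiffAt ((isOpen_extChartAt_target x₀).mem_nhds
      (hyt z hz))).differentiableAt (by simp)).hasFDerivAt
  have hfd : ∀ i j, ∀ z ∈ disc, ∀ w, fderiv ℝ (fun y =>
      -coordinate i (J.inChart x₀ y (Module.finBasis ℝ E j))) (y z) w =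
        -coordinate i (fderiv ℝ (J.inChart x₀) (y z) w (Module.finBasis ℝ E j)) := by
    intro i j z hz w
    have h1 := ((coordinate i).hasFDerivAt.comp (y z)
      (((ContinuousLinearMap.apply ℝ E (Module.finBasis ℝ E j)).hasFDerivAt).comp (y z)
        (hJd z hz))).neg
    exact DFunLike.congr_fun h1.fderiv w
  have p1 : ∀ j, Set.EqOn (f.pull (cutoffCoordinate ρ j)) (fun z => coordinate j (y z)) disc :=
    fun j => eqOn_pull hf (hcoord j)
  have d1 : ∀ j, Set.EqOn (f.pullDifferential (cutoffCoordinate ρ j) u)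
      (fun z => coordinate j (η z)) disc := fun j z hz => by
    rw [eqOn_pullDifferential huη (contMDiff_cutoffCoordinate ρ j) (hcoord j) hz]
    simp only [ContinuousLinearMap.fderiv]
  have d2 : ∀ i, Set.EqOn (f.pullDifferential (cutoffCoefficient J β i none) u)
      (fun _ => 0) disc := fun i z hz => by
    rw [eqOn_pullDifferential huη (contMDiff_cutoffCoefficient J β i none) (hnone i) hz]
    simp
  have d3 : ∀ i j, Set.EqOn (f.pullDifferential (cutoffCoefficient J β i (some j)) u)
      (fun z => -coordinate i (fderiv ℝ (J.inChart x₀) (y z) (η z) (Module.finBasis ℝ E j)))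
      disc := fun i j z hz => by
    rw [eqOn_pullDifferential huη (contMDiff_cutoffCoefficient J β i (some j)) (hsome i j) hz]
    exact hfd i j z hz _
  have hdy : ∀ j v, fderiv ℝ (fun z => coordinate j (y z)) z v = coordinate j (fderiv ℝ y z v) :=
    fun j v => DFunLike.congr_fun ((coordinate j).hasFDerivAt.comp z
      (hy.differentiable one_ne_zero z).hasFDerivAt).fderiv v
  have hdη : ∀ j v, fderiv ℝ (fun z => coordinate j (η z)) z v = coordinate j (fderiv ℝ η z v) :=
    fun j v => DFunLike.congr_fun ((coordinate j).hasFDerivAt.comp z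
      (hη.differentiable one_ne_zero z).hasFDerivAt).fderiv v
  have hJc : ContinuousOn (fun z => fderiv ℝ (J.inChart x₀) (y z)) disc :=
    (J.contDiffOn_inChart.continuousOn_fderiv_of_isOpen (isOpen_extChartAt_target x₀)
      (by simp)).comp hy.continuous.continuousOn hyt
  refine eq_of_coordinate_eq fun i => ?_
  have key := linearisation_of_mem_tangent (f := f) (u := u)
    (a := cutoffCoefficient J β i) (g := fun k => cutoffCoordinate ρ (coordinateIndex i k))
    (v := direction) (contMDiff_cutoffCoefficient J β i)
    (fun k => contMDiff_cutoffCoordinate ρ _) (fun k => by cases k <;> simp [direction])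
    (fun c z hz => c.sum_cutoffCoefficient_mul_fderiv hρβ i hz) hu
    (fun k => (((coordinate _).contDiff.comp hη).contDiffOn).congr (d1 _))
    (fun k => by
      cases k with
      | none => exact continuousOn_const.congr (d2 i)
      | some j =>
        refine ContinuousOn.congr ?_ (d3 i j)
        exact ((coordinate i).continuous.comp_continuousOn
          ((hJc.clm_apply hη.continuous.continuousOn).clm_apply continuousOn_const)).neg) hz
  rw [Fintype.sum_option] at key
  simp only [coordinateIndex, direction, fderiv_eq_of_eqOn_disc (d1 _) hz,
    fderiv_eq_of_eqOn_disc (p1 _) hz, d2 i hz, d3 i _ hz, eqOn_pull hf (hnone i) hz,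
    eqOn_pull hf (hsome i _) hz, hdy, hdη, one_mul, zero_mul, add_zero, neg_mul] at key
  rw [Finset.sum_add_distrib, Finset.sum_neg_distrib, Finset.sum_neg_distrib,
    sum_coordinate_apply, sum_coordinate_apply] at key
  rw [map_add]
  linarith

end Basis

end

/-! ### The Nijenhuis form along families of discs. -/

section

variable {E : Type*} [NormedAddCommGroup E] [NormedSpace ℝ E]

/-- The Nijenhuis tensor of `J` at `p` in linear coordinates. -/
def nijenhuisForm (J : E → E →L[ℝ] E) (p ξ η : E) : E :=
  fderiv ℝ J p (J p ξ) η + J p (fderiv ℝ J p η ξ) - J p (fderiv ℝ J p ξ η)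
    - fderiv ℝ J p (J p η) ξ

lemma nijenhuisForm_smul (J : E → E →L[ℝ] E) (p ξ η : E) (a b : ℝ) :
    nijenhuisForm J p (a • ξ) (b • η) = (a * b) • nijenhuisForm J p ξ η := by
  simp only [nijenhuisForm, map_smul, _root_.smul_apply]
  module

lemma nijenhuisForm_congr {J J' : E → E →L[ℝ] E} {p : E} (h : J =ᶠ[𝓝 p] J') (ξ η : E) :
    nijenhuisForm J p ξ η = nijenhuisForm J' p ξ η := by
  rw [nijenhuisForm, nijenhuisForm, h.fderiv_eq, h.eq_of_nhds]

variable {M : Type*} [TopologicalSpace M] [ChartedSpace E M] [IsManifold 𝓘(ℝ, E) ∞ M]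
  {X : SmoothnessClass} {J : AlmostComplexStructure E M} {x₀ : M}

open JDisc

/-- If the evaluation maps are holomorphic, then the Nijenhuis tensor vanishes on the first
derivatives of a family of discs. -/
lemma nijenhuisForm_eq_zero_of_disc_family [FiniteDimensional ℝ E] [T2Space M]
    {𝒥 : AlmostComplexStructureOnDiscs X J} (h𝒥 : ∀ ζ : disc, 𝒥.EvalIsHolomorphic ζ)
    {ρ β : SmoothBumpFunction 𝓘(ℝ, E) x₀} (hρβ : ∀ x ∈ tsupport β, ρ =ᶠ[𝓝 x] 1)
    {n : ℕ} (hn : X.order + 1 ≤ n) {Y : ℝ × ℂ → E} (hY : ContDiff ℝ n Y)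
    (ht : ∀ p, Y p ∈ (extChartAt 𝓘(ℝ, E) x₀).target)
    (hβ : ∀ p, β =ᶠ[𝓝 ((extChartAt 𝓘(ℝ, E) x₀).symm (Y p))] 1)
    (hCR : ∀ (t : ℝ) (z : ℂ), ‖z‖ < 1 → fderiv ℝ Y (t, z) (0, Complex.I) =
      J.inChart x₀ (Y (t, z)) (fderiv ℝ Y (t, z) (0, 1))) :
    nijenhuisForm (J.inChart x₀) (Y 0) (fderiv ℝ Y 0 (0, 1)) (fderiv ℝ Y 0 (1, 0)) = 0 := by
  have hX := X.one_le_order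
  have hY2 : ContDiff ℝ 2 Y := hY.of_le (by norm_cast; omega)
  have hYd : Differentiable ℝ Y := hY2.differentiable (by simp)
  have hcurve : ∀ t : ℝ, ContDiff ℝ n fun z : ℂ => Y (t, z) := fun t =>
    hY.comp (contDiff_const.prodMk contDiff_id)
  have hcurve' : ∀ (t : ℝ) (z v : ℂ), fderiv ℝ (fun z => Y (t, z)) z v = fderiv ℝ Y (t, z) (0, v) :=
    fun t z v => DFunLike.congr_fun
      ((hYd (t, z)).hasFDerivAt.comp z (hasFDerivAt_prodMk_right t z)).fderiv v
  have hc : ∀ t : ℝ, ContDiff ℝ X.order fun z : ℂ => Y (t, z) := fun t =>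
    (hcurve t).of_le (by norm_cast; omega)
  have hCR' : ∀ t : ℝ, ∀ z ∈ disc, fderiv ℝ (fun z => Y (t, z)) z Complex.I =
      J.inChart x₀ (Y (t, z)) (fderiv ℝ (fun z => Y (t, z)) z 1) := fun t z hz => by
    rw [hcurve', hcurve']; exact hCR t z (mem_disc.1 hz)
  have hvel := hasVelocity_ofChart (X := X) (J := J) (hY.of_le (by norm_cast)) ht hc hCR'
  set f := JDisc.ofChart X J x₀ (fun z => Y (0, z)) (hc 0) (fun z => ht (0, z)) (hCR' 0) with hf
  set η : ℂ → E := fun z => fderiv ℝ Y (0, z) (1, 0) with hη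
  have hη1 : ContDiff ℝ 1 η :=
    ((hY2.fderiv_right (m := 1) (by norm_num)).comp
      (contDiff_const.prodMk contDiff_id)).clm_apply contDiff_const
  have hy1 : ContDiff ℝ 1 fun z : ℂ => Y (0, z) := (hcurve 0).of_le (by norm_cast; omega)
  have hJy : ContDiff ℝ 1 fun z : ℂ => J.inChart x₀ (Y (0, z)) :=
    (J.contDiffOn_inChart.of_le (by norm_cast)).comp_contDiff hy1 fun z => ht (0, z)
  have hJη1 : ContDiff ℝ 1 fun z => J.inChart x₀ (Y (0, z)) (η z) := hJy.clm_apply hη1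
  let u : FieldAlong f := fun ζ => chartSymmDeriv x₀ (Y (0, ζ)) (η ζ)
  have hu : u ∈ tangent f := Submodule.subset_span ⟨_, hvel⟩
  -- Here holomorphy of the evaluation maps enters: it determines `𝒥 u` at every `ζ` as `J` applied
  -- to `u ζ`. In particular `𝒥 u` inherits `C^1` regularity from the family.
  have hw : ∀ ζ : disc, (𝒥.toFun f ⟨u, hu⟩).1 ζ =
      chartSymmDeriv x₀ (Y (0, ζ)) (J.inChart x₀ (Y (0, ζ)) (η ζ)) := fun ζ => by
    rw [J.chartSymmDeriv_inChart (ht _)]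
    exact h𝒥 ζ f ⟨u, hu⟩
  have h0 : (0 : ℂ) ∈ disc := by rw [mem_disc]; simp
  have e1 := JDisc.linearised_cauchyRiemann hρβ hu hy1 hη1 (fun z _ => ht (0, z))
    (fun z _ => hβ (0, z)) (fun ζ => rfl)
    (fun h hh ζ => differential_chartSymmDeriv hh (ht (0, (ζ : ℂ))) (η ζ)) h0
  have e2 := JDisc.linearised_cauchyRiemann hρβ (𝒥.toFun f ⟨u, hu⟩).2 hy1 hJη1
    (fun z _ => ht (0, z)) (fun z _ => hβ (0, z)) (fun ζ => rfl)
    (fun h hh ζ => by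
      rw [hw ζ]; exact differential_chartSymmDeriv hh (ht (0, (ζ : ℂ))) _) h0
  have hJd : HasFDerivAt (J.inChart x₀) (fderiv ℝ (J.inChart x₀) (Y (0, 0))) (Y (0, 0)) :=
    ((J.contDiffOn_inChart.contDiffAt ((isOpen_extChartAt_target x₀).mem_nhds
      (ht _))).differentiableAt (by simp)).hasFDerivAt
  have hyd : HasFDerivAt (fun z : ℂ => Y (0, z)) (fderiv ℝ (fun z : ℂ => Y (0, z)) 0) 0 :=
    (hy1.differentiable one_ne_zero 0).hasFDerivAt
  have hd : ∀ v, fderiv ℝ (fun z => J.inChart x₀ (Y (0, z)) (η z)) 0 v =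
      J.inChart x₀ (Y (0, 0)) (fderiv ℝ η 0 v) +
      fderiv ℝ (J.inChart x₀) (Y (0, 0)) (fderiv ℝ Y (0, 0) (0, v)) (η 0) := fun v => by
    have h := ((hJd.comp (0 : ℂ) hyd).clm_apply (hη1.differentiable one_ne_zero 0).hasFDerivAt)
    rw [← hcurve']
    exact DFunLike.congr_fun h.fderiv v
  -- The equation for `η` eliminates its derivative in direction `I` from the equation for `Jη`. The
  -- derivative in direction `1` then occurs identically on both sides, leaving only terms with the
  -- derivative of `J`.
  rw [hd, hd, e1, hcurve'] at e2
  have hcr := hCR 0 0 (by simp)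
  rw [hcr, map_add, map_add] at e2
  have h00 : (0 : ℝ × ℂ) = (0, 0) := rfl
  have hη0 : η 0 = fderiv ℝ Y (0, 0) (1, 0) := rfl
  rw [hη0] at e2
  rw [nijenhuisForm, h00, sub_sub, sub_eq_zero, ← sub_eq_zero]
  rw [← sub_eq_zero] at e2
  rw [← e2]
  abel

end

/-! ### Vanishing of the Nijenhuis form at the centre of a chart. -/

section

variable {E : Type*} [NormedAddCommGroup E] [NormedSpace ℝ E]

lemma continuous_nijenhuisForm {J : E → E →L[ℝ] E} (hJ : ContDiff ℝ ∞ J) :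
    Continuous fun q : E × E × E => nijenhuisForm J q.1 q.2.1 q.2.2 := by
  have h0 : Continuous J := hJ.continuous
  have h1 : Continuous (fderiv ℝ J) := hJ.continuous_fderiv (by simp)
  unfold nijenhuisForm
  fun_prop

variable {M : Type*} [TopologicalSpace M] [ChartedSpace E M] [IsManifold 𝓘(ℝ, E) ∞ M]
  {X : SmoothnessClass} {J : AlmostComplexStructure E M} {x₀ : M}

open JDisc

/-- Arbitrary vectors `ξ`, `v` are limits of rescaled first derivatives of small families of discs
shrinking to `p`. On these the form vanishes, and it is bilinear and continuous. -/
theorem nijenhuisForm_inChart_eq_zero [FiniteDimensional ℝ E] [T2Space M]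
    {𝒥 : AlmostComplexStructureOnDiscs X J} (h𝒥 : ∀ ζ : disc, 𝒥.EvalIsHolomorphic ζ) (x₀ : M)
    (ξ v : E) : nijenhuisForm (J.inChart x₀) (extChartAt 𝓘(ℝ, E) x₀ x₀) ξ v = 0 := by
  set p := extChartAt 𝓘(ℝ, E) x₀ x₀ with hp
  let ρ : SmoothBumpFunction 𝓘(ℝ, E) x₀ := Classical.arbitrary _
  have hρ : {x | ρ =ᶠ[𝓝 x] 1} ∈ 𝓝 x₀ := eventually_eventually_nhds.2 ρ.eventuallyEq_one
  -- Nested cut-offs: `β` is supported where `ρ` is locally one, as the global form of the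
  -- Cauchy-Riemann system requires.
  obtain ⟨β, -, hβ⟩ := (SmoothBumpFunction.nhds_basis_tsupport (I := 𝓘(ℝ, E)) x₀).mem_iff.1 hρ
  have hβ1 : {x | β =ᶠ[𝓝 x] 1} ∈ 𝓝 x₀ := eventually_eventually_nhds.2 β.eventuallyEq_one
  have hU : (extChartAt 𝓘(ℝ, E) x₀).target ∩
      (extChartAt 𝓘(ℝ, E) x₀).symm ⁻¹' {x | β =ᶠ[𝓝 x] 1} ∈ 𝓝 p := by
    refine Filter.inter_mem (extChartAt_target_mem_nhds x₀) ?_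
    have := continuousAt_extChartAt_symm (I := 𝓘(ℝ, E)) x₀
    rw [ContinuousAt, extChartAt_to_inv] at this
    exact this hβ1
  obtain ⟨R, hR, hRU⟩ := Metric.nhds_basis_closedBall.mem_iff.1 hU
  let χ : ContDiffBump p := ⟨R / 2, R, by positivity, by linarith⟩
  -- A globally smooth coefficient for the existence theorem. It squares to `-1` only near `p`,
  -- which suffices: the existence theorem uses this at `p` alone, and the discs stay in the ball
  -- where `J'` is the given structure.
  let J' : E → E →L[ℝ] E := fun y => χ y • J.inChart x₀ y
  have hJ' : ContDiff ℝ ∞ J' := by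
    rw [contDiff_iff_contDiffAt]
    intro y
    by_cases hy : y ∈ (extChartAt 𝓘(ℝ, E) x₀).target
    · exact χ.contDiff.contDiffAt.smul
        (J.contDiffOn_inChart.contDiffAt ((isOpen_extChartAt_target x₀).mem_nhds hy))
    · have hy' : y ∉ tsupport χ := fun h => by
        rw [χ.tsupport_eq] at h
        exact hy (hRU h).1
      have h1 : J' =ᶠ[𝓝 y] fun _ => 0 := by
        filter_upwards [notMem_tsupport_iff_eventuallyEq.1 hy'] with y' h
        simp [J', h]
      exact contDiffAt_const.congr_of_eventuallyEq h1
  have hJJ' : ∀ y ∈ Metric.ball p (R / 2), J' y = J.inChart x₀ y := fun y hy => by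
    simp only [J']
    rw [χ.one_of_mem_closedBall (Metric.ball_subset_closedBall hy), one_smul]
  have hball : ∀ y ∈ Metric.ball p (R / 2), y ∈ (extChartAt 𝓘(ℝ, E) x₀).target ∩
      (extChartAt 𝓘(ℝ, E) x₀).symm ⁻¹' {x | β =ᶠ[𝓝 x] 1} := fun y hy =>
    hRU (Metric.ball_subset_closedBall (Metric.ball_subset_ball (by linarith) hy))
  have hpb : p ∈ Metric.ball p (R / 2) := Metric.mem_ball_self (by positivity)
  have hcongr : ∀ y ∈ Metric.ball p (R / 2), ∀ ξ η,
      nijenhuisForm J' y ξ η = nijenhuisForm (J.inChart x₀) y ξ η := fun y hy =>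
    nijenhuisForm_congr (Filter.eventually_of_mem (Metric.isOpen_ball.mem_nhds hy) hJJ')
  rw [← hcongr p hpb]
  obtain ⟨K, ε₀, hε₀, hF⟩ := WienerTorus.exists_disc_family (X.order + 6) (by omega) hJ' p
    (fun w => by rw [hJJ' p hpb]; exact J.inChart_inChart (hball p hpb).1 w) ξ v
  choose! F hFs hFK hFe hFx hFt using hF
  have hK : 0 ≤ K := (norm_nonneg _).trans (hFK 0 le_rfl hε₀.le 0)
  have hev : ∀ᶠ ε : ℝ in 𝓝[>] 0, 0 < ε ∧ ε ≤ ε₀ ∧ ε * K < R / 2 := by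
    have h1 : ∀ᶠ ε : ℝ in 𝓝[>] 0, ε * K < R / 2 := by
      have hc : Continuous fun ε : ℝ => ε * K := by fun_prop
      have := (hc.tendsto 0).mono_left (nhdsWithin_le_nhds (s := Set.Ioi 0))
      exact this.eventually_lt_const (by simpa using hR)
    have h2 : ∀ᶠ ε : ℝ in 𝓝[>] 0, ε ≤ ε₀ := by
      filter_upwards [Ioo_mem_nhdsGT hε₀] with ε h using h.2.le
    filter_upwards [h1, h2, self_mem_nhdsWithin] with ε a b c using ⟨c, b, a⟩
  -- Both derivatives of `p + ε F` carry a factor `ε`; by bilinearity the resulting `ε²` is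
  -- cancelled, so the limit below is not trivial.
  have hzero : ∀ᶠ ε : ℝ in 𝓝[>] 0, nijenhuisForm J' (p + ε • F ε 0)
      (fderiv ℝ (F ε) 0 (0, 1)) (fderiv ℝ (F ε) 0 (1, 0)) = 0 := by
    filter_upwards [hev] with ε ⟨h0, h1, h2⟩
    have hs := hFs ε h0.le h1
    let Y : ℝ × ℂ → E := fun q => p + ε • F ε q
    have hYs : ContDiff ℝ (X.order + 6 : ℕ) Y := contDiff_const.add (hs.const_smul ε)
    have hYb : ∀ q, Y q ∈ Metric.ball p (R / 2) := fun q => by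
      rw [Metric.mem_ball, dist_eq_norm, add_sub_cancel_left, norm_smul,
        Real.norm_of_nonneg h0.le]
      exact (mul_le_mul_of_nonneg_left (hFK ε h0.le h1 q) h0.le).trans_lt h2
    have hYd : ∀ q w, fderiv ℝ Y q w = ε • fderiv ℝ (F ε) q w := fun q w => by
      have hd : DifferentiableAt ℝ (F ε) q := hs.differentiable (by norm_cast) q
      exact DFunLike.congr_fun ((hd.hasFDerivAt.const_smul ε).const_add p).fderiv w
    have hz := nijenhuisForm_eq_zero_of_disc_family h𝒥 hβ (n := X.order + 6) (by omega) hYs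
      (fun q => (hball _ (hYb q)).1) (fun q => (hball _ (hYb q)).2) (fun t z hz => by
        have he := hFe ε h0.le h1 t z hz
        have hb := hYb (t, z)
        change fderiv ℝ (F ε) (t, z) (0, 1) + J' (Y (t, z)) _ = 0 at he
        rw [hJJ' _ hb] at he
        rw [hYd, hYd, map_smul, eq_neg_of_add_eq_zero_left he, map_neg,
          J.inChart_inChart (hball _ hb).1, neg_neg])
    rw [hYd, hYd, nijenhuisForm_smul, smul_eq_zero_iff_right (by positivity)] at hz
    rw [hcongr _ (hYb 0)]
    exact hz
  have hsq : ∀ {a : ℝ → E} {b : E}, (∀ ε, 0 ≤ ε → ε ≤ ε₀ → ‖a ε - b‖ ≤ K * ε) →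
      Filter.Tendsto a (𝓝[>] 0) (𝓝 b) := fun {a b} h => by
    rw [tendsto_iff_norm_sub_tendsto_zero]
    have hc : Continuous fun ε : ℝ => K * ε := by fun_prop
    have hl : Filter.Tendsto (fun ε : ℝ => K * ε) (𝓝[>] 0) (𝓝 0) := by
      simpa using (hc.tendsto 0).mono_left (nhdsWithin_le_nhds (s := Set.Ioi 0))
    refine squeeze_zero' (Filter.Eventually.of_forall fun _ => norm_nonneg _) ?_ hl
    filter_upwards [hev] with ε ⟨h0, h1, _⟩ using h ε h0.le h1
  have hlim := ((continuous_nijenhuisForm hJ').tendsto (p, ξ, v)).comp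
    ((hsq (a := fun ε => p + ε • F ε 0) fun ε h0 h1 => by
      rw [add_sub_cancel_left, norm_smul, Real.norm_of_nonneg h0, mul_comm]
      exact mul_le_mul_of_nonneg_right (hFK ε h0 h1 0) h0).prodMk_nhds
      ((hsq hFx).prodMk_nhds (hsq hFt)))
  exact tendsto_nhds_unique hlim (tendsto_const_nhds.congr' (hzero.mono fun ε h => h.symm))

/-! ### The Nijenhuis tensor in a chart -/

open VectorField

/-- The vector field `V` in the chart at `x₀`. -/
def fieldInChart (V : ∀ x : M, TangentSpace 𝓘(ℝ, E) x) (x₀ : M) (y : E) : E :=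
  chartDeriv x₀ _ (V ((extChartAt 𝓘(ℝ, E) x₀).symm y))

set_option linter.unusedSectionVars false in
lemma fieldInChart_self (V : ∀ x : M, TangentSpace 𝓘(ℝ, E) x) (x₀ : M) :
    fieldInChart V x₀ (extChartAt 𝓘(ℝ, E) x₀ x₀) = chartDeriv x₀ x₀ (V x₀) := by
  -- The two base points are equal but not definitionally so; a free `x` allows substitution despite
  -- the dependent types.
  have h : ∀ x, x = x₀ → (chartDeriv x₀ x (V x) : E) = chartDeriv x₀ x₀ (V x₀) := by
    rintro x rfl; rfl
  exact h _ (extChartAt_to_inv x₀)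

lemma mpullback_chart_symm_eq {V : ∀ x : M, TangentSpace 𝓘(ℝ, E) x} {y : E}
    (hy : y ∈ (extChartAt 𝓘(ℝ, E) x₀).target) :
    mpullback 𝓘(ℝ, E) 𝓘(ℝ, E) (extChartAt 𝓘(ℝ, E) x₀).symm V y = fieldInChart V x₀ y := by
  have : IsManifold 𝓘(ℝ, E) 1 M := isManifold_one
  have h1 := isInvertible_mfderivWithin_extChartAt_symm (I := 𝓘(ℝ, E)) hy
  rw [ModelWithCorners.range_eq_univ, mfderivWithin_univ] at h1
  have h2 := DFunLike.congr_fun h1.inverse_comp_self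
    (chartDeriv x₀ _ (V ((extChartAt 𝓘(ℝ, E) x₀).symm y)))
  have h3 := chartSymmDeriv_chartDeriv hy (V ((extChartAt 𝓘(ℝ, E) x₀).symm y))
  refine Eq.trans ?_ h2
  exact congrArg (mfderiv 𝓘(ℝ, E) 𝓘(ℝ, E) (extChartAt 𝓘(ℝ, E) x₀).symm y).inverse h3.symm

/-- The manifold bracket is defined as the pullback by the chart of the bracket of the coordinate
fields; the differential of the chart cancels the inverse in this pullback. -/
lemma mlieBracket_eq_chart (V W : ∀ x : M, TangentSpace 𝓘(ℝ, E) x) (x₀ : M) :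
    chartDeriv x₀ x₀ (mlieBracket 𝓘(ℝ, E) V W x₀) =
      lieBracket ℝ (fieldInChart V x₀) (fieldInChart W x₀) (extChartAt 𝓘(ℝ, E) x₀ x₀) := by
  have : IsManifold 𝓘(ℝ, E) 1 M := isManifold_one
  have hinv := isInvertible_mfderiv_extChartAt (I := 𝓘(ℝ, E))
    (mem_extChartAt_source (I := 𝓘(ℝ, E)) x₀)
  have hev : ∀ U : ∀ x : M, TangentSpace 𝓘(ℝ, E) x,
      mpullbackWithin 𝓘(ℝ, E) 𝓘(ℝ, E) (extChartAt 𝓘(ℝ, E) x₀).symm U (Set.range 𝓘(ℝ, E))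
        =ᶠ[𝓝 (extChartAt 𝓘(ℝ, E) x₀ x₀)] fieldInChart U x₀ := fun U => by
    rw [ModelWithCorners.range_eq_univ, mpullbackWithin_univ]
    filter_upwards [extChartAt_target_mem_nhds (I := 𝓘(ℝ, E)) x₀] with y hy
    exact mpullback_chart_symm_eq hy
  have hS : (extChartAt 𝓘(ℝ, E) x₀).symm ⁻¹' Set.univ ∩ Set.range 𝓘(ℝ, E) = Set.univ := by
    rw [Set.preimage_univ, Set.univ_inter, ModelWithCorners.range_eq_univ]
  refine (DFunLike.congr_fun hinv.self_comp_inverse _).trans ?_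
  rw [hS]
  exact (congrFun (lieBracketWithin_univ (𝕜 := ℝ) (E := E)) _).trans
    (Filter.EventuallyEq.lieBracket_vectorField_eq (E := E) (hev V) (hev W))

lemma differentiableAt_fieldInChart {V : ∀ x : M, TangentSpace 𝓘(ℝ, E) x}
    (hV : IsSmoothVectorField V) (x₀ : M) :
    DifferentiableAt ℝ (fieldInChart V x₀) (extChartAt 𝓘(ℝ, E) x₀ x₀) := by
  have : IsManifold 𝓘(ℝ, E) 1 M := isManifold_one
  have h1 := (Bundle.Trivialization.contMDiffOn_section_baseSet_iff (IB := 𝓘(ℝ, E)) (n := 1)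
    (s := V) (trivializationAt E (TangentSpace 𝓘(ℝ, E)) x₀)).1
      (ContMDiff.contMDiffOn (ContMDiff.of_le hV (by norm_cast)))
  have h2 : ContMDiffOn 𝓘(ℝ, E) 𝓘(ℝ, E) 1 (extChartAt 𝓘(ℝ, E) x₀).symm
      (extChartAt 𝓘(ℝ, E) x₀).target := contMDiffOn_extChartAt_symm x₀
  have hs : ∀ y ∈ (extChartAt 𝓘(ℝ, E) x₀).target,
      (extChartAt 𝓘(ℝ, E) x₀).symm y ∈ (chartAt E x₀).source := fun y hy => by
    rw [← extChartAt_source 𝓘(ℝ, E)]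
    exact (extChartAt 𝓘(ℝ, E) x₀).map_target hy
  have h3 := h1.comp h2 fun y hy => by simpa using hs y hy
  have h4 : ContDiffOn ℝ 1 (fieldInChart V x₀) (extChartAt 𝓘(ℝ, E) x₀).target := by
    rw [← contMDiffOn_iff_contDiffOn]
    refine h3.congr fun y hy => ?_
    have e1 := TangentBundle.continuousLinearMapAt_trivializationAt (I := 𝓘(ℝ, E)) (hs y hy)
    refine (DFunLike.congr_fun e1.symm (V ((extChartAt 𝓘(ℝ, E) x₀).symm y))).trans ?_
    rw [Bundle.Trivialization.continuousLinearMapAt_apply,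
      Bundle.Trivialization.linearMapAt_apply, if_pos (by simpa using hs y hy)]
    rfl
  exact (h4.contDiffAt (extChartAt_target_mem_nhds x₀)).differentiableAt (by simp)

/-- When the four brackets are expanded by the product rule, all derivatives of `V` and `W` cancel
because `J² = -1`. Only terms with the derivative of `J` remain, so the value depends on the fields
only through their values at `x₀`. -/
lemma AlmostComplexStructure.nijenhuis_eq (J : AlmostComplexStructure E M)
    {V W : ∀ x : M, TangentSpace 𝓘(ℝ, E) x} (hV : IsSmoothVectorField V)
    (hW : IsSmoothVectorField W) (x₀ : M) :
    chartDeriv x₀ x₀ (J.nijenhuis V W x₀) =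
      nijenhuisForm (J.inChart x₀) (extChartAt 𝓘(ℝ, E) x₀ x₀)
        (chartDeriv x₀ x₀ (V x₀)) (chartDeriv x₀ x₀ (W x₀)) := by
  have hp := mem_extChartAt_target (I := 𝓘(ℝ, E)) x₀
  have hx := (extChartAt_to_inv (I := 𝓘(ℝ, E)) x₀).symm
  rw [AlmostComplexStructure.nijenhuis, map_sub, map_sub, map_sub,
    ← J.inChart_chartDeriv_of_eq hx hp, ← J.inChart_chartDeriv_of_eq hx hp,
    mlieBracket_eq_chart, mlieBracket_eq_chart, mlieBracket_eq_chart, mlieBracket_eq_chart,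
    ← fieldInChart_self V, ← fieldInChart_self W]
  simp only [lieBracket]
  have hdV := differentiableAt_fieldInChart hV x₀
  have hdW := differentiableAt_fieldInChart hW x₀
  set p := extChartAt 𝓘(ℝ, E) x₀ x₀
  have hJ : ∀ U : ∀ x : M, TangentSpace 𝓘(ℝ, E) x, fieldInChart (J.apply U) x₀ =ᶠ[𝓝 p]
        fun y => J.inChart x₀ y (fieldInChart U x₀ y) := fun U => by
      filter_upwards [(isOpen_extChartAt_target x₀).mem_nhds hp] with y hy
      exact (J.inChart_chartDeriv hy _).symm
  have hdJ : HasFDerivAt (J.inChart x₀) (fderiv ℝ (J.inChart x₀) p) p :=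
    ((J.contDiffOn_inChart.contDiffAt ((isOpen_extChartAt_target x₀).mem_nhds
      hp)).differentiableAt (by simp)).hasFDerivAt
  have hfd : ∀ {U : E → E}, DifferentiableAt ℝ U p → ∀ w,
      fderiv ℝ (fun y => J.inChart x₀ y (U y)) p w =
        J.inChart x₀ p (fderiv ℝ U p w) + fderiv ℝ (J.inChart x₀) p w (U p) := fun hU w =>
    DFunLike.congr_fun (hdJ.clm_apply hU.hasFDerivAt).fderiv w
  rw [(hJ V).fderiv_eq, (hJ W).fderiv_eq, (hJ V).eq_of_nhds, (hJ W).eq_of_nhds]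
  simp only [hfd hdV, hfd hdW, nijenhuisForm, map_sub, map_add, J.inChart_inChart hp]
  abel

end

end PseudoHolomorphic

end

theorem proposition4p1
    {E : Type*} [NormedAddCommGroup E] [NormedSpace ℝ E] [FiniteDimensional ℝ E]
    {M : Type*} [TopologicalSpace M] [T2Space M] [SigmaCompactSpace M]
    [ChartedSpace E M] [IsManifold 𝓘(ℝ, E) ∞ M]
    (J : PseudoHolomorphic.AlmostComplexStructure E M)
    (X : PseudoHolomorphic.SmoothnessClass)
    (h : ∃ 𝒥 : PseudoHolomorphic.JDisc.AlmostComplexStructureOnDiscs X J,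
      ∀ ζ : PseudoHolomorphic.disc, 𝒥.EvalIsHolomorphic ζ) :
    J.IsIntegrable := by
  obtain ⟨𝒥, h𝒥⟩ := h
  intro V W hV hW x
  have : IsManifold 𝓘(ℝ, E) 1 M := PseudoHolomorphic.isManifold_one
  have hinv := isInvertible_mfderiv_extChartAt (I := 𝓘(ℝ, E)) (mem_extChartAt_source (I := 𝓘(ℝ, E)) x)
  -- The differential of the chart is invertible, so vanishing can be tested in coordinates.
  refine hinv.injective ?_
  rw [map_zero]
  exact (J.nijenhuis_eq hV hW x).trans
    (PseudoHolomorphic.nijenhuisForm_inChart_eq_zero h𝒥 x _ _)
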